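/- **Setting.** Let $q\ge 1$, $\epsilon=(-1)^q$, and let $\Lambda$ be a unital ring with involution over which the rank of finitely generated free modules is well defined. Fix a subgroup $Z$ of $\widetilde K_1(\Lambda)=\operatorname{coker}(K_1(\mathbb Z)\to K_1(\Lambda))$ that is invariant under $[f]\mapsto[f^*]$. A *based module* is a left module $M$ with (the class of) an $s$-basis, i.e. a basis of some $M\oplus\Lambda^m$; an isomorphism of based modules is *simple* if its torsion lies in $Z$; a short exact sequence $0\to A\to B\to C\to 0$ of based modules is *based* if the isomorphism $A\oplus C\cong B$ given by a section is simple. All modules are based. **Forms.** $Q_\epsilon(M)=\operatorname{coker}(1-T_\epsilon)$ on $\operatorname{Hom}(M,M^*)$, $T_\epsilon\chi=\epsilon\chi^*$. An *$\epsilon$-quadratic form* is a pair $(M,\psi)$, $\psi\in Q_\epsilon(M)$, with symmetrisation $\phi=\psi+\epsilon\psi^*$; it is *simple* if $\phi:M\to M^*$ is a simple isomorphism. Isometries are simple isomorphisms $f$ with $f^*\psi'f=\psi$. $H_\epsilon(P)=(P\oplus P^*,\begin{pmatrix}0&1\\0&0\end{pmatrix})$. A *simple Lagrangian* of a simple form $(M,\psi)$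 is a based direct summand $j:L\to M$ with $L=L^\perp=\ker(j^*\phi)$, $j^*\psi j=0\in Q_\epsilon(L)$ and $0\to L\to M\to L^*\to0$ based. $L^s_{2q}(\Lambda)$ is the set (group) of simple forms modulo $v\sim w$ if $v\oplus H_\epsilon(P)\cong w\oplus H_\epsilon(Q)$ for some $P,Q$; its zero is the class of the hyperbolic forms. $[v]$ denotes the class of a form $v$ modulo $v\sim w$ if $v\oplus(P,0)\cong w\oplus(Q,0)$ for some $P,Q$. **Quasi-formations.** A *quasi-formation* $(M,\psi;L,V)$ is a simple form $(M,\psi)$, a simple Lagrangian $L$ and a based half rank direct summand $V$. Isomorphisms are isometries that induce simple isomorphisms on $L$ and $V$. The monoid $l_{2q+1}(\Lambda)$ consists of the quasi-formations under direct sum modulo the congruence generated by isomorphism, by addition of trivial formations $(H_\epsilon(P);P,P^*)$, and by $(M,\psi;K,L)\oplus(M,\psi;L,V)\sim(M,\psi;K,V)$ for simple Lagrangians $K,L$. $L^s_{2q+1}(\Lambda)\subset l_{2q+1}(\Lambda)$ consists of the classes of those $(M,\psi;L,V)$ with $V$ a simple Lagrangian. An element of $l_{2q+1}(\Lambda)$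 is *elementary* if it is represented by some $(H_\epsilon(K);K,\begin{pmatrix}1\\ \rho\end{pmatrix}K)$ with $\rho\in\operatorname{Hom}(K,K^*)$. For a quasi-formation let $j:V\to M$ and $j^\perp:V^\perp\to M$ be the inclusions, $V^\perp=\ker(j^*\phi)$ based so that $0\to V^\perp\to M\to V^*\to0$ is based, $\theta=j^*\psi j$ and $\theta^\perp=(j^\perp)^*\psi j^\perp$. Put $b([M,\psi;L,V])=([V,\theta],[V^\perp,-\theta^\perp])$ and $l_{2q+1}(v,v)=b^{-1}([v],[v])$. **Boundaries.** A *split $(-\epsilon)$-quadratic formation* $(F,(\begin{pmatrix}\gamma\\ \mu\end{pmatrix},\theta)G)$ consists of $\gamma:G\to F$, $\mu:G\to F^*$ embedding $G$ as a simple Lagrangian of $H_{-\epsilon}(F)$, and $\theta\in Q_\epsilon(G)$ with $\gamma^*\mu=\theta+\epsilon\theta^*$. Examples: $\partial(K,\psi)=(K,(\begin{pmatrix}1\\ \psi+\epsilon\psi^*\end{pmatrix},\psi)K)$ and the trivial one $(P,P^*)=(P,(\begin{pmatrix}0\\1\end{pmatrix},0)P^*)$. An *isomorphism* to $(F',(\begin{pmatrix}\gamma'\\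 \mu'\end{pmatrix},\theta')G')$ is a triple $(\alpha,\beta,\nu)$ of simple isomorphisms $\alpha:F\to F'$, $\beta:G\to G'$ and $\nu\in Q_\epsilon(F^*)$ with $\alpha\gamma+\alpha(\nu+\epsilon\nu^*)^*\mu=\gamma'\beta$, $\alpha^{-*}\mu=\mu'\beta$, $\theta+\mu^*\nu\mu=\beta^*\theta'\beta$; composition is $(\alpha',\beta',\nu')\circ(\alpha,\beta,\nu)=(\alpha'\alpha,\beta'\beta,\nu+\alpha^{-1}\nu'\alpha^{-*})$. A *homotopy* $(\alpha,\beta,\nu)\simeq(\alpha',\beta',\nu')$ is a $\Delta:G^*\to F'$ with $\beta'^{-*}-\beta^{-*}=\mu'^*\Delta$, $\alpha'-\alpha=\Delta\mu^*$, $\alpha'\nu'\alpha'^*-\alpha\nu\alpha^*=(-\epsilon\alpha'\gamma+\Delta\theta)\Delta^*\in Q_\epsilon(F'^*)$. An isometry $h$ has boundary $\partial h=(h,h,0)$. A *stable isomorphism* $y\to z$ is an isomorphism $y\oplus(P,P^*)\cong z\oplus(P',P'^*)$; two stable isomorphisms $f_0,f_1$, with $f_i:y\oplus(P_i,P_i^*)\cong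 z\oplus(P_i',P_i'^*)$, are *stably homotopic* if there are $A,B,R_0,R_1$ and isomorphisms $g_i:(A,A^*)\cong(P_i,P_i^*)\oplus(R_i,R_i^*)$ and $h_i:(P_i',P_i'^*)\oplus(R_i,R_i^*)\cong(B,B^*)$ such that $(\mathrm{id}\oplus h_0)(f_0\oplus\mathrm{id})(\mathrm{id}\oplus g_0)\simeq(\mathrm{id}\oplus h_1)(f_1\oplus\mathrm{id})(\mathrm{id}\oplus g_1)$. $\mathrm{bIso}(v,v')$ is the set of stable homotopy classes of stable isomorphisms $\partial v\to\partial v'$ modulo $[f]\sim[\partial h\circ f\circ\partial g^{-1}]$ for $g\in\mathrm{Aut}(v)$, $h\in\mathrm{Aut}(v')$, and $\mathrm{sbAut}(v)=\varinjlim_Q\mathrm{bIso}(v\oplus(Q,0),v\oplus(Q,0))$ over the based modules $Q=(\Lambda^k,\mathcal B)$, with transition maps $[f]\mapsto[f\oplus\partial\mathrm{id}]$ and $1=[\partial\,\mathrm{id}]$. **The maps.** * For a quasi-formation choose a representative $\psi:M\to M^*$ and a section $\sigma$ of $(j^\perp)^*\phi:M\to(V^\perp)^*$. Then $h(x,w,u)=(c,\,j^\perp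 c+\sigma u+jx)$ with $c=w-\sigma^*\phi^*jx-\sigma^*\psi^*\sigma u$ is an isometry $(V,\theta)\oplus H_\epsilon(V^\perp)\cong(V^\perp,-\theta^\perp)\oplus(M,\psi)$. Composing $\partial h$ with the isomorphisms $(1,\phi,-\phi^{-*}\psi\phi^{-1}):\partial(M,\psi)\cong(M,M^*)$ and the inverse of the corresponding one for $H_\epsilon(V^\perp)$ gives a stable isomorphism $f_j:\partial(V,\theta)\to\partial(V^\perp,-\theta^\perp)$. For $[x]\in l_{2q+1}(v,v)$, $x=(M,\psi;L,V)$, put $\delta([x])=[\partial l\circ(f_j\oplus\partial\mathrm{id}_Q)\circ\partial k^{-1}]\in\mathrm{sbAut}(v)$ for isometries $k:(V,\theta)\oplus(Q,0)\cong v\oplus(P,0)$ and $l:(V^\perp,-\theta^\perp)\oplus(Q,0)\cong v\oplus(P,0)$, where $P$ is some $(\Lambda^n,\mathcal B)$. * For a stable isomorphism $f=(\alpha,\beta,\nu)$ of $\partial w$, $w=v\oplus(Q,0)=(W,\theta)$, to itself put $\kappa([f])=[w\cup_f(-w)]\in L^s_{2q}(\Lambda)$, where $w\cup_f(-w)=(W\oplus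 W^*,\begin{pmatrix}\theta&0\\ \epsilon a&-s\end{pmatrix})$ and $a:W\to W$ and $s\in Q_\epsilon(W^*)$ are the upper left entries of $\alpha$ and of $\alpha\nu\alpha^*$. **Corollary.** For every $\epsilon$-quadratic form $v$ the maps $b$, $\delta$, $\kappa$ are well defined (in particular $w\cup_f(-w)$ is always simple), $L^s_{2q+1}(\Lambda)$ acts on $l_{2q+1}(v,v)$ by addition, $\rho([x],[z])=[x]+[z]$, and the sequence $$L^s_{2q+1}(\Lambda)\xrightarrow{\ \rho\ }l_{2q+1}(v,v)\xrightarrow{\ \delta\ }\mathrm{sbAut}(v)\xrightarrow{\ \kappa\ }L^s_{2q}(\Lambda)$$ is exact in the following sense: the orbits of $\rho$ are precisely the fibres of $\delta$ (that is, $\delta([x])=\delta([x'])$ if and only if $[x']=[x]+[z]$ for some $[z]\in L^s_{2q+1}(\Lambda)$), and $\operatorname{im}\delta=\kappa^{-1}(0)$. Moreover $\delta([x])=1$ if and only if $[x]+[z]$ is elementary for some $[z]\in L^s_{2q+1}(\Lambda)$. -/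

import Mathlib

set_option linter.unusedSectionVars false

universe u

namespace QuadL

section Dual

/-- The dual `M^* = Hom_Λ(M, Λ)` of a left module over a ring with involution, made into a left
module by `(a • f) x = f x * star a`. -/
def SDual (Λ : Type u) [Ring Λ] (M : Type u) [AddCommGroup M] [Module Λ M] : Type u :=
  M →ₗ[Λ] Λ

variable {Λ : Type u} [Ring Λ] [StarRing Λ]
variable {M N P : Type u} [AddCommGroup M] [Module Λ M] [AddCommGroup N] [Module Λ N]
  [AddCommGroup P] [Module Λ P]

instance : AddCommGroup (SDual Λ M) := inferInstanceAs (AddCommGroup (M →ₗ[Λ] Λ))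

instance : FunLike (SDual Λ M) M Λ := inferInstanceAs (FunLike (M →ₗ[Λ] Λ) M Λ)

instance : LinearMapClass (SDual Λ M) Λ M Λ :=
  inferInstanceAs (LinearMapClass (M →ₗ[Λ] Λ) Λ M Λ)

instance : Module Λ (SDual Λ M) :=
  Module.compHom (M →ₗ[Λ] Λ) ((starRingEquiv : Λ ≃+* Λᵐᵒᵖ) : Λ →+* Λᵐᵒᵖ)

/-- A functional, as an element of the dual. -/
def SDual.of (f : M →ₗ[Λ] Λ) : SDual Λ M := f

@[simp] theorem SDual.of_apply (f : M →ₗ[Λ] Λ) (x : M) : (SDual.of f) x = f x := rfl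

@[ext] theorem SDual.ext {f g : SDual Λ M} (h : ∀ x, f x = g x) : f = g :=
  LinearMap.ext (f := (f : M →ₗ[Λ] Λ)) (g := (g : M →ₗ[Λ] Λ)) h

@[simp] theorem SDual.smul_apply (a : Λ) (f : SDual Λ M) (x : M) : (a • f) x = f x * star a := rfl
@[simp] theorem SDual.add_apply (f g : SDual Λ M) (x : M) : (f + g) x = f x + g x := rfl
@[simp] theorem SDual.sub_apply (f g : SDual Λ M) (x : M) : (f - g) x = f x - g x := rfl
@[simp] theorem SDual.neg_apply (f : SDual Λ M) (x : M) : (-f) x = - f x := rfl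
@[simp] theorem SDual.zero_apply (x : M) : (0 : SDual Λ M) x = 0 := rfl
@[simp] theorem SDual.zsmul_apply (k : ℤ) (f : SDual Λ M) (x : M) : (k • f) x = k • f x :=
  LinearMap.smul_apply k (f : M →ₗ[Λ] Λ) x

/-- The dual `f^* : N^* → M^*` of a homomorphism `f : M → N`. -/
def dualMap (f : M →ₗ[Λ] N) : SDual Λ N →ₗ[Λ] SDual Λ M where
  toFun g := SDual.of ((g : N →ₗ[Λ] Λ).comp f)
  map_add' _ _ := rfl
  map_smul' _ _ := rfl

@[simp] theorem dualMap_apply (f : M →ₗ[Λ] N) (g : SDual Λ N) (x : M) :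
    (dualMap f g) x = g (f x) := rfl

/-- The evaluation map `M → M^{**}`, by which `M` and `M^{**}` are identified. -/
def ev : M →ₗ[Λ] SDual Λ (SDual Λ M) where
  toFun m := SDual.of
    { toFun := fun f : SDual Λ M => star (f m)
      map_add' := by intro f g; simp
      map_smul' := by intro a f; simp }
  map_add' x y := by ext f; simp
  map_smul' a x := by ext f; simp

@[simp] theorem ev_apply (m : M) (f : SDual Λ M) : (ev m) f = star (f m) := rfl

/-- The adjoint `φ^* : N → M^*` of `φ : M → N^*` (with `N` embedded in `N^{**}`):
`(φ^* y) x = star (φ x y)`. -/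
def adj (φ : M →ₗ[Λ] SDual Λ N) : N →ₗ[Λ] SDual Λ M := (dualMap φ).comp ev

@[simp] theorem adj_apply (φ : M →ₗ[Λ] SDual Λ N) (x : M) (y : N) :
    adj φ y x = star (φ x y) := rfl

/-- The isomorphism `f^* : N^* ≃ M^*` of an isomorphism `f : M ≃ N`. -/
def dualCongr (e : M ≃ₗ[Λ] N) : SDual Λ N ≃ₗ[Λ] SDual Λ M :=
  LinearEquiv.ofLinearMap (dualMap e.toLinearMap) (dualMap e.symm.toLinearMap)
    (by ext f x; simp) (by ext f x; simp)

@[simp] theorem dualCongr_apply (e : M ≃ₗ[Λ] N) (g : SDual Λ N) (x : M) :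
    (dualCongr e g) x = g (e x) := rfl

@[simp] theorem dualCongr_symm_apply (e : M ≃ₗ[Λ] N) (g : SDual Λ M) (x : N) :
    ((dualCongr e).symm g) x = g (e.symm x) := rfl

/-- The identification `(M ⊕ N)^* = M^* ⊕ N^*`. -/
def dualProd (M N : Type u) [AddCommGroup M] [Module Λ M] [AddCommGroup N] [Module Λ N] :
    SDual Λ (M × N) ≃ₗ[Λ] SDual Λ M × SDual Λ N :=
  LinearEquiv.ofLinearMap
    ((dualMap (LinearMap.inl Λ M N)).prod (dualMap (LinearMap.inr Λ M N)))
    ((dualMap (LinearMap.fst Λ M N)).coprod (dualMap (LinearMap.snd Λ M N)))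
    (by ext f x <;> simp)
    (by
      ext f x
      simp [← map_add])

@[simp] theorem dualProd_apply_fst (f : SDual Λ (M × N)) (x : M) :
    (dualProd M N f).1 x = f (x, 0) := rfl
@[simp] theorem dualProd_apply_snd (f : SDual Λ (M × N)) (y : N) :
    (dualProd M N f).2 y = f (0, y) := rfl
@[simp] theorem dualProd_symm_apply (f : SDual Λ M × SDual Λ N) (x : M × N) :
    ((dualProd M N).symm f) x = f.1 x.1 + f.2 x.2 := rfl

/-- The identification of `(Λ^n)^*` with `Λ^n` by the dual of the standard basis. -/
def dualPi (n : ℕ) : SDual Λ (Fin n → Λ) ≃ₗ[Λ] (Fin n → Λ) where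
  toFun f := fun i => star (f (Pi.single i 1))
  map_add' f g := by ext i; simp
  map_smul' a f := by ext i; simp
  invFun w := SDual.of
    { toFun := fun x => ∑ i, x i * star (w i)
      map_add' := by intro x y; simp [add_mul, Finset.sum_add_distrib]
      map_smul' := by intro a x; simp [Finset.mul_sum, mul_assoc] }
  left_inv f := by
    ext x
    have hx : x = ∑ i, x i • (Pi.single i (1 : Λ) : Fin n → Λ) := by
      ext j; simp [Finset.sum_apply, Pi.single_apply]
    have : f x = ∑ i, x i * f (Pi.single i 1) := by
      conv_lhs => rw [hx]
      rw [map_sum]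
      exact Finset.sum_congr rfl fun i _ => map_smul f _ _
    simpa using this.symm
  right_inv w := by ext i; simp [Pi.single_apply]

theorem dualPi_apply (n : ℕ) (f : SDual Λ (Fin n → Λ)) (i : Fin n) :
    dualPi n f i = star (f (Pi.single i 1)) := rfl

theorem dualPi_symm_apply (n : ℕ) (w x : Fin n → Λ) :
    ((dualPi n).symm w) x = ∑ i, x i * star (w i) := rfl

end Dual

section KOne

/-- `Λ^n ⊕ Λ^k = Λ^{n+k}`. -/
def joinFin (R : Type u) [Ring R] (n k : ℕ) :
    ((Fin n → R) × (Fin k → R)) ≃ₗ[R] (Fin (n + k) → R) :=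
  (LinearEquiv.sumArrowLequivProdArrow (Fin n) (Fin k) R R).symm.trans
    (LinearEquiv.funCongrLeft R R finSumFinEquiv.symm)

theorem joinFin_inl (R : Type u) [Ring R] (n k : ℕ) (x : (Fin n → R) × (Fin k → R)) (i : Fin n) :
    joinFin R n k x (finSumFinEquiv (Sum.inl i)) = x.1 i := by
  change (LinearEquiv.sumArrowLequivProdArrow (Fin n) (Fin k) R R).symm x
    (finSumFinEquiv.symm (finSumFinEquiv (Sum.inl i))) = x.1 i
  rw [Equiv.symm_apply_apply]; rfl

theorem joinFin_inr (R : Type u) [Ring R] (n k : ℕ) (x : (Fin n → R) × (Fin k → R)) (i : Fin k) :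
    joinFin R n k x (finSumFinEquiv (Sum.inr i)) = x.2 i := by
  change (LinearEquiv.sumArrowLequivProdArrow (Fin n) (Fin k) R R).symm x
    (finSumFinEquiv.symm (finSumFinEquiv (Sum.inr i))) = x.2 i
  rw [Equiv.symm_apply_apply]; rfl

variable (Λ : Type u) [Ring Λ]

/-- `f ⊕ id : Λ^{n+k} → Λ^{n+k}` for an automorphism `f` of `Λ^n`. -/
def stabAut {n : ℕ} (k : ℕ) (f : (Fin n → Λ) ≃ₗ[Λ] (Fin n → Λ)) :
    (Fin (n + k) → Λ) ≃ₗ[Λ] (Fin (n + k) → Λ) :=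
  (joinFin Λ n k).symm.trans
    ((f.prodCongr (LinearEquiv.refl Λ (Fin k → Λ))).trans (joinFin Λ n k))

/-- The relations `[f ∘ g] = [f] + [g]` and `[f ⊕ id] = [f]`. -/
inductive K1Rel : FreeAbelianGroup (Σ n : ℕ, (Fin n → Λ) ≃ₗ[Λ] (Fin n → Λ)) → Prop
  | comp {n : ℕ} (f g : (Fin n → Λ) ≃ₗ[Λ] (Fin n → Λ)) :
      K1Rel (FreeAbelianGroup.of ⟨n, f.trans g⟩ - FreeAbelianGroup.of ⟨n, f⟩
        - FreeAbelianGroup.of ⟨n, g⟩)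
  | stab {n : ℕ} (k : ℕ) (f : (Fin n → Λ) ≃ₗ[Λ] (Fin n → Λ)) :
      K1Rel (FreeAbelianGroup.of ⟨n + k, stabAut Λ k f⟩ - FreeAbelianGroup.of ⟨n, f⟩)

/-- `K_1(Λ) = colim_n GL_n(Λ)^{ab}`, the abelianisation of the stable general linear group,
given by generators and relations: one generator for every automorphism of a `Λ^n`, additive under
composition and invariant under stabilisation. -/
def K1 : Type u :=
  FreeAbelianGroup (Σ n : ℕ, (Fin n → Λ) ≃ₗ[Λ] (Fin n → Λ)) ⧸
    AddSubgroup.closure {x | K1Rel Λ x}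

instance : AddCommGroup (K1 Λ) :=
  inferInstanceAs (AddCommGroup (_ ⧸ AddSubgroup.closure {x | K1Rel Λ x}))

variable {Λ} in
/-- The class of an automorphism of `Λ^n` in `K_1(Λ)`. -/
def K1.cls {n : ℕ} (f : (Fin n → Λ) ≃ₗ[Λ] (Fin n → Λ)) : K1 Λ :=
  QuotientAddGroup.mk (s := AddSubgroup.closure {x | K1Rel Λ x}) (FreeAbelianGroup.of ⟨n, f⟩)

variable {Λ} in
/-- `f` is the base change along `ℤ → Λ` of an automorphism of `ℤ^n`. -/
def IsIntegral {n : ℕ} (f : (Fin n → Λ) ≃ₗ[Λ] (Fin n → Λ)) : Prop :=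
  ∃ g : (Fin n → ℤ) ≃ₗ[ℤ] (Fin n → ℤ),
    ∀ x : Fin n → ℤ, f (fun i => (x i : Λ)) = fun i => ((g x i : ℤ) : Λ)

/-- The image of `K_1(ℤ) → K_1(Λ)`. -/
def K1.integral : AddSubgroup (K1 Λ) :=
  AddSubgroup.closure {x | ∃ (n : ℕ) (f : (Fin n → Λ) ≃ₗ[Λ] (Fin n → Λ)),
    IsIntegral f ∧ x = K1.cls f}

/-- The reduced group `coker (K_1(ℤ) → K_1(Λ))`. -/
def RedK1 : Type u := K1 Λ ⧸ K1.integral Λ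

instance : AddCommGroup (RedK1 Λ) := inferInstanceAs (AddCommGroup (_ ⧸ K1.integral Λ))

variable {Λ}

/-- The class of an automorphism of `Λ^n` in the reduced group `K̃_1(Λ)`. -/
def RedK1.cls {n : ℕ} (f : (Fin n → Λ) ≃ₗ[Λ] (Fin n → Λ)) : RedK1 Λ :=
  QuotientAddGroup.mk (s := K1.integral Λ) (K1.cls f)

theorem RedK1.cls_trans {n : ℕ} (f g : (Fin n → Λ) ≃ₗ[Λ] (Fin n → Λ)) :
    RedK1.cls (f.trans g) = RedK1.cls f + RedK1.cls g := by
  have h : K1.cls (f.trans g) = K1.cls f + K1.cls g := by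
    have : (QuotientAddGroup.mk (s := AddSubgroup.closure {x | K1Rel Λ x})
        (FreeAbelianGroup.of ⟨n, f.trans g⟩ - FreeAbelianGroup.of ⟨n, f⟩
        - FreeAbelianGroup.of ⟨n, g⟩)) = 0 :=
      (QuotientAddGroup.eq_zero_iff _).2 (AddSubgroup.subset_closure (K1Rel.comp f g))
    have h2 : K1.cls (f.trans g) - K1.cls f - K1.cls g = 0 := this
    rw [sub_sub, sub_eq_zero] at h2
    exact h2
  exact congrArg (QuotientAddGroup.mk (s := K1.integral Λ)) h

theorem RedK1.cls_stab {n : ℕ} (k : ℕ) (f : (Fin n → Λ) ≃ₗ[Λ] (Fin n → Λ)) :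
    RedK1.cls (stabAut Λ k f) = RedK1.cls f := by
  have h : K1.cls (stabAut Λ k f) = K1.cls f := by
    have : (QuotientAddGroup.mk (s := AddSubgroup.closure {x | K1Rel Λ x})
        (FreeAbelianGroup.of ⟨n + k, stabAut Λ k f⟩ - FreeAbelianGroup.of ⟨n, f⟩)) = 0 :=
      (QuotientAddGroup.eq_zero_iff _).2 (AddSubgroup.subset_closure (K1Rel.stab k f))
    have h2 : K1.cls (stabAut Λ k f) - K1.cls f = 0 := this
    rwa [sub_eq_zero] at h2
  exact congrArg (QuotientAddGroup.mk (s := K1.integral Λ)) h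

theorem RedK1.cls_integral {n : ℕ} {f : (Fin n → Λ) ≃ₗ[Λ] (Fin n → Λ)} (h : IsIntegral f) :
    RedK1.cls f = 0 :=
  (QuotientAddGroup.eq_zero_iff _).2 (AddSubgroup.subset_closure ⟨n, f, h, rfl⟩)

/-- A subgroup `Z ⊆ K̃_1(Λ)` is `*`-invariant if `[f] ∈ Z` implies `[f^*] ∈ Z`, where
`f^* : (Λ^n)^* → (Λ^n)^*` is read in the dual basis. -/
def StarInvariant [StarRing Λ] (Z : AddSubgroup (RedK1 Λ)) : Prop :=
  ∀ (n : ℕ) (f : (Fin n → Λ) ≃ₗ[Λ] (Fin n → Λ)), RedK1.cls f ∈ Z →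
    RedK1.cls ((dualPi n).symm.trans ((dualCongr f).trans (dualPi n))) ∈ Z

end KOne

section Frames

variable {Λ : Type u} [Ring Λ]

/-- A finite ordered basis of a module, as an isomorphism with `Λ^n`. -/
structure Frame (Λ : Type u) [Ring Λ] (X : Type u) [AddCommGroup X] [Module Λ X] where
  n : ℕ
  e : X ≃ₗ[Λ] (Fin n → Λ)

variable {X Y W X' Y' : Type u} [AddCommGroup X] [Module Λ X] [AddCommGroup Y] [Module Λ Y]
  [AddCommGroup W] [Module Λ W] [AddCommGroup X'] [Module Λ X'] [AddCommGroup Y'] [Module Λ Y']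

/-- The standard basis of `Λ^k`. -/
abbrev Frame.std (Λ : Type u) [Ring Λ] (k : ℕ) : Frame Λ (Fin k → Λ) := ⟨k, LinearEquiv.refl _ _⟩

/-- The union of a basis of `X` and a basis of `Y`, as a basis of `X ⊕ Y`. -/
abbrev Frame.prod (a : Frame Λ X) (b : Frame Λ Y) : Frame Λ (X × Y) :=
  ⟨a.n + b.n, (a.e.prodCongr b.e).trans (joinFin Λ a.n b.n)⟩

/-- The indices of the union of two bases. -/
def Frame.idx (a : Frame Λ X) (b : Frame Λ Y) : Fin a.n ⊕ Fin b.n ≃ Fin (a.prod b).n :=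
  finSumFinEquiv

theorem Frame.prod_inl (a : Frame Λ X) (b : Frame Λ Y) (x : X × Y) (i : Fin a.n) :
    (a.prod b).e x (Frame.idx a b (Sum.inl i)) = a.e x.1 i :=
  joinFin_inl Λ a.n b.n (a.e x.1, b.e x.2) i

theorem Frame.prod_inr (a : Frame Λ X) (b : Frame Λ Y) (x : X × Y) (i : Fin b.n) :
    (a.prod b).e x (Frame.idx a b (Sum.inr i)) = b.e x.2 i :=
  joinFin_inr Λ a.n b.n (a.e x.1, b.e x.2) i

/-- The reordering that exchanges two bases. -/
def Frame.swapIdx (a : Frame Λ X) (b : Frame Λ Y) : Fin (b.prod a).n ≃ Fin (a.prod b).n :=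
  (Frame.idx b a).symm.trans ((Equiv.sumComm _ _).trans (Frame.idx a b))

theorem Frame.prod_swap (a : Frame Λ X) (b : Frame Λ Y) (x : X × Y) :
    (b.prod a).e (x.2, x.1) = fun i => (a.prod b).e x (Frame.swapIdx a b i) := by
  ext i
  obtain ⟨j, rfl⟩ := (Frame.idx b a).surjective i
  have hs : Frame.swapIdx a b (Frame.idx b a j) = Frame.idx a b j.swap := by
    rw [Frame.swapIdx, Equiv.trans_apply, Equiv.symm_apply_apply]; rfl
  rw [hs]
  rcases j with j | j
  · exact (Frame.prod_inl b a (x.2, x.1) j).trans (Frame.prod_inr a b x j).symm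
  · exact (Frame.prod_inr b a (x.2, x.1) j).trans (Frame.prod_inl a b x j).symm

/-- The reordering for the associativity of unions. -/
def Frame.assocIdx (a : Frame Λ X) (b : Frame Λ Y) (c : Frame Λ W) :
    Fin (a.prod (b.prod c)).n ≃ Fin ((a.prod b).prod c).n :=
  (Frame.idx a (b.prod c)).symm.trans
    (((Equiv.refl _).sumCongr (Frame.idx b c).symm).trans ((Equiv.sumAssoc _ _ _).symm.trans
      (((Frame.idx a b).sumCongr (Equiv.refl _)).trans (Frame.idx (a.prod b) c))))

theorem Frame.prod_assoc (a : Frame Λ X) (b : Frame Λ Y) (c : Frame Λ W) (x : (X × Y) × W) :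
    (a.prod (b.prod c)).e (x.1.1, (x.1.2, x.2)) =
      fun i => ((a.prod b).prod c).e x (Frame.assocIdx a b c i) := by
  ext i
  obtain ⟨j, rfl⟩ := (Frame.idx a (b.prod c)).surjective i
  rcases j with j | j
  · have hs : Frame.assocIdx a b c (Frame.idx a (b.prod c) (Sum.inl j)) =
        Frame.idx (a.prod b) c (Sum.inl (Frame.idx a b (Sum.inl j))) := by
      rw [Frame.assocIdx, Equiv.trans_apply, Equiv.symm_apply_apply]; rfl
    rw [hs]
    exact (Frame.prod_inl a (b.prod c) _ j).trans
      ((Frame.prod_inl (a.prod b) c x _).trans (Frame.prod_inl a b x.1 j)).symm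
  · obtain ⟨j, rfl⟩ := (Frame.idx b c).surjective j
    have hs : Frame.assocIdx a b c (Frame.idx a (b.prod c) (Sum.inr (Frame.idx b c j))) =
        Frame.idx (a.prod b) c (Sum.map (Frame.idx a b) id
          ((Equiv.sumAssoc _ _ _).symm (Sum.inr j))) := by
      rw [Frame.assocIdx, Equiv.trans_apply, Equiv.symm_apply_apply, Equiv.trans_apply,
        Equiv.sumCongr_apply, Sum.map_inr, Equiv.symm_apply_apply]; rfl
    rw [hs]
    refine (Frame.prod_inr a (b.prod c) _ _).trans ?_
    rcases j with j | j
    · exact (Frame.prod_inl b c _ j).trans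
        ((Frame.prod_inl (a.prod b) c x _).trans (Frame.prod_inr a b x.1 j)).symm
    · exact (Frame.prod_inr b c _ j).trans (Frame.prod_inr (a.prod b) c x j).symm

variable [InvariantBasisNumber Λ]

theorem Frame.n_eq (a : Frame Λ X) (b : Frame Λ Y) (e : X ≃ₗ[Λ] Y) : b.n = a.n :=
  eq_of_fin_equiv Λ (b.e.symm.trans (e.symm.trans a.e))

/-- The class in `K̃_1(Λ)` of an isomorphism between two modules with bases. -/
def tors (a : Frame Λ X) (b : Frame Λ Y) (e : X ≃ₗ[Λ] Y) : RedK1 Λ :=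
  RedK1.cls (a.e.symm.trans (e.trans (b.e.trans
    (LinearEquiv.funCongrLeft Λ Λ (finCongr (Frame.n_eq a b e).symm)))))

theorem tors_eq {n : ℕ} (a : X ≃ₗ[Λ] (Fin n → Λ)) (b : Y ≃ₗ[Λ] (Fin n → Λ)) (e : X ≃ₗ[Λ] Y) :
    tors ⟨n, a⟩ ⟨n, b⟩ e = RedK1.cls (a.symm.trans (e.trans b)) := rfl

theorem tors_trans (a : Frame Λ X) (b : Frame Λ Y) (c : Frame Λ W) (e : X ≃ₗ[Λ] Y)
    (e' : Y ≃ₗ[Λ] W) : tors a c (e.trans e') = tors a b e + tors b c e' := by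
  have h1 := Frame.n_eq a b e
  have h2 := Frame.n_eq b c e'
  obtain ⟨n, a⟩ := a
  obtain ⟨n', b⟩ := b
  obtain ⟨n'', c⟩ := c
  dsimp only at h1 h2
  subst h2 h1
  rw [tors_eq, tors_eq, tors_eq, ← RedK1.cls_trans]
  congr 1
  ext x
  simp

theorem tors_prod_refl (a : Frame Λ X) (b : Frame Λ Y) (c : Frame Λ W) (e : X ≃ₗ[Λ] Y) :
    tors (a.prod c) (b.prod c) (e.prodCongr (LinearEquiv.refl Λ W)) = tors a b e := by
  have h1 := Frame.n_eq a b e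
  obtain ⟨n, a⟩ := a
  obtain ⟨n', b⟩ := b
  dsimp only at h1
  subst h1
  rw [Frame.prod, Frame.prod, tors_eq, tors_eq,
    ← RedK1.cls_stab c.n (a.symm.trans (e.trans b))]
  refine congrArg (RedK1.cls (Λ := Λ)) (LinearEquiv.ext fun x => ?_)
  simp [stabAut]

/-- An isomorphism that permutes the coordinates has trivial torsion. -/
theorem tors_perm (a : Frame Λ X) (b : Frame Λ Y) (e : X ≃ₗ[Λ] Y) (π : Fin b.n ≃ Fin a.n)
    (h : ∀ x, b.e (e x) = fun i => a.e x (π i)) : tors a b e = 0 := by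
  have h1 := Frame.n_eq a b e
  obtain ⟨n, a⟩ := a
  obtain ⟨n', b⟩ := b
  dsimp only at h1 π h
  subst h1
  rw [tors_eq]
  refine RedK1.cls_integral ⟨LinearEquiv.funCongrLeft ℤ ℤ π, fun x => ?_⟩
  simp only [LinearEquiv.trans_apply, h, LinearEquiv.apply_symm_apply]
  rfl

theorem tors_prodComm (a : Frame Λ X) (b : Frame Λ Y) :
    tors (a.prod b) (b.prod a) (LinearEquiv.prodComm Λ X Y) = 0 :=
  tors_perm _ _ _ (Frame.swapIdx a b) (Frame.prod_swap a b)

theorem tors_refl_prod (a : Frame Λ X) (b : Frame Λ Y) (c : Frame Λ W) (e : X ≃ₗ[Λ] Y) :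
    tors (c.prod a) (c.prod b) ((LinearEquiv.refl Λ W).prodCongr e) = tors a b e := by
  have : (LinearEquiv.refl Λ W).prodCongr e =
      (LinearEquiv.prodComm Λ W X).trans ((e.prodCongr (LinearEquiv.refl Λ W)).trans
        (LinearEquiv.prodComm Λ Y W)) := by
    ext x <;> simp
  rw [this, tors_trans _ (a.prod c), tors_trans _ (b.prod c), tors_prodComm, tors_prodComm,
    tors_prod_refl]
  simp

theorem tors_prod (a : Frame Λ X) (b : Frame Λ Y) (a' : Frame Λ X') (b' : Frame Λ Y')
    (e : X ≃ₗ[Λ] Y) (e' : X' ≃ₗ[Λ] Y') :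
    tors (a.prod a') (b.prod b') (e.prodCongr e') = tors a b e + tors a' b' e' := by
  have : e.prodCongr e' = (e.prodCongr (LinearEquiv.refl Λ X')).trans
      ((LinearEquiv.refl Λ Y).prodCongr e') := by
    ext x <;> simp
  rw [this, tors_trans _ (b.prod a'), tors_prod_refl, tors_refl_prod]

theorem tors_prodAssoc (a : Frame Λ X) (b : Frame Λ Y) (c : Frame Λ W) :
    tors ((a.prod b).prod c) (a.prod (b.prod c)) (LinearEquiv.prodAssoc Λ X Y W) = 0 :=
  tors_perm _ _ _ (Frame.assocIdx a b c) (Frame.prod_assoc a b c)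

theorem tors_refl (a : Frame Λ X) : tors a a (LinearEquiv.refl Λ X) = 0 :=
  tors_perm _ _ _ (Equiv.refl _) fun _ => rfl

theorem tors_symm (a : Frame Λ X) (b : Frame Λ Y) (e : X ≃ₗ[Λ] Y) :
    tors b a e.symm = - tors a b e := by
  have := tors_trans a b a e e.symm
  rw [LinearEquiv.self_trans_symm, tors_refl] at this
  exact (neg_eq_of_add_eq_zero_right this.symm).symm

/-- `(X ⊕ Y) ⊕ W = (X ⊕ W) ⊕ Y`. -/
def rightComm (Λ X Y W : Type u) [Ring Λ] [AddCommGroup X] [Module Λ X] [AddCommGroup Y]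
    [Module Λ Y] [AddCommGroup W] [Module Λ W] : ((X × Y) × W) ≃ₗ[Λ] ((X × W) × Y) :=
  (LinearEquiv.prodAssoc Λ X Y W).trans
    (((LinearEquiv.refl Λ X).prodCongr (LinearEquiv.prodComm Λ Y W)).trans
      (LinearEquiv.prodAssoc Λ X W Y).symm)

@[simp] theorem rightComm_apply (x : X) (y : Y) (w : W) :
    rightComm Λ X Y W ((x, y), w) = ((x, w), y) := rfl

theorem tors_rightComm (a : Frame Λ X) (b : Frame Λ Y) (c : Frame Λ W) :
    tors ((a.prod b).prod c) ((a.prod c).prod b) (rightComm Λ X Y W) = 0 := by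
  rw [rightComm, tors_trans _ (a.prod (b.prod c)), tors_trans _ (a.prod (c.prod b)),
    tors_prodAssoc, tors_refl_prod, tors_prodComm, tors_symm, tors_prodAssoc]
  simp

theorem tors_prodProdProdComm (a : Frame Λ X) (b : Frame Λ Y) (c : Frame Λ X') (d : Frame Λ Y') :
    tors ((a.prod b).prod (c.prod d)) ((a.prod c).prod (b.prod d))
      (LinearEquiv.prodProdProdComm Λ X Y X' Y') = 0 := by
  have : LinearEquiv.prodProdProdComm Λ X Y X' Y' =
      (LinearEquiv.prodAssoc Λ (X × Y) X' Y').symm.trans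
        (((rightComm Λ X Y X').prodCongr (LinearEquiv.refl Λ Y')).trans
          (LinearEquiv.prodAssoc Λ (X × X') Y Y')) := by
    exact LinearEquiv.ext fun _ => rfl
  rw [this, tors_trans _ (((a.prod b).prod c).prod d), tors_trans _ (((a.prod c).prod b).prod d),
    tors_symm, tors_prodAssoc, tors_prodAssoc, tors_prod_refl, tors_rightComm]
  simp

/-- Replacing both bases by the bases transported along isomorphisms. -/
theorem tors_conj (a : Frame Λ X) (b : Frame Λ Y) (a' : Frame Λ X') (b' : Frame Λ Y')
    (s : X ≃ₗ[Λ] X') (t : Y ≃ₗ[Λ] Y') (hs : tors a a' s = 0) (ht : tors b b' t = 0)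
    (e : X ≃ₗ[Λ] Y) (e' : X' ≃ₗ[Λ] Y') (h : e.trans t = s.trans e') :
    tors a b e = tors a' b' e' := by
  have h1 := tors_trans a b b' e t
  rw [h, tors_trans a a' b', hs, ht] at h1
  simpa using h1.symm

end Frames
section Based

/-- A based module: a stably finitely generated free module `carrier` together with an `s`-basis,
that is, a basis `sb` of `carrier ⊕ Λ^m`. Torsion, and hence every notion below, depends on the
`s`-basis only through its equivalence class, so a representative is carried along. -/
structure BasedModule (Λ : Type u) [Ring Λ] : Type (u + 1) where
  carrier : Type u
  [ab : AddCommGroup carrier]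
  [mod : Module Λ carrier]
  m : ℕ
  n : ℕ
  sb : (carrier × (Fin m → Λ)) ≃ₗ[Λ] (Fin n → Λ)

attribute [instance] BasedModule.ab BasedModule.mod

instance (Λ : Type u) [Ring Λ] : CoeSort (BasedModule Λ) (Type u) := ⟨BasedModule.carrier⟩

variable {Λ : Type u} [Ring Λ]

namespace BasedModule

/-- The rank of a stably free module. -/
def rank (M : BasedModule Λ) : ℤ := (M.n : ℤ) - M.m

/-- The `s`-basis as a basis of `M ⊕ Λ^m`. -/
abbrev frame (M : BasedModule Λ) : Frame Λ (M × (Fin M.m → Λ)) := ⟨M.n, M.sb⟩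

/-- `(M ⊕ N) ⊕ Λ^{m + m'} = (M ⊕ Λ^m) ⊕ (N ⊕ Λ^{m'})`. -/
def unpack (M N : BasedModule Λ) : ((M × N) × (Fin (M.m + N.m) → Λ)) ≃ₗ[Λ]
    ((M × (Fin M.m → Λ)) × (N × (Fin N.m → Λ))) :=
  ((LinearEquiv.refl Λ (M × N)).prodCongr (joinFin Λ M.m N.m).symm).trans
    (LinearEquiv.prodProdProdComm Λ M N (Fin M.m → Λ) (Fin N.m → Λ))

/-- The direct sum of based modules. -/
abbrev prod (M N : BasedModule Λ) : BasedModule Λ where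
  carrier := M × N
  m := M.m + N.m
  n := M.n + N.n
  sb := (unpack M N).trans (M.frame.prod N.frame).e

/-- The dual of a based module, with the dual `s`-basis. -/
abbrev dual [StarRing Λ] (M : BasedModule Λ) : BasedModule Λ where
  carrier := SDual Λ M
  m := M.m
  n := M.n
  sb := ((LinearEquiv.refl Λ (SDual Λ M)).prodCongr (dualPi M.m).symm).trans
    ((dualProd M (Fin M.m → Λ)).symm.trans ((dualCongr M.sb.symm).trans (dualPi M.n)))

/-- `Λ^k` with its standard basis. -/
abbrev std (Λ : Type u) [Ring Λ] (k : ℕ) : BasedModule Λ where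
  carrier := Fin k → Λ
  m := 0
  n := k
  sb := LinearEquiv.prodUnique

end BasedModule

variable [InvariantBasisNumber Λ]

/-- `f ⊕ id : (M ⊕ Λ^m) ⊕ Λ^{m'} → (N ⊕ Λ^{m'}) ⊕ Λ^m`. -/
def stabIso {M N : BasedModule Λ} (f : M ≃ₗ[Λ] N) :
    ((M × (Fin M.m → Λ)) × (Fin N.m → Λ)) ≃ₗ[Λ] ((N × (Fin N.m → Λ)) × (Fin M.m → Λ)) :=
  (rightComm Λ M (Fin M.m → Λ) (Fin N.m → Λ)).trans
    ((f.prodCongr (LinearEquiv.refl Λ (Fin N.m → Λ))).prodCongr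
      (LinearEquiv.refl Λ (Fin M.m → Λ)))

@[simp] theorem stabIso_apply {M N : BasedModule Λ} (f : M ≃ₗ[Λ] N) (x : M) (a : Fin M.m → Λ)
    (b : Fin N.m → Λ) : stabIso f ((x, a), b) = ((f x, b), a) := rfl

/-- The torsion `τ(f) ∈ K̃_1(Λ)` of an isomorphism of based modules: the class of `f ⊕ id` in the
(stabilised) `s`-bases. -/
def torsion {M N : BasedModule Λ} (f : M ≃ₗ[Λ] N) : RedK1 Λ :=
  tors (M.frame.prod (Frame.std Λ N.m)) (N.frame.prod (Frame.std Λ M.m)) (stabIso f)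

theorem torsion_trans {M N P : BasedModule Λ} (f : M ≃ₗ[Λ] N) (g : N ≃ₗ[Λ] P) :
    torsion (M := M) (N := P) (f.trans g) = torsion f + torsion g := by
  have h : (stabIso (M := M) (N := P) (f.trans g)).prodCongr (LinearEquiv.refl Λ (Fin N.m → Λ)) =
      (rightComm Λ (M × (Fin M.m → Λ)) (Fin P.m → Λ) (Fin N.m → Λ)).trans
      (((stabIso f).prodCongr (LinearEquiv.refl Λ (Fin P.m → Λ))).trans
      ((rightComm Λ (N × (Fin N.m → Λ)) (Fin M.m → Λ) (Fin P.m → Λ)).trans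
      (((stabIso g).prodCongr (LinearEquiv.refl Λ (Fin M.m → Λ))).trans
        (rightComm Λ (P × (Fin P.m → Λ)) (Fin N.m → Λ) (Fin M.m → Λ))))) :=
    LinearEquiv.ext fun _ => rfl
  have h2 := tors_prod_refl (M.frame.prod (Frame.std Λ P.m)) (P.frame.prod (Frame.std Λ M.m))
    (Frame.std Λ N.m) (stabIso (M := M) (N := P) (f.trans g))
  rw [h, tors_trans _ ((M.frame.prod (Frame.std Λ N.m)).prod (Frame.std Λ P.m)),
    tors_trans _ ((N.frame.prod (Frame.std Λ M.m)).prod (Frame.std Λ P.m)),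
    tors_trans _ ((N.frame.prod (Frame.std Λ P.m)).prod (Frame.std Λ M.m)),
    tors_trans _ ((P.frame.prod (Frame.std Λ N.m)).prod (Frame.std Λ M.m)),
    tors_rightComm, tors_rightComm, tors_rightComm, tors_prod_refl, tors_prod_refl] at h2
  simp only [zero_add, add_zero] at h2
  exact h2.symm

theorem torsion_refl (M : BasedModule Λ) :
    torsion (M := M) (N := M) (LinearEquiv.refl Λ M) = 0 := by
  have := torsion_trans (M := M) (N := M) (P := M) (LinearEquiv.refl Λ M) (LinearEquiv.refl Λ M)
  rw [LinearEquiv.trans_refl] at this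
  simpa using this

theorem torsion_symm {M N : BasedModule Λ} (f : M ≃ₗ[Λ] N) :
    torsion (M := N) (N := M) f.symm = - torsion f := by
  have := torsion_trans (P := M) f f.symm
  rw [LinearEquiv.self_trans_symm, torsion_refl] at this
  exact (neg_eq_of_add_eq_zero_right this.symm).symm

theorem tors_unpack (M N : BasedModule Λ) :
    tors (M.prod N).frame (M.frame.prod N.frame) (BasedModule.unpack M N) = 0 :=
  tors_perm _ _ _ (Equiv.refl _) fun _ => rfl

theorem tors_joinFin_symm (n k : ℕ) :
    tors (Frame.std Λ (n + k)) ((Frame.std Λ n).prod (Frame.std Λ k)) (joinFin Λ n k).symm = 0 :=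
  tors_perm _ _ _ (Equiv.refl _) fun x => (joinFin Λ n k).apply_symm_apply x

theorem torsion_prod {M N M' N' : BasedModule Λ} (f : M ≃ₗ[Λ] N) (f' : M' ≃ₗ[Λ] N') :
    torsion (M := M.prod M') (N := N.prod N') (f.prodCongr f') = torsion f + torsion f' := by
  have key : ∀ (M M' N N' : BasedModule Λ),
      tors ((M.prod M').frame.prod (Frame.std Λ (N.prod N').m))
        ((M.frame.prod (Frame.std Λ N.m)).prod (M'.frame.prod (Frame.std Λ N'.m)))
        (((BasedModule.unpack M M').prodCongr (joinFin Λ N.m N'.m).symm).trans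
          (LinearEquiv.prodProdProdComm Λ _ _ _ _)) = 0 := by
    intro M M' N N'
    rw [tors_trans _ ((M.frame.prod M'.frame).prod ((Frame.std Λ N.m).prod (Frame.std Λ N'.m))),
      tors_prodProdProdComm, tors_prod, tors_unpack]
    rw [add_zero, zero_add]
    exact tors_joinFin_symm _ _
  rw [torsion, tors_conj _ _ _ _ _ _ (key M M' N N') (key N N' M M') _
    ((stabIso f).prodCongr (stabIso f')) (LinearEquiv.ext fun _ => rfl), tors_prod]
  rfl

/-- An isomorphism that carries one `s`-basis to the other up to reordering has trivial torsion. -/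
theorem torsion_perm {M N : BasedModule Λ} (e : M ≃ₗ[Λ] N) (r : Fin N.m ≃ Fin M.m)
    (p : Fin N.n ≃ Fin M.n)
    (h : ∀ x w, N.sb (e x, fun i => w (r i)) = fun i => M.sb (x, w) (p i)) : torsion e = 0 := by
  have h1 : tors M.frame N.frame (e.prodCongr (LinearEquiv.funCongrLeft Λ Λ r)) = 0 :=
    tors_perm _ _ _ p fun x => h x.1 x.2
  have h2 : tors (Frame.std Λ M.m) (Frame.std Λ N.m) (LinearEquiv.funCongrLeft Λ Λ r) = 0 :=
    tors_perm _ _ _ r fun _ => rfl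
  have h3 := torsion_refl N
  have h4 : stabIso e = ((e.prodCongr (LinearEquiv.funCongrLeft Λ Λ r)).prodCongr
      (LinearEquiv.refl Λ (Fin N.m → Λ))).trans ((stabIso (M := N) (N := N)
        (LinearEquiv.refl Λ N)).trans ((LinearEquiv.refl Λ (N × (Fin N.m → Λ))).prodCongr
          (LinearEquiv.funCongrLeft Λ Λ r).symm)) := by
    refine LinearEquiv.ext fun x => ?_
    refine Prod.ext rfl ?_
    exact ((LinearEquiv.funCongrLeft Λ Λ r).symm_apply_apply x.1.2).symm
  rw [torsion, h4, tors_trans _ (N.frame.prod (Frame.std Λ N.m)),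
    tors_trans _ (N.frame.prod (Frame.std Λ N.m)), tors_prod_refl, tors_refl_prod, tors_symm,
    h1, h2]
  rw [zero_add, neg_zero, add_zero]
  exact h3

theorem BasedModule.prod_sb (M N : BasedModule Λ) (x : M × N)
    (w : (Fin M.m → Λ) × (Fin N.m → Λ)) :
    (M.prod N).sb (x, joinFin Λ M.m N.m w) =
      (M.frame.prod N.frame).e ((x.1, w.1), (x.2, w.2)) := by
  change (M.frame.prod N.frame).e (BasedModule.unpack M N _) = _
  congr 1
  simp [BasedModule.unpack]

theorem torsion_prodComm (M N : BasedModule Λ) :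
    torsion (M := M.prod N) (N := N.prod M) (LinearEquiv.prodComm Λ M N) = 0 := by
  refine torsion_perm (M := M.prod N) (N := N.prod M) _
    (Frame.swapIdx (Frame.std Λ M.m) (Frame.std Λ N.m)) (Frame.swapIdx M.frame N.frame)
    fun x w => ?_
  obtain ⟨w, rfl⟩ := (joinFin Λ M.m N.m).surjective w
  have hw := Frame.prod_swap (Frame.std Λ M.m) (Frame.std Λ N.m) w
  refine (congrArg (fun z => (N.prod M).sb (LinearEquiv.prodComm Λ M N x, z)) hw.symm).trans ?_
  refine (BasedModule.prod_sb N M (x.2, x.1) (w.2, w.1)).trans ?_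
  rw [BasedModule.prod_sb M N x w]
  exact Frame.prod_swap M.frame N.frame ((x.1, w.1), (x.2, w.2))

theorem torsion_prodAssoc (M N P : BasedModule Λ) :
    torsion (M := (M.prod N).prod P) (N := M.prod (N.prod P))
      (LinearEquiv.prodAssoc Λ M N P) = 0 := by
  refine torsion_perm (M := (M.prod N).prod P) (N := M.prod (N.prod P)) _
    (Frame.assocIdx (Frame.std Λ M.m) (Frame.std Λ N.m) (Frame.std Λ P.m))
    (Frame.assocIdx M.frame N.frame P.frame) fun x w => ?_
  obtain ⟨⟨w, w''⟩, rfl⟩ := (joinFin Λ (M.m + N.m) P.m).surjective w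
  obtain ⟨⟨w, w'⟩, rfl⟩ := (joinFin Λ M.m N.m).surjective w
  have hw := Frame.prod_assoc (Frame.std Λ M.m) (Frame.std Λ N.m) (Frame.std Λ P.m) ((w, w'), w'')
  refine (congrArg (fun z => (M.prod (N.prod P)).sb (LinearEquiv.prodAssoc Λ M N P x, z))
    hw.symm).trans ?_
  have e1 : (M.prod (N.prod P)).sb (LinearEquiv.prodAssoc Λ M N P x,
      joinFin Λ M.m (N.m + P.m) (w, joinFin Λ N.m P.m (w', w''))) =
      (M.frame.prod (N.frame.prod P.frame)).e ((x.1.1, w), ((x.1.2, w'), (x.2, w''))) := by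
    refine (BasedModule.prod_sb M (N.prod P) (x.1.1, (x.1.2, x.2))
      (w, joinFin Λ N.m P.m (w', w''))).trans ?_
    exact congrArg (fun z => joinFin Λ M.n (N.n + P.n) (M.sb (x.1.1, w), z))
      (BasedModule.prod_sb N P (x.1.2, x.2) (w', w''))
  have e2 : ((M.prod N).prod P).sb (x, joinFin Λ (M.m + N.m) P.m (joinFin Λ M.m N.m (w, w'), w'')) =
      ((M.frame.prod N.frame).prod P.frame).e (((x.1.1, w), (x.1.2, w')), (x.2, w'')) := by
    refine (BasedModule.prod_sb (M.prod N) P x (joinFin Λ M.m N.m (w, w'), w'')).trans ?_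
    exact congrArg (fun z => joinFin Λ (M.n + N.n) P.n (z, P.sb (x.2, w'')))
      (BasedModule.prod_sb M N x.1 (w, w'))
  refine e1.trans ?_
  rw [e2]
  exact Frame.prod_assoc M.frame N.frame P.frame (((x.1.1, w), (x.1.2, w')), (x.2, w''))

theorem torsion_rightComm (M N P : BasedModule Λ) :
    torsion (M := (M.prod N).prod P) (N := (M.prod P).prod N) (rightComm Λ M N P) = 0 := by
  have h1 := torsion_trans (M := (M.prod N).prod P) (N := M.prod (N.prod P))
    (P := (M.prod P).prod N) (LinearEquiv.prodAssoc Λ M N P)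
    (((LinearEquiv.refl Λ M).prodCongr (LinearEquiv.prodComm Λ N P)).trans
      (LinearEquiv.prodAssoc Λ M P N).symm)
  have h2 := torsion_trans (M := M.prod (N.prod P)) (N := M.prod (P.prod N))
    (P := (M.prod P).prod N)
    ((LinearEquiv.refl Λ M).prodCongr (LinearEquiv.prodComm Λ N P))
      (LinearEquiv.prodAssoc Λ M P N).symm
  have h3 := torsion_prod (M := M) (N := M) (M' := N.prod P) (N' := P.prod N)
    (LinearEquiv.refl Λ M) (LinearEquiv.prodComm Λ N P)
  have h4 := torsion_symm (M := (M.prod P).prod N) (N := M.prod (P.prod N))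
    (LinearEquiv.prodAssoc Λ M P N)
  refine h1.trans ?_
  rw [h2, h3, h4, torsion_prodAssoc, torsion_prodAssoc, torsion_refl, torsion_prodComm]
  simp

theorem torsion_prodProdProdComm (M N P R : BasedModule Λ) :
    torsion (M := (M.prod N).prod (P.prod R)) (N := (M.prod P).prod (N.prod R))
      (LinearEquiv.prodProdProdComm Λ M N P R) = 0 := by
  have h1 := torsion_trans (M := (M.prod N).prod (P.prod R)) (N := ((M.prod N).prod P).prod R)
    (P := (M.prod P).prod (N.prod R)) (LinearEquiv.prodAssoc Λ (M × N) P R).symm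
    (((rightComm Λ M N P).prodCongr (LinearEquiv.refl Λ R)).trans
          (LinearEquiv.prodAssoc Λ (M × P) N R))
  have h2 := torsion_trans (M := ((M.prod N).prod P).prod R) (N := ((M.prod P).prod N).prod R)
    (P := (M.prod P).prod (N.prod R))
    ((rightComm Λ M N P).prodCongr (LinearEquiv.refl Λ R))
          (LinearEquiv.prodAssoc Λ (M × P) N R)
  have h3 := torsion_prod (M := (M.prod N).prod P) (N := (M.prod P).prod N) (M' := R) (N' := R)
    (rightComm Λ M N P) (LinearEquiv.refl Λ R)
  have h4 := torsion_symm (M := ((M.prod N).prod P).prod R) (N := (M.prod N).prod (P.prod R))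
    (LinearEquiv.prodAssoc Λ (M × N) P R)
  have h5 := torsion_prodAssoc (M.prod N) P R
  have h6 := torsion_prodAssoc (M.prod P) N R
  refine h1.trans ?_
  rw [h2, h3, h4, h5, h6, torsion_refl, torsion_rightComm]
  simp

/-- Multiplication by a sign. -/
def signEquiv (Λ X : Type u) [Ring Λ] [AddCommGroup X] [Module Λ X] (ε : ℤˣ) : X ≃ₗ[Λ] X :=
  DistribMulAction.toLinearEquiv Λ X ε

@[simp] theorem signEquiv_apply (X : Type u) [AddCommGroup X] [Module Λ X] (ε : ℤˣ) (x : X) :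
    signEquiv Λ X ε x = (ε : ℤ) • x := rfl

theorem tors_sign {X : Type u} [AddCommGroup X] [Module Λ X] (a : Frame Λ X) (ε : ℤˣ) :
    tors a a (signEquiv Λ X ε) = 0 := by
  obtain ⟨n, a⟩ := a
  rw [tors_eq]
  refine RedK1.cls_integral ⟨signEquiv ℤ (Fin n → ℤ) ε, fun x => ?_⟩
  ext i
  simp

theorem torsion_sign (M : BasedModule Λ) (ε : ℤˣ) :
    torsion (M := M) (N := M) (signEquiv Λ M ε) = 0 := by
  have h : stabIso (M := M) (N := M) (signEquiv Λ M ε) =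
      ((signEquiv Λ (M × (Fin M.m → Λ)) ε).prodCongr (LinearEquiv.refl Λ (Fin M.m → Λ))).trans
        ((stabIso (M := M) (N := M) (LinearEquiv.refl Λ M)).trans
          ((LinearEquiv.refl Λ (M × (Fin M.m → Λ))).prodCongr
            (signEquiv Λ (Fin M.m → Λ) ε))) := by
    refine LinearEquiv.ext fun x => Prod.ext rfl ?_
    change x.1.2 = (ε : ℤ) • ((ε : ℤ) • x.1.2)
    rw [smul_smul, ← Units.val_mul, Int.units_mul_self, Units.val_one, one_smul]
  have h2 := torsion_refl M
  rw [torsion] at h2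
  rw [torsion, h, tors_trans _ (M.frame.prod (Frame.std Λ M.m)),
    tors_trans _ (M.frame.prod (Frame.std Λ M.m)), tors_prod_refl, tors_refl_prod, tors_sign,
    tors_sign, h2]
  simp

theorem BasedModule.rank_prod (M N : BasedModule Λ) : (M.prod N).rank = M.rank + N.rank := by
  simp only [BasedModule.rank]; push_cast; ring

theorem BasedModule.rank_eq {M N : BasedModule Λ} (e : M ≃ₗ[Λ] N) : M.rank = N.rank := by
  have h := Frame.n_eq (M.frame.prod (Frame.std Λ N.m)) (N.frame.prod (Frame.std Λ M.m))
    (stabIso e)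
  simp only [BasedModule.rank]
  have : N.n + M.m = M.n + N.m := h
  omega

variable [StarRing Λ]

theorem dualPi_symm_joinFin (n k : ℕ) (w x : (Fin n → Λ) × (Fin k → Λ)) :
    ((dualPi (n + k)).symm (joinFin Λ n k w)) (joinFin Λ n k x) =
      ((dualPi n).symm w.1) x.1 + ((dualPi k).symm w.2) x.2 := by
  simp only [dualPi_symm_apply]
  rw [← finSumFinEquiv.sum_comp, Fintype.sum_sum_type]
  simp only [joinFin_inl, joinFin_inr]

/-- The defining property of the dual `s`-basis. -/
theorem BasedModule.dual_sb (M : BasedModule Λ) (u : SDual Λ M) (w a : Fin M.m → Λ) (x : M) :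
    ((dualPi M.n).symm (M.dual.sb (u, w))) (M.sb (x, a)) = u x + ((dualPi M.m).symm w) a := by
  change ((dualPi M.n).symm ((dualPi M.n) ((dualCongr M.sb.symm)
    ((dualProd M (Fin M.m → Λ)).symm (u, (dualPi M.m).symm w))))) (M.sb (x, a)) = _
  rw [LinearEquiv.symm_apply_apply, dualCongr_apply, LinearEquiv.symm_apply_apply]
  rfl

theorem BasedModule.dual_sb_ext (M : BasedModule Λ) {c : Fin M.n → Λ} {u : SDual Λ M}
    {w : Fin M.m → Λ}
    (h : ∀ x a, ((dualPi M.n).symm c) (M.sb (x, a)) = u x + ((dualPi M.m).symm w) a) :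
    c = M.dual.sb (u, w) := by
  refine (dualPi (Λ := Λ) M.n).symm.injective (SDual.ext fun y => ?_)
  obtain ⟨⟨x, a⟩, rfl⟩ := M.sb.surjective y
  rw [h, BasedModule.dual_sb]

theorem torsion_dualProd (M N : BasedModule Λ) :
    torsion (M := (M.prod N).dual) (N := M.dual.prod N.dual) (dualProd (Λ := Λ) M N) = 0 := by
  refine torsion_perm (M := (M.prod N).dual) (N := M.dual.prod N.dual) _ (Equiv.refl _)
    (Equiv.refl _) fun f w => ?_
  refine BasedModule.dual_sb_ext (M.prod N) fun x a => ?_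
  obtain ⟨w, rfl⟩ := (joinFin Λ M.m N.m).surjective w
  obtain ⟨a, rfl⟩ := (joinFin Λ M.m N.m).surjective a
  have h1 := BasedModule.prod_sb M.dual N.dual (dualProd (Λ := Λ) M N f) w
  have h2 := BasedModule.prod_sb M N x a
  refine (congrArg₂ (fun c d => ((dualPi (Λ := Λ) (M.n + N.n)).symm c) d) h1 h2).trans ?_
  refine (dualPi_symm_joinFin M.n N.n (M.dual.sb ((dualProd (Λ := Λ) M N f).1, w.1),
    N.dual.sb ((dualProd (Λ := Λ) M N f).2, w.2)) (M.sb (x.1, a.1), N.sb (x.2, a.2))).trans ?_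
  dsimp only
  rw [BasedModule.dual_sb, BasedModule.dual_sb]
  have h3 := dualPi_symm_joinFin M.m N.m w a
  refine Eq.trans ?_ (congrArg (fun z => f x + z) h3.symm)
  have h4 : f x = f (x.1, 0) + f (0, x.2) := by
    rw [← map_add]; simp
  rw [h4, dualProd_apply_fst, dualProd_apply_snd]
  abel

theorem BasedModule.ev_sb (M : BasedModule Λ) (x : M) (w : Fin M.m → Λ) :
    M.dual.dual.sb (ev x, w) = M.sb (x, w) := by
  refine (BasedModule.dual_sb_ext M.dual fun u a => ?_).symm
  have h1 : ∀ (n : ℕ) (c d : Fin n → Λ), ((dualPi n).symm c) d = star (((dualPi n).symm d) c) := by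
    intro n c d
    simp [dualPi_symm_apply, star_sum]
  refine (h1 _ _ _).trans ?_
  refine (congrArg star (BasedModule.dual_sb M u a w x)).trans ?_
  rw [star_add, ← h1]
  rfl

/-- The identification `M = M^{**}`. -/
noncomputable def evEquiv (M : BasedModule Λ) : M ≃ₗ[Λ] SDual Λ (SDual Λ M) :=
  LinearEquiv.ofBijective ev (by
    constructor
    · intro x y h
      have h1 := M.ev_sb x 0
      have h2 := M.ev_sb y 0
      rw [h, h2] at h1
      exact (congrArg Prod.fst (M.sb.injective h1)).symm
    · intro ξ
      obtain ⟨⟨x, w⟩, h⟩ := M.sb.surjective (M.dual.dual.sb (ξ, 0))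
      rw [← M.ev_sb] at h
      exact ⟨x, congrArg Prod.fst (M.dual.dual.sb.injective h)⟩)

@[simp] theorem evEquiv_apply (M : BasedModule Λ) (x : M) : evEquiv M x = ev x := rfl

theorem torsion_evEquiv (M : BasedModule Λ) :
    torsion (M := M) (N := M.dual.dual) (evEquiv M) = 0 :=
  torsion_perm (M := M) (N := M.dual.dual) _ (Equiv.refl _) (Equiv.refl _)
    fun x w => M.ev_sb x w

/-- An isomorphism of based modules is simple if its torsion lies in the fixed subgroup `Z`. -/
def IsSimple (Z : AddSubgroup (RedK1 Λ)) {M N : BasedModule Λ} (f : M ≃ₗ[Λ] N) : Prop :=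
  torsion f ∈ Z

variable {Z : AddSubgroup (RedK1 Λ)}

theorem IsSimple.of_eq_zero {M N : BasedModule Λ} {f : M ≃ₗ[Λ] N} (h : torsion f = 0) :
    IsSimple Z f := by rw [IsSimple, h]; exact Z.zero_mem

theorem IsSimple.refl (M : BasedModule Λ) :
    IsSimple Z (M := M) (N := M) (LinearEquiv.refl Λ M) := .of_eq_zero (torsion_refl M)

theorem IsSimple.trans {M N P : BasedModule Λ} {f : M ≃ₗ[Λ] N} {g : N ≃ₗ[Λ] P}
    (hf : IsSimple Z f) (hg : IsSimple Z g) :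
    IsSimple Z (M := M) (N := P) (f.trans g) := by
  rw [IsSimple, torsion_trans]; exact Z.add_mem hf hg

theorem IsSimple.symm {M N : BasedModule Λ} {f : M ≃ₗ[Λ] N} (hf : IsSimple Z f) :
    IsSimple Z (M := N) (N := M) f.symm := by
  rw [IsSimple, torsion_symm]; exact Z.neg_mem hf

theorem IsSimple.prod {M N M' N' : BasedModule Λ} {f : M ≃ₗ[Λ] N} {f' : M' ≃ₗ[Λ] N'}
    (hf : IsSimple Z f) (hf' : IsSimple Z f') :
    IsSimple Z (M := M.prod M') (N := N.prod N') (f.prodCongr f') := by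
  rw [IsSimple, torsion_prod]; exact Z.add_mem hf hf'

end Based
section QGroups

variable {Λ : Type u} [Ring Λ] [StarRing Λ]
variable {M N P : Type u} [AddCommGroup M] [Module Λ M] [AddCommGroup N] [Module Λ N]
  [AddCommGroup P] [Module Λ P]

theorem adj_add (χ χ' : M →ₗ[Λ] SDual Λ N) : adj (χ + χ') = adj χ + adj χ' := by
  ext x y; simp

theorem adj_adj (χ : M →ₗ[Λ] SDual Λ N) : adj (adj χ) = χ := by
  ext x y; simp

/-- `1 - T_ε`, where `T_ε χ = ε χ^*`. -/
def oneSubT (ε : ℤˣ) (M : Type u) [AddCommGroup M] [Module Λ M] :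
    (M →ₗ[Λ] SDual Λ M) →+ (M →ₗ[Λ] SDual Λ M) :=
  AddMonoidHom.mk' (fun χ => χ - (ε : ℤ) • adj χ) fun χ χ' => by
    rw [adj_add, smul_add]; abel

/-- `1 + T_ε`. -/
def oneAddT (ε : ℤˣ) (M : Type u) [AddCommGroup M] [Module Λ M] :
    (M →ₗ[Λ] SDual Λ M) →+ (M →ₗ[Λ] SDual Λ M) :=
  AddMonoidHom.mk' (fun χ => χ + (ε : ℤ) • adj χ) fun χ χ' => by
    rw [adj_add, smul_add]; abel

/-- `Q_ε(M) = coker (1 - T_ε)`. -/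
def QGrp (Λ : Type u) [Ring Λ] [StarRing Λ] (ε : ℤˣ) (M : Type u) [AddCommGroup M] [Module Λ M] :
    Type u :=
  (M →ₗ[Λ] SDual Λ M) ⧸ (oneSubT (Λ := Λ) ε M).range

namespace QGrp

variable {ε : ℤˣ}

instance : AddCommGroup (QGrp Λ ε M) :=
  inferInstanceAs (AddCommGroup ((M →ₗ[Λ] SDual Λ M) ⧸ (oneSubT (Λ := Λ) ε M).range))

/-- The class in `Q_ε(M)` of a homomorphism `M → M^*`. -/
def mk (ε : ℤˣ) : (M →ₗ[Λ] SDual Λ M) →+ QGrp Λ ε M :=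
  QuotientAddGroup.mk' (oneSubT (Λ := Λ) ε M).range

theorem mk_surjective : Function.Surjective (mk (Λ := Λ) (M := M) ε) :=
  QuotientAddGroup.mk'_surjective _

theorem mk_eq_zero {χ : M →ₗ[Λ] SDual Λ M} :
    mk ε χ = 0 ↔ ∃ ρ : M →ₗ[Λ] SDual Λ M, ρ - (ε : ℤ) • adj ρ = χ :=
  QuotientAddGroup.eq_zero_iff χ

/-- `χ ↦ f^* χ f`. -/
def pullHom (f : M →ₗ[Λ] N) : (N →ₗ[Λ] SDual Λ N) →+ (M →ₗ[Λ] SDual Λ M) :=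
  AddMonoidHom.mk' (fun χ => (dualMap f).comp (χ.comp f)) fun χ χ' => by
    ext x y; simp

theorem pullHom_apply (f : M →ₗ[Λ] N) (χ : N →ₗ[Λ] SDual Λ N) (x y : M) :
    pullHom f χ x y = χ (f x) (f y) := rfl

/-- The induced map `f^* : Q_ε(N) → Q_ε(M)`, `[χ] ↦ [f^* χ f]`. -/
def pull (f : M →ₗ[Λ] N) : QGrp Λ ε N →+ QGrp Λ ε M :=
  QuotientAddGroup.map _ _ (pullHom f) (by
    rintro _ ⟨χ, rfl⟩
    refine ⟨pullHom f χ, ?_⟩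
    ext x y
    simp [oneSubT, pullHom_apply])

@[simp] theorem pull_mk (f : M →ₗ[Λ] N) (χ : N →ₗ[Λ] SDual Λ N) :
    pull f (mk ε χ) = mk ε (pullHom f χ) := rfl

/-- The symmetrisation `1 + T_ε : Q_ε(M) → Hom(M, M^*)`. -/
def symm : QGrp Λ ε M →+ (M →ₗ[Λ] SDual Λ M) :=
  QuotientAddGroup.lift _ (oneAddT (Λ := Λ) ε M) (by
    rintro _ ⟨χ, rfl⟩
    have h : (ε : ℤ) * (ε : ℤ) = 1 := by rw [← Units.val_mul, Int.units_mul_self]; rfl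
    ext x y
    simp only [oneSubT, oneAddT, AddMonoidHom.mk'_apply, LinearMap.add_apply,
      LinearMap.sub_apply, LinearMap.smul_apply, SDual.add_apply, SDual.sub_apply,
      SDual.zsmul_apply, adj_apply, star_sub, star_zsmul, star_star, smul_sub, smul_smul, h,
      one_smul, LinearMap.zero_apply, SDual.zero_apply]
    abel)

theorem symm_mk (χ : M →ₗ[Λ] SDual Λ M) : symm (mk ε χ) = χ + (ε : ℤ) • adj χ := rfl

theorem symm_mk_apply (χ : M →ₗ[Λ] SDual Λ M) (x y : M) :
    symm (mk ε χ) x y = χ x y + (ε : ℤ) • star (χ y x) := rfl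

theorem pull_pull (f : M →ₗ[Λ] N) (g : N →ₗ[Λ] P) (a : QGrp Λ ε P) :
    pull f (pull g a) = pull (g.comp f) a := by
  obtain ⟨χ, rfl⟩ := mk_surjective a
  rfl

theorem pull_id (a : QGrp Λ ε M) : pull LinearMap.id a = a := by
  obtain ⟨χ, rfl⟩ := mk_surjective a
  rfl

theorem pull_zero (a : QGrp Λ ε N) : pull (0 : M →ₗ[Λ] N) a = 0 := by
  obtain ⟨χ, rfl⟩ := mk_surjective a
  have : pullHom (0 : M →ₗ[Λ] N) χ = 0 := by ext x y; simp [pullHom_apply]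
  rw [pull_mk, this, map_zero]

theorem symm_pull (f : M →ₗ[Λ] N) (a : QGrp Λ ε N) (x y : M) :
    symm (pull f a) x y = symm a (f x) (f y) := by
  obtain ⟨χ, rfl⟩ := mk_surjective a
  rw [pull_mk, symm_mk_apply, symm_mk_apply]
  rfl

theorem symm_symm (a : QGrp Λ ε M) (x y : M) :
    symm a x y = (ε : ℤ) • star (symm a y x) := by
  obtain ⟨χ, rfl⟩ := mk_surjective a
  have h : (ε : ℤ) * (ε : ℤ) = 1 := by rw [← Units.val_mul, Int.units_mul_self]; rfl
  simp only [symm_mk_apply, star_add, star_zsmul, star_star, smul_add, smul_smul, h, one_smul]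
  abel

/-- `[χ] = [ε χ^*]` in `Q_ε(M)`. -/
theorem mk_adj (χ : M →ₗ[Λ] SDual Λ M) : mk ε ((ε : ℤ) • adj χ) = mk ε χ := by
  have h : mk ε (χ - (ε : ℤ) • adj χ) = 0 := mk_eq_zero.2 ⟨χ, rfl⟩
  rw [map_sub, sub_eq_zero] at h
  exact h.symm

end QGrp

end QGroups

section Forms

/-- An `ε`-quadratic form: a based module `M` with an element of `Q_ε(M)`. -/
structure QForm (Λ : Type u) [Ring Λ] [StarRing Λ] (ε : ℤˣ) : Type (u + 1) where
  M : BasedModule Λ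
  q : QGrp Λ ε M

variable {Λ : Type u} [Ring Λ] [StarRing Λ] {ε : ℤˣ}

namespace QForm

/-- The symmetrisation `M → M^*`. -/
def phi (v : QForm Λ ε) : v.M →ₗ[Λ] SDual Λ v.M := QGrp.symm v.q

/-- The orthogonal sum. -/
abbrev sum (v w : QForm Λ ε) : QForm Λ ε where
  M := v.M.prod w.M
  q := QGrp.pull (LinearMap.fst Λ v.M w.M) v.q + QGrp.pull (LinearMap.snd Λ v.M w.M) w.q

/-- The form `-v`. -/
abbrev neg (v : QForm Λ ε) : QForm Λ ε where
  M := v.M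
  q := -v.q

/-- The zero form `(P, 0)`. -/
abbrev zeroForm (ε : ℤˣ) (P : BasedModule Λ) : QForm Λ ε where
  M := P
  q := 0

/-- The form induced on `W` by a homomorphism `j : W → M`. -/
abbrev restrict (v : QForm Λ ε) (W : BasedModule Λ) (j : W →ₗ[Λ] v.M) : QForm Λ ε where
  M := W
  q := QGrp.pull j v.q

/-- The homomorphism `P ⊕ P^* → (P ⊕ P^*)^*`, `(p, u) ↦ ((p', u') ↦ u p')`. -/
def hypHom (P : BasedModule Λ) : (P × SDual Λ P) →ₗ[Λ] SDual Λ (P × SDual Λ P) :=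
  (dualMap (LinearMap.fst Λ P (SDual Λ P))).comp (LinearMap.snd Λ P (SDual Λ P))

/-- The hyperbolic form `H_ε(P)` on `P ⊕ P^*`. -/
abbrev hyp (ε : ℤˣ) (P : BasedModule Λ) : QForm Λ ε where
  M := P.prod P.dual
  q := QGrp.mk ε (hypHom P)

theorem phi_sum (v w : QForm Λ ε) (x y : v.M × w.M) :
    (v.sum w).phi x y = v.phi x.1 y.1 + w.phi x.2 y.2 := by
  change QGrp.symm (QGrp.pull (LinearMap.fst Λ v.M w.M) v.q +
    QGrp.pull (LinearMap.snd Λ v.M w.M) w.q) x y = _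
  rw [map_add]
  exact congrArg₂ (· + ·) (QGrp.symm_pull (LinearMap.fst Λ v.M w.M) v.q x y)
    (QGrp.symm_pull (LinearMap.snd Λ v.M w.M) w.q x y)

theorem phi_hyp (P : BasedModule Λ) (x y : P × SDual Λ P) :
    (hyp ε P).phi x y = x.2 y.1 + (ε : ℤ) • star (y.2 x.1) := rfl

end QForm

variable [InvariantBasisNumber Λ] (Z : AddSubgroup (RedK1 Λ))

/-- A simple isometry `v ≅ w`. All isometries are understood to be simple. -/
structure Isometry (v w : QForm Λ ε) where
  e : v.M ≃ₗ[Λ] w.M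
  simple : IsSimple Z e
  isom : QGrp.pull e.toLinearMap w.q = v.q

/-- A form is simple if its symmetrisation is a simple isomorphism `M → M^*`. -/
def QForm.IsSimpleForm (v : QForm Λ ε) : Prop :=
  ∃ e : v.M ≃ₗ[Λ] SDual Λ v.M, IsSimple Z (M := v.M) (N := v.M.dual) e ∧ ∀ x, e x = v.phi x

/-- The sequence `0 → A → B → C → 0` is exact and based: for a section `s` of `p`, the isomorphism
`A ⊕ C → B`, `(a, c) ↦ i a + s c`, is simple. -/
structure BasedExact {A B C : BasedModule Λ} (i : A →ₗ[Λ] B) (p : B →ₗ[Λ] C) : Prop where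
  inj : Function.Injective i
  exact : Function.Exact i p
  based : ∃ (s : C →ₗ[Λ] B) (e : (A × C) ≃ₗ[Λ] B), (∀ c, p (s c) = c) ∧
    (∀ a c, e (a, c) = i a + s c) ∧ IsSimple Z (M := A.prod C) (N := B) e

/-- The homomorphism `j^* φ : M → L^*`, whose kernel is the annihilator `L^⊥`. -/
def QForm.perpMap (v : QForm Λ ε) {L : BasedModule Λ} (j : L →ₗ[Λ] v.M) : v.M →ₗ[Λ] L.dual :=
  (dualMap j).comp v.phi

/-- `j : L → M` is (the inclusion of) a simple Lagrangian of the form `v` on `M`: a direct summand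
with `L = L^⊥` and `j^* ψ j = 0 ∈ Q_ε(L)`, such that the `s`-basis of `M` is a Hamiltonian one, that
is, `0 → L → M → L^* → 0` is based. -/
structure IsSimpleLagrangian (v : QForm Λ ε) (L : BasedModule Λ) (j : L →ₗ[Λ] v.M) : Prop where
  summand : ∃ r : v.M →ₗ[Λ] L, ∀ x, r (j x) = x
  perp : ∀ x : v.M, x ∈ LinearMap.range j ↔ v.perpMap j x = 0
  isotropic : QGrp.pull j v.q = 0
  based : BasedExact Z (A := L) (B := v.M) (C := L.dual) j (v.perpMap j)

variable {Z}

theorem IsSimpleLagrangian.rank {v : QForm Λ ε} {L : BasedModule Λ} {j : L →ₗ[Λ] v.M}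
    (h : IsSimpleLagrangian Z v L j) : 2 * L.rank = v.M.rank := by
  obtain ⟨s, e, -, -, -⟩ := h.based.based
  have h1 := BasedModule.rank_eq (M := L.prod L.dual) (N := v.M) e
  rw [BasedModule.rank_prod] at h1
  have h2 : L.dual.rank = L.rank := rfl
  omega

namespace Isometry

/-- The identity. -/
def refl (v : QForm Λ ε) : Isometry Z v v := ⟨LinearEquiv.refl Λ v.M, .refl _, QGrp.pull_id _⟩

/-- Composition. -/
def trans {v w x : QForm Λ ε} (f : Isometry Z v w) (g : Isometry Z w x) : Isometry Z v x where
  e := f.e.trans g.e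
  simple := f.simple.trans g.simple
  isom := by
    rw [← f.isom, ← g.isom, QGrp.pull_pull]; rfl

/-- The inverse. -/
def symm {v w : QForm Λ ε} (f : Isometry Z v w) : Isometry Z w v where
  e := f.e.symm
  simple := f.simple.symm
  isom := by
    rw [← f.isom, QGrp.pull_pull]
    have : f.e.toLinearMap.comp f.e.symm.toLinearMap = LinearMap.id := by ext x; simp
    rw [this, QGrp.pull_id]

/-- The orthogonal sum of isometries. -/
def sum {v w v' w' : QForm Λ ε} (f : Isometry Z v w) (f' : Isometry Z v' w') :
    Isometry Z (v.sum v') (w.sum w') where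
  e := f.e.prodCongr f'.e
  simple := f.simple.prod f'.simple
  isom := by
    change QGrp.pull _ (QGrp.pull (LinearMap.fst Λ w.M w'.M) w.q +
        QGrp.pull (LinearMap.snd Λ w.M w'.M) w'.q) =
      QGrp.pull (LinearMap.fst Λ v.M v'.M) v.q + QGrp.pull (LinearMap.snd Λ v.M v'.M) v'.q
    rw [← f.isom, ← f'.isom, map_add, QGrp.pull_pull, QGrp.pull_pull, QGrp.pull_pull,
      QGrp.pull_pull]
    rfl

/-- `v ⊕ w ≅ w ⊕ v`. -/
def comm (v w : QForm Λ ε) : Isometry Z (v.sum w) (w.sum v) where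
  e := LinearEquiv.prodComm Λ v.M w.M
  simple := .of_eq_zero (torsion_prodComm _ _)
  isom := by
    rw [map_add, QGrp.pull_pull, QGrp.pull_pull, add_comm]
    rfl

/-- `(v ⊕ w) ⊕ x ≅ v ⊕ (w ⊕ x)`. -/
def assoc (v w x : QForm Λ ε) : Isometry Z ((v.sum w).sum x) (v.sum (w.sum x)) where
  e := LinearEquiv.prodAssoc Λ v.M w.M x.M
  simple := .of_eq_zero (torsion_prodAssoc _ _ _)
  isom := by
    simp only [map_add, QGrp.pull_pull, ← add_assoc]
    rfl

end Isometry

theorem QForm.IsSimpleForm.sum {v w : QForm Λ ε} (hv : v.IsSimpleForm Z) (hw : w.IsSimpleForm Z) :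
    (v.sum w).IsSimpleForm Z := by
  obtain ⟨e, he, h⟩ := hv
  obtain ⟨e', he', h'⟩ := hw
  refine ⟨(e.prodCongr e').trans (dualProd (Λ := Λ) v.M w.M).symm, ?_, fun x => ?_⟩
  · have h0 : IsSimple Z (M := (v.M.prod w.M).dual) (N := v.M.dual.prod w.M.dual)
      (dualProd (Λ := Λ) v.M w.M) := .of_eq_zero (torsion_dualProd v.M w.M)
    have h1 := IsSimple.symm (M := (v.M.prod w.M).dual) (N := v.M.dual.prod w.M.dual) h0
    have h2 := IsSimple.prod (M := v.M) (N := v.M.dual) (M' := w.M) (N' := w.M.dual) he he'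
    exact IsSimple.trans (M := v.M.prod w.M) (N := v.M.dual.prod w.M.dual)
      (P := (v.M.prod w.M).dual) h2 h1
  · ext y
    refine Eq.trans ?_ (QForm.phi_sum v w x y).symm
    change e x.1 y.1 + e' x.2 y.2 = _
    rw [h, h']

theorem QForm.hyp_isSimpleForm (P : BasedModule Λ) : (QForm.hyp ε P).IsSimpleForm Z := by
  refine ⟨(LinearEquiv.prodComm Λ P (SDual Λ P)).trans
    (((LinearEquiv.refl Λ (SDual Λ P)).prodCongr ((signEquiv Λ P ε).trans (evEquiv P))).trans
      (dualProd (Λ := Λ) P (SDual Λ P)).symm), ?_, fun x => ?_⟩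
  · have h0 : IsSimple Z (M := P) (N := P.dual.dual) ((signEquiv Λ P ε).trans (evEquiv P)) :=
      IsSimple.trans (M := P) (N := P) (P := P.dual.dual) (.of_eq_zero (torsion_sign P ε))
        (.of_eq_zero (torsion_evEquiv P))
    have h1 := IsSimple.prod (M := P.dual) (N := P.dual) (M' := P) (N' := P.dual.dual)
      (IsSimple.refl (Z := Z) P.dual) h0
    have h2' : IsSimple Z (M := (P.prod P.dual).dual) (N := P.dual.prod P.dual.dual)
      (dualProd (Λ := Λ) P (SDual Λ P)) := .of_eq_zero (torsion_dualProd P P.dual)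
    have h2 := IsSimple.symm (M := (P.prod P.dual).dual) (N := P.dual.prod P.dual.dual) h2'
    have h3 : IsSimple Z (M := P.prod P.dual) (N := P.dual.prod P)
      (LinearEquiv.prodComm Λ P (SDual Λ P)) := .of_eq_zero (torsion_prodComm P P.dual)
    exact IsSimple.trans (M := P.prod P.dual) (N := P.dual.prod P) (P := (P.prod P.dual).dual) h3
      (IsSimple.trans (M := P.dual.prod P) (N := P.dual.prod P.dual.dual)
        (P := (P.prod P.dual).dual) h1 h2)
  · ext y
    refine Eq.trans ?_ (QForm.phi_hyp P x y).symm
    change x.2 y.1 + star (y.2 ((ε : ℤ) • x.1)) = _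
    rw [map_zsmul, star_zsmul]

theorem IsSimpleLagrangian.hyp (P : BasedModule Λ) :
    IsSimpleLagrangian Z (QForm.hyp ε P) P (LinearMap.inl Λ P (SDual Λ P)) := by
  have h : ∀ x : P × SDual Λ P,
      (QForm.hyp ε P).perpMap (L := P) (LinearMap.inl Λ P (SDual Λ P)) x = x.2 := by
    intro x
    refine SDual.ext fun y => ?_
    refine (QForm.phi_hyp (ε := ε) P x (y, 0)).trans ?_
    simp
  have h1 : ∀ x : P × SDual Λ P, x ∈ LinearMap.range (LinearMap.inl Λ P (SDual Λ P)) ↔ x.2 = 0 := by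
    intro x
    constructor
    · rintro ⟨y, rfl⟩; rfl
    · intro hx
      exact ⟨x.1, Prod.ext rfl hx.symm⟩
  refine ⟨⟨LinearMap.fst Λ P (SDual Λ P), fun x => rfl⟩, fun x => ?_, ?_, ?_, ?_, ?_⟩
  · rw [h]; exact h1 x
  · rw [QGrp.pull_mk]
    have : QGrp.pullHom (LinearMap.inl Λ P (SDual Λ P)) (QForm.hypHom P) = 0 := by
      ext x y; rfl
    rw [this, map_zero]
  · intro x y hxy
    exact congrArg Prod.fst hxy
  · intro x
    rw [h]
    exact (h1 x).symm
  · refine ⟨LinearMap.inr Λ P (SDual Λ P), LinearEquiv.refl Λ _, fun c => h _, fun a c => ?_,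
      IsSimple.refl (P.prod P.dual)⟩
    change (a, c) = (a, (0 : SDual Λ P)) + ((0 : P), c)
    simp

theorem IsSimpleLagrangian.sum {v w : QForm Λ ε} {L K : BasedModule Λ} {j : L →ₗ[Λ] v.M}
    {k : K →ₗ[Λ] w.M} (hj : IsSimpleLagrangian Z v L j) (hk : IsSimpleLagrangian Z w K k) :
    IsSimpleLagrangian Z (v.sum w) (L.prod K) (j.prodMap k) := by
  have h : ∀ x : v.M × w.M, (v.sum w).perpMap (L := L.prod K) (j.prodMap k) x =
      (dualProd (Λ := Λ) L K).symm (v.perpMap j x.1, w.perpMap k x.2) := by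
    intro x
    refine SDual.ext fun y => ?_
    exact QForm.phi_sum v w x (j y.1, k y.2)
  have h1 : ∀ x : v.M × w.M, (v.sum w).perpMap (L := L.prod K) (j.prodMap k) x = 0 ↔
      v.perpMap j x.1 = 0 ∧ w.perpMap k x.2 = 0 := by
    intro x
    rw [h]
    refine (LinearEquiv.map_eq_zero_iff _).trans ?_
    exact Prod.mk_eq_zero
  have h2 : ∀ x : v.M × w.M, x ∈ LinearMap.range (j.prodMap k) ↔
      x.1 ∈ LinearMap.range j ∧ x.2 ∈ LinearMap.range k := by
    intro x
    constructor
    · rintro ⟨y, rfl⟩; exact ⟨⟨y.1, rfl⟩, ⟨y.2, rfl⟩⟩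
    · rintro ⟨⟨a, ha⟩, ⟨b, hb⟩⟩; exact ⟨(a, b), Prod.ext ha hb⟩
  have h3 : ∀ x : v.M × w.M, x ∈ LinearMap.range (j.prodMap k) ↔
      (v.sum w).perpMap (L := L.prod K) (j.prodMap k) x = 0 := by
    intro x
    rw [h2, h1, hj.perp, hk.perp]
  obtain ⟨r, hr⟩ := hj.summand
  obtain ⟨r', hr'⟩ := hk.summand
  refine ⟨⟨r.prodMap r', fun x => Prod.ext (hr _) (hr' _)⟩, h3, ?_, ?_, ?_, ?_⟩
  · have e1 : (LinearMap.fst Λ v.M w.M).comp (j.prodMap k) = j.comp (LinearMap.fst Λ L K) := rfl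
    have e2 : (LinearMap.snd Λ v.M w.M).comp (j.prodMap k) = k.comp (LinearMap.snd Λ L K) := rfl
    change QGrp.pull (j.prodMap k) (QGrp.pull (LinearMap.fst Λ v.M w.M) v.q +
        QGrp.pull (LinearMap.snd Λ v.M w.M) w.q) = 0
    rw [map_add, QGrp.pull_pull, QGrp.pull_pull, e1, e2, ← QGrp.pull_pull, ← QGrp.pull_pull,
      hj.isotropic, hk.isotropic, map_zero, map_zero, add_zero]
  · intro x y hxy
    exact Prod.ext (hj.based.inj (congrArg Prod.fst hxy)) (hk.based.inj (congrArg Prod.snd hxy))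
  · intro x
    exact (h3 x).symm
  · obtain ⟨s, e, hs, he, hes⟩ := hj.based.based
    obtain ⟨s', e', hs', he', hes'⟩ := hk.based.based
    refine ⟨(s.prodMap s').comp (dualProd (Λ := Λ) L K).toLinearMap,
      ((LinearEquiv.refl Λ (L × K)).prodCongr (dualProd (Λ := Λ) L K)).trans
        ((LinearEquiv.prodProdProdComm Λ L K (SDual Λ L) (SDual Λ K)).trans
          (e.prodCongr e')), fun c => ?_, fun a c => ?_, ?_⟩
    · rw [h]
      change (dualProd (Λ := Λ) L K).symm (v.perpMap j (s (dualProd (Λ := Λ) L K c).1),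
        w.perpMap k (s' (dualProd (Λ := Λ) L K c).2)) = c
      rw [hs, hs']
      exact LinearEquiv.symm_apply_apply _ c
    · change (e (a.1, (dualProd (Λ := Λ) L K c).1), e' (a.2, (dualProd (Λ := Λ) L K c).2)) = _
      rw [he, he']
      rfl
    · have t0 : IsSimple Z (M := (L.prod K).dual) (N := L.dual.prod K.dual)
          (dualProd (Λ := Λ) L K) := .of_eq_zero (torsion_dualProd L K)
      have t1 := IsSimple.prod (M := L.prod K) (N := L.prod K) (M' := (L.prod K).dual)
        (N' := L.dual.prod K.dual) (IsSimple.refl (Z := Z) (L.prod K)) t0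
      have t2 : IsSimple Z (M := (L.prod K).prod (L.dual.prod K.dual))
          (N := (L.prod L.dual).prod (K.prod K.dual))
          (LinearEquiv.prodProdProdComm Λ L K (SDual Λ L) (SDual Λ K)) :=
        .of_eq_zero (torsion_prodProdProdComm L K L.dual K.dual)
      have t3 := IsSimple.prod (M := L.prod L.dual) (N := v.M) (M' := K.prod K.dual) (N' := w.M)
        hes hes'
      exact IsSimple.trans (M := (L.prod K).prod (L.prod K).dual)
        (N := (L.prod K).prod (L.dual.prod K.dual)) (P := v.M.prod w.M) t1
        (IsSimple.trans (M := (L.prod K).prod (L.dual.prod K.dual))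
          (N := (L.prod L.dual).prod (K.prod K.dual)) (P := v.M.prod w.M) t2 t3)

end Forms

section QuasiFormations

variable {Λ : Type u} [Ring Λ] [StarRing Λ] [InvariantBasisNumber Λ]
variable (Z : AddSubgroup (RedK1 Λ)) (ε : ℤˣ)

/-- An `ε`-quadratic quasi-formation `(M, ψ; L, V)`: a simple form, a simple Lagrangian `L` and a
based half rank direct summand `V`. The based submodules `L` and `V` are given by based modules
with split injections `jL` and `jV` into `M`. -/
structure QuasiFormation : Type (u + 1) where
  form : QForm Λ ε
  simple : form.IsSimpleForm Z
  L : BasedModule Λ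
  jL : L →ₗ[Λ] form.M
  lagrangian : IsSimpleLagrangian Z form L jL
  V : BasedModule Λ
  jV : V →ₗ[Λ] form.M
  split : ∃ r : form.M →ₗ[Λ] V, ∀ x, r (jV x) = x
  half : 2 * V.rank = form.M.rank

variable {Z ε}

namespace QuasiFormation

/-- The direct sum of quasi-formations. -/
def sum (x y : QuasiFormation Z ε) : QuasiFormation Z ε where
  form := x.form.sum y.form
  simple := x.simple.sum y.simple
  L := x.L.prod y.L
  jL := x.jL.prodMap y.jL
  lagrangian := x.lagrangian.sum y.lagrangian
  V := x.V.prod y.V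
  jV := x.jV.prodMap y.jV
  split := by
    obtain ⟨r, hr⟩ := x.split
    obtain ⟨s, hs⟩ := y.split
    exact ⟨r.prodMap s, fun z => Prod.ext (hr z.1) (hs z.2)⟩
  half := by
    have h1 := x.half
    have h2 := y.half
    change 2 * (x.V.prod y.V).rank = (x.form.M.prod y.form.M).rank
    rw [BasedModule.rank_prod, BasedModule.rank_prod]
    omega

/-- The trivial formation `(H_ε(P); P, P^*)`. -/
def trivial (Z : AddSubgroup (RedK1 Λ)) (ε : ℤˣ) (P : BasedModule Λ) : QuasiFormation Z ε where
  form := QForm.hyp ε P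
  simple := QForm.hyp_isSimpleForm P
  L := P
  jL := LinearMap.inl Λ P (SDual Λ P)
  lagrangian := IsSimpleLagrangian.hyp P
  V := P.dual
  jV := LinearMap.inr Λ P (SDual Λ P)
  split := ⟨LinearMap.snd Λ P (SDual Λ P), fun _ => rfl⟩
  half := by
    have h : P.dual.rank = P.rank := rfl
    change 2 * P.dual.rank = (P.prod P.dual).rank
    rw [BasedModule.rank_prod]
    omega

/-- The boundary `(H_ε(K); K, (1; ρ) K)` of an asymmetric form `(K, ρ)`. -/
def boundary (Z : AddSubgroup (RedK1 Λ)) (ε : ℤˣ) (K : BasedModule Λ) (ρ : K →ₗ[Λ] SDual Λ K) :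
    QuasiFormation Z ε where
  form := QForm.hyp ε K
  simple := QForm.hyp_isSimpleForm K
  L := K
  jL := LinearMap.inl Λ K (SDual Λ K)
  lagrangian := IsSimpleLagrangian.hyp K
  V := K
  jV := LinearMap.id.prod ρ
  split := ⟨LinearMap.fst Λ K (SDual Λ K), fun _ => rfl⟩
  half := by
    have h : K.dual.rank = K.rank := rfl
    change 2 * K.rank = (K.prod K.dual).rank
    rw [BasedModule.rank_prod]
    omega

/-- The simple formation `(M, ψ; K, L)` of two simple Lagrangians. -/
def ofLagrangians (v : QForm Λ ε) (hv : v.IsSimpleForm Z) {K L : BasedModule Λ}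
    {jK : K →ₗ[Λ] v.M} {jL : L →ₗ[Λ] v.M} (hK : IsSimpleLagrangian Z v K jK)
    (hL : IsSimpleLagrangian Z v L jL) : QuasiFormation Z ε where
  form := v
  simple := hv
  L := K
  jL := jK
  lagrangian := hK
  V := L
  jV := jL
  split := hL.summand
  half := hL.rank

/-- The quasi-formation `(M, ψ; K, V)` obtained from `x = (M, ψ; L, V)` by changing the simple
Lagrangian. -/
def changeLagrangian (x : QuasiFormation Z ε) {K : BasedModule Λ} {jK : K →ₗ[Λ] x.form.M}
    (hK : IsSimpleLagrangian Z x.form K jK) : QuasiFormation Z ε where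
  form := x.form
  simple := x.simple
  L := K
  jL := jK
  lagrangian := hK
  V := x.V
  jV := x.jV
  split := x.split
  half := x.half

/-- An isomorphism of quasi-formations: an isometry which restricts to simple isomorphisms
`L ≃ L'` and `V ≃ V'`. -/
structure Iso (x y : QuasiFormation Z ε) where
  f : Isometry Z x.form y.form
  eL : x.L ≃ₗ[Λ] y.L
  eL_simple : IsSimple Z eL
  eL_comm : ∀ a, f.e (x.jL a) = y.jL (eL a)
  eV : x.V ≃ₗ[Λ] y.V
  eV_simple : IsSimple Z eV
  eV_comm : ∀ a, f.e (x.jV a) = y.jV (eV a)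

/-- `x ⊕ y ≅ y ⊕ x`. -/
def Iso.comm (x y : QuasiFormation Z ε) : Iso (x.sum y) (y.sum x) where
  f := Isometry.comm x.form y.form
  eL := LinearEquiv.prodComm Λ x.L y.L
  eL_simple := .of_eq_zero (torsion_prodComm x.L y.L)
  eL_comm _ := rfl
  eV := LinearEquiv.prodComm Λ x.V y.V
  eV_simple := .of_eq_zero (torsion_prodComm x.V y.V)
  eV_comm _ := rfl

/-- `(x ⊕ y) ⊕ z ≅ x ⊕ (y ⊕ z)`. -/
def Iso.assoc (x y z : QuasiFormation Z ε) : Iso ((x.sum y).sum z) (x.sum (y.sum z)) where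
  f := Isometry.assoc x.form y.form z.form
  eL := LinearEquiv.prodAssoc Λ x.L y.L z.L
  eL_simple := .of_eq_zero (torsion_prodAssoc x.L y.L z.L)
  eL_comm _ := rfl
  eV := LinearEquiv.prodAssoc Λ x.V y.V z.V
  eV_simple := .of_eq_zero (torsion_prodAssoc x.V y.V z.V)
  eV_comm _ := rfl

/-- The congruence on quasi-formations which defines `l_{2q+1}(Λ)`: it is generated by
isomorphism, by the addition of trivial formations, and by
`(M, ψ; K, L) ⊕ (M, ψ; L, V) ∼ (M, ψ; K, V)` for simple Lagrangians `K` and `L`. -/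
inductive Rel : QuasiFormation Z ε → QuasiFormation Z ε → Prop
  | iso {x y : QuasiFormation Z ε} (f : Iso x y) : Rel x y
  | stab (x : QuasiFormation Z ε) (P : BasedModule Λ) : Rel (x.sum (trivial Z ε P)) x
  | shift (x : QuasiFormation Z ε) {K : BasedModule Λ} {jK : K →ₗ[Λ] x.form.M}
      (hK : IsSimpleLagrangian Z x.form K jK) :
      Rel ((ofLagrangians x.form x.simple hK x.lagrangian).sum x) (x.changeLagrangian hK)
  | refl (x : QuasiFormation Z ε) : Rel x x
  | symm {x y : QuasiFormation Z ε} : Rel x y → Rel y x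
  | trans {x y z : QuasiFormation Z ε} : Rel x y → Rel y z → Rel x z
  | sum {x y x' y' : QuasiFormation Z ε} : Rel x y → Rel x' y' → Rel (x.sum x') (y.sum y')

end QuasiFormation

variable (Z ε)

/-- The `l`-monoid `l_{2q+1}(Λ)`, `ε = (-1)^q`. -/
def LMonoid : Type (u + 1) := Quot (QuasiFormation.Rel (Z := Z) (ε := ε))

namespace LMonoid

variable {Z ε}

/-- The class `[x]` of a quasi-formation. -/
def mk (x : QuasiFormation Z ε) : LMonoid Z ε := Quot.mk _ x

theorem sound {x y : QuasiFormation Z ε} (h : QuasiFormation.Rel x y) : mk x = mk y :=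
  Quot.sound h

instance : Add (LMonoid Z ε) :=
  ⟨Quot.map₂ QuasiFormation.sum (fun a _ _ h => .sum (.refl a) h) fun _ _ b h => .sum h (.refl b)⟩

instance : Zero (LMonoid Z ε) := ⟨mk (QuasiFormation.trivial Z ε (BasedModule.std Λ 0))⟩

theorem mk_add (x y : QuasiFormation Z ε) : mk x + mk y = mk (x.sum y) := rfl

instance : AddCommMonoid (LMonoid Z ε) where
  add_assoc a b c := by
    induction a using Quot.ind
    induction b using Quot.ind
    induction c using Quot.ind
    exact sound (.iso (.assoc _ _ _))
  add_comm a b := by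
    induction a using Quot.ind
    induction b using Quot.ind
    exact sound (.iso (.comm _ _))
  add_zero a := by
    induction a using Quot.ind
    exact sound (.stab _ _)
  zero_add a := by
    induction a using Quot.ind
    exact sound (.trans (.iso (.comm _ _)) (.stab _ _))
  nsmul := nsmulRec

variable (Z ε)

/-- The subset `L^s_{2q+1}(Λ)` of `l_{2q+1}(Λ)`: the classes of the simple formations, that is, of
the quasi-formations `(M, ψ; L, V)` where `V` is a simple Lagrangian. -/
def simpleL : Set (LMonoid Z ε) :=
  {ξ | ∃ x : QuasiFormation Z ε, IsSimpleLagrangian Z x.form x.V x.jV ∧ mk x = ξ}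

/-- The elementary elements: the classes of the boundaries of asymmetric forms. -/
def elementary : Set (LMonoid Z ε) :=
  {ξ | ∃ (K : BasedModule Λ) (ρ : K →ₗ[Λ] SDual Λ K), mk (QuasiFormation.boundary Z ε K ρ) = ξ}

end LMonoid

/-- The `0`-stabilised forms: forms modulo `v ∼ w` if `v ⊕ (P, 0) ≅ w ⊕ (Q, 0)`. -/
def ZSForm : Type (u + 1) :=
  Quot fun v w : QForm Λ ε => ∃ P Q : BasedModule Λ,
    Nonempty (Isometry Z (v.sum (QForm.zeroForm ε P)) (w.sum (QForm.zeroForm ε Q)))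

variable {ε} in
/-- The `0`-stabilised form `[v]`. -/
def ZSForm.mk (v : QForm Λ ε) : ZSForm Z ε := Quot.mk _ v

/-- `L^s_{2q}(Λ)`: simple forms modulo `v ∼ w` if `v ⊕ H_ε(P) ≅ w ⊕ H_ε(Q)`. -/
def SimpleLEven : Type (u + 1) :=
  Quot fun v w : {v : QForm Λ ε // v.IsSimpleForm Z} => ∃ P Q : BasedModule Λ,
    Nonempty (Isometry Z (v.1.sum (QForm.hyp ε P)) (w.1.sum (QForm.hyp ε Q)))

variable {Z ε}

/-- The class of a simple form. -/
def SimpleLEven.mk (v : QForm Λ ε) (hv : v.IsSimpleForm Z) : SimpleLEven Z ε := Quot.mk _ ⟨v, hv⟩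

/-- The zero of `L^s_{2q}(Λ)`, the class of the hyperbolic forms. -/
instance : Zero (SimpleLEven Z ε) :=
  ⟨SimpleLEven.mk (QForm.hyp ε (BasedModule.std Λ 0)) (QForm.hyp_isSimpleForm _)⟩

namespace QuasiFormation

/-- The annihilator `V^⊥ ⊆ M` of `V`, based in such a way that `0 → V^⊥ → M → V^* → 0` is based. -/
structure Perp (x : QuasiFormation Z ε) where
  W : BasedModule Λ
  i : W →ₗ[Λ] x.form.M
  based : BasedExact Z (A := W) (B := x.form.M) (C := x.V.dual) i (x.form.perpMap x.jV)

/-- The induced form `(V, θ)`. -/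
abbrev vform (x : QuasiFormation Z ε) : QForm Λ ε := x.form.restrict x.V x.jV

/-- The form `(V^⊥, -θ^⊥)`, where `θ^⊥` is the induced form. -/
abbrev pform {x : QuasiFormation Z ε} (p : x.Perp) : QForm Λ ε := (x.form.restrict p.W p.i).neg

end QuasiFormation

end QuasiFormations

section Split

variable {Λ : Type u} [Ring Λ] [StarRing Λ]

/-- The data of a split `(-ε)`-quadratic formation `(F, ((γ; μ), θ) G)`, with
`θ ∈ Q_ε(G)` and `γ^* μ = θ + ε θ^*`. Only boundaries of forms, trivial formations and their sums
occur below; for these, `(γ; μ) G` is always a simple Lagrangian of `H_{-ε}(F)`. -/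
structure SplitFormation (Λ : Type u) [Ring Λ] [StarRing Λ] (ε : ℤˣ) : Type (u + 1) where
  F : BasedModule Λ
  G : BasedModule Λ
  γ : G →ₗ[Λ] F
  μ : G →ₗ[Λ] SDual Λ F
  θ : QGrp Λ ε G
  rel : (dualMap γ).comp μ = QGrp.symm θ

variable {ε : ℤˣ}

namespace SplitFormation

/-- The direct sum. -/
abbrev sum (y z : SplitFormation Λ ε) : SplitFormation Λ ε where
  F := y.F.prod z.F
  G := y.G.prod z.G
  γ := y.γ.prodMap z.γ
  μ := (dualProd (Λ := Λ) y.F z.F).symm.toLinearMap.comp (y.μ.prodMap z.μ)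
  θ := QGrp.pull (LinearMap.fst Λ y.G z.G) y.θ + QGrp.pull (LinearMap.snd Λ y.G z.G) z.θ
  rel := by
    refine LinearMap.ext fun x => SDual.ext fun x' => ?_
    rw [map_add]
    have h1 := congrArg (fun f : y.G →ₗ[Λ] SDual Λ y.G => f x.1 x'.1) y.rel
    have h2 := congrArg (fun f : z.G →ₗ[Λ] SDual Λ z.G => f x.2 x'.2) z.rel
    refine (congrArg₂ (· + ·) h1 h2).trans ?_
    exact (congrArg₂ (· + ·) (QGrp.symm_pull (LinearMap.fst Λ y.G z.G) y.θ x x')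
      (QGrp.symm_pull (LinearMap.snd Λ y.G z.G) z.θ x x')).symm

/-- The trivial split formation `(P, P^*) = (P, ((0; 1), 0) P^*)`. -/
abbrev trivial (ε : ℤˣ) (P : BasedModule Λ) : SplitFormation Λ ε where
  F := P
  G := P.dual
  γ := 0
  μ := LinearMap.id
  θ := 0
  rel := by
    rw [map_zero]
    refine LinearMap.ext fun x => SDual.ext fun x' => ?_
    exact map_zero x

/-- The boundary `∂v = (K, ((1; ψ + ε ψ^*), ψ) K)` of the form `v = (K, ψ)`. -/
abbrev boundary (v : QForm Λ ε) : SplitFormation Λ ε where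
  F := v.M
  G := v.M
  γ := LinearMap.id
  μ := v.phi
  θ := v.q
  rel := rfl

end SplitFormation

variable [InvariantBasisNumber Λ] (Z : AddSubgroup (RedK1 Λ))

/-- An isomorphism `(α, β, ν)` of split formations:
* `α γ + α (ν + ε ν^*)^* μ = γ' β : G → F'` (read in `F'^{**}`),
* `α^{-*} μ = μ' β : G → F'^*`,
* `θ + μ^* ν μ = β^* θ' β ∈ Q_ε(G)`. -/
structure SplitIso (y z : SplitFormation Λ ε) where
  α : y.F ≃ₗ[Λ] z.F
  α_simple : IsSimple Z α
  β : y.G ≃ₗ[Λ] z.G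
  β_simple : IsSimple Z β
  ν : QGrp Λ ε (SDual Λ y.F)
  eqγ : ev.comp (α.toLinearMap.comp y.γ) +
      (dualMap (dualMap α.toLinearMap)).comp ((adj (QGrp.symm ν)).comp y.μ) =
    ev.comp (z.γ.comp β.toLinearMap)
  eqμ : (dualMap α.symm.toLinearMap).comp y.μ = z.μ.comp β.toLinearMap
  eqθ : y.θ + QGrp.pull y.μ ν = QGrp.pull β.toLinearMap z.θ

variable {Z}

namespace SplitIso

variable {y z w y' z' : SplitFormation Λ ε}

theorem eqγ_apply (f : SplitIso Z y z) (g : y.G) (u : SDual Λ z.F) :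
    u (f.α (y.γ g)) + QGrp.symm f.ν (dualMap f.α.toLinearMap u) (y.μ g) = u (z.γ (f.β g)) := by
  have h := congrArg (fun t : y.G →ₗ[Λ] SDual Λ (SDual Λ z.F) => star (t g u)) f.eqγ
  simpa using h

theorem eqμ_apply (f : SplitIso Z y z) (g : y.G) :
    dualMap f.α.symm.toLinearMap (y.μ g) = z.μ (f.β g) :=
  congrArg (fun t : y.G →ₗ[Λ] SDual Λ z.F => t g) f.eqμ

/-- Constructor with the first equation in evaluated form. -/
def ofApply (α : y.F ≃ₗ[Λ] z.F) (hα : IsSimple Z α) (β : y.G ≃ₗ[Λ] z.G) (hβ : IsSimple Z β)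
    (ν : QGrp Λ ε (SDual Λ y.F))
    (h1 : ∀ (g : y.G) (u : SDual Λ z.F),
      u (α (y.γ g)) + QGrp.symm ν (dualMap α.toLinearMap u) (y.μ g) = u (z.γ (β g)))
    (h2 : ∀ g : y.G, dualMap α.symm.toLinearMap (y.μ g) = z.μ (β g))
    (h3 : y.θ + QGrp.pull y.μ ν = QGrp.pull β.toLinearMap z.θ) : SplitIso Z y z where
  α := α
  α_simple := hα
  β := β
  β_simple := hβ
  ν := ν
  eqγ := by
    refine LinearMap.ext fun g => SDual.ext fun u => ?_
    have h := congrArg star (h1 g u)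
    rw [star_add] at h
    exact h
  eqμ := LinearMap.ext h2
  eqθ := h3

/-- The identity `(1, 1, 0)`. -/
def refl (y : SplitFormation Λ ε) : SplitIso Z y y :=
  ofApply (LinearEquiv.refl Λ y.F) (.refl y.F) (LinearEquiv.refl Λ y.G) (.refl y.G) 0
    (fun g u => by rw [map_zero]; exact add_zero _)
    (fun g => rfl)
    (by rw [map_zero, add_zero]; exact (QGrp.pull_id y.θ).symm)

/-- The composition of `f = (α, β, ν)` and `f' = (α', β', ν')`, namely
`f' ∘ f = (α' α, β' β, ν + α^{-1} ν' α^{-*})`. -/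
def trans (f : SplitIso Z y z) (f' : SplitIso Z z w) : SplitIso Z y w :=
  ofApply (f.α.trans f'.α) (f.α_simple.trans f'.α_simple) (f.β.trans f'.β)
    (f.β_simple.trans f'.β_simple) (f.ν + QGrp.pull (dualMap f.α.symm.toLinearMap) f'.ν)
    (fun g u => by
      have h1 := f.eqγ_apply g (dualMap f'.α.toLinearMap u)
      have h2 := f'.eqγ_apply (f.β g) u
      have h3 : dualMap f.α.symm.toLinearMap (dualMap (f.α.trans f'.α).toLinearMap u) =
          dualMap f'.α.toLinearMap u := by
        refine SDual.ext fun x => ?_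
        simp
      have h4 : dualMap (f.α.trans f'.α).toLinearMap u =
        dualMap f.α.toLinearMap (dualMap f'.α.toLinearMap u) := rfl
      rw [map_add, LinearMap.add_apply, SDual.add_apply, QGrp.symm_pull, h3, f.eqμ_apply, h4,
        ← add_assoc]
      refine Eq.trans ?_ h2
      exact congrArg (fun t => t + _) h1)
    (fun g => by
      have h1 := f.eqμ_apply g
      have h2 := f'.eqμ_apply (f.β g)
      rw [← h1] at h2
      exact h2)
    (by
      have h1 : (dualMap f.α.symm.toLinearMap).comp y.μ = z.μ.comp f.β.toLinearMap := f.eqμ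
      have h2 : (f.β.trans f'.β).toLinearMap = f'.β.toLinearMap.comp f.β.toLinearMap := rfl
      rw [map_add, QGrp.pull_pull, h1, ← add_assoc, f.eqθ, ← QGrp.pull_pull, ← map_add, f'.eqθ,
        QGrp.pull_pull, h2])

/-- The inverse `(α^{-1}, β^{-1}, -α ν α^*)`. -/
def symm (f : SplitIso Z y z) : SplitIso Z z y :=
  ofApply f.α.symm f.α_simple.symm f.β.symm f.β_simple.symm
    (-QGrp.pull (dualMap f.α.toLinearMap) f.ν)
    (fun g u => by
      have h1 := f.eqγ_apply (f.β.symm g) (dualMap f.α.symm.toLinearMap u)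
      have h2 := f.eqμ_apply (f.β.symm g)
      have h3 : dualMap f.α.toLinearMap (dualMap f.α.symm.toLinearMap u) = u := by
        refine SDual.ext fun x => ?_
        simp
      have h4 : dualMap f.α.toLinearMap (z.μ g) = y.μ (f.β.symm g) := by
        rw [LinearEquiv.apply_symm_apply] at h2
        rw [← h2]
        refine SDual.ext fun x => ?_
        simp
      rw [h3, LinearEquiv.apply_symm_apply] at h1
      rw [map_neg, LinearMap.neg_apply, SDual.neg_apply, QGrp.symm_pull, h3, h4]
      have h5 : (dualMap f.α.symm.toLinearMap u) (f.α (y.γ (f.β.symm g))) =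
        u (y.γ (f.β.symm g)) := by simp
      rw [h5] at h1
      have h6 : u (f.α.symm (z.γ g)) = (dualMap f.α.symm.toLinearMap u) (z.γ g) := rfl
      rw [h6, ← h1]
      abel)
    (fun g => by
      have h2 := f.eqμ_apply (f.β.symm g)
      rw [LinearEquiv.apply_symm_apply] at h2
      rw [← h2]
      refine SDual.ext fun x => ?_
      simp)
    (by
      have h1 : (dualMap f.α.toLinearMap).comp z.μ = y.μ.comp f.β.symm.toLinearMap := by
        refine LinearMap.ext fun g => ?_
        have h2 := f.eqμ_apply (f.β.symm g)
        rw [LinearEquiv.apply_symm_apply] at h2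
        refine SDual.ext fun x => ?_
        simp [← h2]
      have h2 := congrArg (QGrp.pull f.β.symm.toLinearMap) f.eqθ
      have h3 : f.β.toLinearMap.comp f.β.symm.toLinearMap = LinearMap.id := by
        refine LinearMap.ext fun g => ?_
        simp
      rw [map_add, QGrp.pull_pull, QGrp.pull_pull, h3, QGrp.pull_id] at h2
      rw [map_neg, QGrp.pull_pull, h1, ← h2]
      abel)

/-- The direct sum of isomorphisms. -/
def sum (f : SplitIso Z y z) (f' : SplitIso Z y' z') : SplitIso Z (y.sum y') (z.sum z') :=
  ofApply (y := y.sum y') (z := z.sum z') (f.α.prodCongr f'.α) (f.α_simple.prod f'.α_simple)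
    (f.β.prodCongr f'.β) (f.β_simple.prod f'.β_simple)
    (QGrp.pull (dualMap (LinearMap.inl Λ y.F y'.F)) f.ν +
      QGrp.pull (dualMap (LinearMap.inr Λ y.F y'.F)) f'.ν)
    (fun g u => by
      have h1 := f.eqγ_apply g.1 (dualMap (LinearMap.inl Λ z.F z'.F) u)
      have h2 := f'.eqγ_apply g.2 (dualMap (LinearMap.inr Λ z.F z'.F) u)
      have e1 : ∀ (a : z.F) (b : z'.F), u (a, b) = u (a, 0) + u (0, b) := by
        intro a b; rw [← map_add]; simp
      have e2 : dualMap (LinearMap.inl Λ y.F y'.F)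
          (dualMap (f.α.prodCongr f'.α).toLinearMap u) =
          dualMap f.α.toLinearMap (dualMap (LinearMap.inl Λ z.F z'.F) u) := by
        refine SDual.ext fun x => ?_
        simp
      have e3 : dualMap (LinearMap.inr Λ y.F y'.F)
          (dualMap (f.α.prodCongr f'.α).toLinearMap u) =
          dualMap f'.α.toLinearMap (dualMap (LinearMap.inr Λ z.F z'.F) u) := by
        refine SDual.ext fun x => ?_
        simp
      have e4 : dualMap (LinearMap.inl Λ y.F y'.F) ((y.sum y').μ g) = y.μ g.1 := by
        refine SDual.ext fun x => ?_
        change y.μ g.1 x + y'.μ g.2 0 = _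
        rw [map_zero, add_zero]
      have e5 : dualMap (LinearMap.inr Λ y.F y'.F) ((y.sum y').μ g) = y'.μ g.2 := by
        refine SDual.ext fun x => ?_
        change y.μ g.1 0 + y'.μ g.2 x = _
        rw [map_zero, zero_add]
      rw [map_add, LinearMap.add_apply, SDual.add_apply, QGrp.symm_pull, QGrp.symm_pull, e2, e3,
        e4, e5]
      change u (f.α (y.γ g.1), f'.α (y'.γ g.2)) + _ = u (z.γ (f.β g.1), z'.γ (f'.β g.2))
      rw [e1, e1 (z.γ (f.β g.1))]
      refine Eq.trans ?_ (congrArg₂ (· + ·) h1 h2)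
      exact add_add_add_comm _ _ _ _)
    (fun g => by
      have h1 := f.eqμ_apply g.1
      have h2 := f'.eqμ_apply g.2
      refine SDual.ext fun x => ?_
      change y.μ g.1 (f.α.symm x.1) + y'.μ g.2 (f'.α.symm x.2) =
        z.μ (f.β g.1) x.1 + z'.μ (f'.β g.2) x.2
      rw [← h1, ← h2]
      rfl)
    (by
      have e4 : (dualMap (LinearMap.inl Λ y.F y'.F)).comp (y.sum y').μ =
          y.μ.comp (LinearMap.fst Λ y.G y'.G) := by
        refine LinearMap.ext fun g => SDual.ext fun x => ?_
        change y.μ g.1 x + y'.μ g.2 0 = _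
        rw [map_zero, add_zero]
        rfl
      have e5 : (dualMap (LinearMap.inr Λ y.F y'.F)).comp (y.sum y').μ =
          y'.μ.comp (LinearMap.snd Λ y.G y'.G) := by
        refine LinearMap.ext fun g => SDual.ext fun x => ?_
        change y.μ g.1 0 + y'.μ g.2 x = _
        rw [map_zero, zero_add]
        rfl
      have e6 : (LinearMap.fst Λ z.G z'.G).comp (f.β.prodCongr f'.β).toLinearMap =
        f.β.toLinearMap.comp (LinearMap.fst Λ y.G y'.G) := rfl
      have e7 : (LinearMap.snd Λ z.G z'.G).comp (f.β.prodCongr f'.β).toLinearMap =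
        f'.β.toLinearMap.comp (LinearMap.snd Λ y.G y'.G) := rfl
      change QGrp.pull (LinearMap.fst Λ y.G y'.G) y.θ + QGrp.pull (LinearMap.snd Λ y.G y'.G) y'.θ +
        QGrp.pull _ _ = QGrp.pull _ (QGrp.pull (LinearMap.fst Λ z.G z'.G) z.θ +
          QGrp.pull (LinearMap.snd Λ z.G z'.G) z'.θ)
      rw [map_add, map_add, QGrp.pull_pull, QGrp.pull_pull, QGrp.pull_pull, QGrp.pull_pull, e4, e5,
        e6, e7, ← QGrp.pull_pull, ← QGrp.pull_pull, ← QGrp.pull_pull _ f.β.toLinearMap,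
        ← QGrp.pull_pull _ f'.β.toLinearMap, ← f.eqθ, ← f'.eqθ, map_add, map_add]
      exact add_add_add_comm _ _ _ _)

/-- `(x ⊕ y) ⊕ z ≅ x ⊕ (y ⊕ z)`. -/
def assoc (x y z : SplitFormation Λ ε) : SplitIso Z ((x.sum y).sum z) (x.sum (y.sum z)) :=
  ofApply (y := (x.sum y).sum z) (z := x.sum (y.sum z)) (LinearEquiv.prodAssoc Λ x.F y.F z.F)
    (.of_eq_zero (torsion_prodAssoc x.F y.F z.F))
    (LinearEquiv.prodAssoc Λ x.G y.G z.G) (.of_eq_zero (torsion_prodAssoc x.G y.G z.G)) 0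
    (fun g u => by rw [map_zero]; exact add_zero _)
    (fun g => by
      refine SDual.ext fun a => ?_
      exact add_assoc _ _ _)
    (by
      rw [map_zero, add_zero]
      simp only [map_add, QGrp.pull_pull, ← add_assoc]
      rfl)

/-- `(x ⊕ y) ⊕ z ≅ (x ⊕ z) ⊕ y`. -/
def rightComm (x y z : SplitFormation Λ ε) : SplitIso Z ((x.sum y).sum z) ((x.sum z).sum y) :=
  ofApply (y := (x.sum y).sum z) (z := (x.sum z).sum y) (QuadL.rightComm Λ x.F y.F z.F)
    (.of_eq_zero (torsion_rightComm x.F y.F z.F))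
    (QuadL.rightComm Λ x.G y.G z.G) (.of_eq_zero (torsion_rightComm x.G y.G z.G)) 0
    (fun g u => by rw [map_zero]; exact add_zero _)
    (fun g => by
      refine SDual.ext fun a => ?_
      exact add_right_comm _ _ _)
    (by
      rw [map_zero, add_zero]
      simp only [map_add, QGrp.pull_pull]
      refine (add_right_comm _ _ _).trans ?_
      rfl)

/-- The boundary `∂h = (h, h, 0)` of an isometry. -/
def ofIsometry {v w : QForm Λ ε} (h : Isometry Z v w) :
    SplitIso Z (SplitFormation.boundary v) (SplitFormation.boundary w) :=
  ofApply (y := SplitFormation.boundary v) (z := SplitFormation.boundary w) h.e h.simple h.e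
    h.simple 0
    (fun g u => by rw [map_zero]; exact add_zero _)
    (fun g => by
      refine SDual.ext fun a => ?_
      have h1 := QGrp.symm_pull h.e.toLinearMap w.q g (h.e.symm a)
      rw [h.isom] at h1
      refine h1.trans ?_
      change QGrp.symm w.q (h.e g) (h.e (h.e.symm a)) = QGrp.symm w.q (h.e g) a
      rw [LinearEquiv.apply_symm_apply])
    (by rw [map_zero, add_zero]; exact h.isom.symm)

/-- The identification `∂(v ⊕ w) = ∂v ⊕ ∂w`. -/
def boundarySum (v w : QForm Λ ε) : SplitIso Z (SplitFormation.boundary (v.sum w))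
    ((SplitFormation.boundary v).sum (SplitFormation.boundary w)) :=
  ofApply (y := SplitFormation.boundary (v.sum w))
    (z := (SplitFormation.boundary v).sum (SplitFormation.boundary w))
    (LinearEquiv.refl Λ (v.M × w.M)) (.refl (v.M.prod w.M)) (LinearEquiv.refl Λ (v.M × w.M))
    (.refl (v.M.prod w.M)) 0
    (fun g u => by rw [map_zero]; exact add_zero _)
    (fun g => SDual.ext fun a => QForm.phi_sum v w g a)
    (by rw [map_zero, add_zero]; exact (QGrp.pull_id _).symm)

/-- For a simple form `v = (M, ψ)` with symmetrisation `φ`, the isomorphism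
`(1, φ, -φ^{-*} ψ φ^{-1}) : ∂(M, ψ) ≅ (M, M^*)`. -/
noncomputable def ofSimpleForm (v : QForm Λ ε) (hv : v.IsSimpleForm Z) :
    SplitIso Z (SplitFormation.boundary v) (SplitFormation.trivial ε v.M) :=
  ofApply (y := SplitFormation.boundary v) (z := SplitFormation.trivial ε v.M)
    (LinearEquiv.refl Λ v.M) (.refl v.M) hv.choose hv.choose_spec.1
    (-QGrp.pull hv.choose.symm.toLinearMap v.q)
    (fun g u => by
      have h := hv.choose_spec.2
      rw [map_neg, LinearMap.neg_apply, SDual.neg_apply, QGrp.symm_pull]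
      have h1 : hv.choose.symm.toLinearMap ((SplitFormation.boundary v).μ g) = g := by
        change hv.choose.symm (v.phi g) = g
        rw [← h, LinearEquiv.symm_apply_apply]
      have h2 : ∀ x, QGrp.symm v.q x = hv.choose x := fun x => (h x).symm
      rw [h1, h2]
      change u g + -(hv.choose (hv.choose.symm u) g) = u 0
      rw [LinearEquiv.apply_symm_apply, map_zero]
      abel)
    (fun g => (hv.choose_spec.2 g).symm)
    (by
      have h1 : hv.choose.symm.toLinearMap.comp v.phi = LinearMap.id := by
        refine LinearMap.ext fun g => ?_
        change hv.choose.symm (v.phi g) = g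
        rw [← hv.choose_spec.2, LinearEquiv.symm_apply_apply]
      change v.q + QGrp.pull v.phi (-QGrp.pull hv.choose.symm.toLinearMap v.q) = QGrp.pull _ 0
      rw [map_neg, QGrp.pull_pull, h1, QGrp.pull_id, map_zero]
      abel)

/-- `Δ : G^* → F'` is a homotopy from `f = (α, β, ν)` to `f' = (α', β', ν')`:
* `β'^{-*} - β^{-*} = μ'^* Δ : G^* → G'^*`,
* `α' - α = Δ μ^* : F → F'`,
* `α' ν' α'^* - α ν α^* = (-ε α' γ + Δ θ) Δ^* ∈ Q_ε(F'^*)`,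

where `Δ^* : F'^* → G` is the homomorphism that corresponds to the dual of `Δ` under the
identification of `G` with `G^{**}`. -/
def Homotopic (f f' : SplitIso Z y z) : Prop :=
  ∃ (Δ : SDual Λ y.G →ₗ[Λ] z.F) (Δ' : SDual Λ z.F →ₗ[Λ] y.G),
    ev.comp Δ' = dualMap Δ ∧
    dualMap f'.β.symm.toLinearMap - dualMap f.β.symm.toLinearMap = (adj z.μ).comp Δ ∧
    f'.α.toLinearMap - f.α.toLinearMap = Δ.comp (adj y.μ) ∧
    QGrp.pull (dualMap f'.α.toLinearMap) f'.ν - QGrp.pull (dualMap f.α.toLinearMap) f.ν =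
      QGrp.mk ε (ev.comp ((-(ε : ℤ) • f'.α.toLinearMap.comp y.γ).comp Δ')) + QGrp.pull Δ' y.θ

end SplitIso

variable (Z) in
/-- A stable isomorphism `y ⊕ (P, P^*) ≅ z ⊕ (P', P'^*)`. -/
structure StableIso (y z : SplitFormation Λ ε) where
  P : BasedModule Λ
  P' : BasedModule Λ
  f : SplitIso Z (y.sum (SplitFormation.trivial ε P)) (z.sum (SplitFormation.trivial ε P'))

namespace StableIso

variable {y z y' z' : SplitFormation Λ ε}

/-- `(id_z ⊕ h) ∘ (f ⊕ id_{(R, R^*)}) ∘ (id_y ⊕ g) : y ⊕ (A, A^*) ≅ z ⊕ (B, B^*)`. -/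
def extend (f : StableIso Z y z) {A B R : BasedModule Λ}
    (g : SplitIso Z (SplitFormation.trivial ε A)
      ((SplitFormation.trivial ε f.P).sum (SplitFormation.trivial ε R)))
    (h : SplitIso Z ((SplitFormation.trivial ε f.P').sum (SplitFormation.trivial ε R))
      (SplitFormation.trivial ε B)) :
    SplitIso Z (y.sum (SplitFormation.trivial ε A)) (z.sum (SplitFormation.trivial ε B)) :=
  ((SplitIso.refl y).sum g).trans <| (SplitIso.assoc _ _ _).symm.trans <|
    (f.f.sum (SplitIso.refl (SplitFormation.trivial ε R))).trans <|
      (SplitIso.assoc _ _ _).trans ((SplitIso.refl z).sum h)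

/-- Stable homotopy of stable isomorphisms. -/
def Homotopic (f f' : StableIso Z y z) : Prop :=
  ∃ (A B R R' : BasedModule Λ)
    (g : SplitIso Z (SplitFormation.trivial ε A)
      ((SplitFormation.trivial ε f.P).sum (SplitFormation.trivial ε R)))
    (h : SplitIso Z ((SplitFormation.trivial ε f.P').sum (SplitFormation.trivial ε R))
      (SplitFormation.trivial ε B))
    (g' : SplitIso Z (SplitFormation.trivial ε A)
      ((SplitFormation.trivial ε f'.P).sum (SplitFormation.trivial ε R')))
    (h' : SplitIso Z ((SplitFormation.trivial ε f'.P').sum (SplitFormation.trivial ε R'))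
      (SplitFormation.trivial ε B)),
    (f.extend g h).Homotopic (f'.extend g' h')

/-- `b ∘ f ∘ a` for isomorphisms `a : y' ≅ y` and `b : z ≅ z'`. -/
def conj (f : StableIso Z y z) (a : SplitIso Z y' y) (b : SplitIso Z z z') :
    StableIso Z y' z' where
  P := f.P
  P' := f.P'
  f := ((a.sum (SplitIso.refl (SplitFormation.trivial ε f.P))).trans f.f).trans
    (b.sum (SplitIso.refl (SplitFormation.trivial ε f.P')))

/-- The identity of `y`, as a stable isomorphism. -/
def refl (y : SplitFormation Λ ε) : StableIso Z y y :=
  ⟨BasedModule.std Λ 0, BasedModule.std Λ 0, SplitIso.refl _⟩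

/-- `f ⊕ id_x : y ⊕ x ≅ z ⊕ x`. -/
def sumRefl (f : StableIso Z y z) (x : SplitFormation Λ ε) : StableIso Z (y.sum x) (z.sum x) where
  P := f.P
  P' := f.P'
  f := ((SplitIso.rightComm _ _ _).trans (f.f.sum (SplitIso.refl x))).trans
    (SplitIso.rightComm _ _ _)

end StableIso

/-- `∂l ∘ f ∘ ∂k^{-1}` for a stable isomorphism `f : ∂v ≅ ∂v'` and isometries `k : v ≅ w` and
`l : v' ≅ w'`. -/
def StableIso.conjIsometry {v v' w w' : QForm Λ ε}
    (f : StableIso Z (SplitFormation.boundary v) (SplitFormation.boundary v'))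
    (k : Isometry Z v w) (l : Isometry Z v' w') :
    StableIso Z (SplitFormation.boundary w) (SplitFormation.boundary w') :=
  f.conj (SplitIso.ofIsometry k.symm) (SplitIso.ofIsometry l)

/-- `f ⊕ ∂ id_Q : ∂(v ⊕ (Q, 0)) ≅ ∂(v' ⊕ (Q, 0))` for a stable isomorphism `f : ∂v ≅ ∂v'`. -/
def StableIso.stab {v v' : QForm Λ ε}
    (f : StableIso Z (SplitFormation.boundary v) (SplitFormation.boundary v'))
    (Q : BasedModule Λ) : StableIso Z (SplitFormation.boundary (v.sum (QForm.zeroForm ε Q)))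
      (SplitFormation.boundary (v'.sum (QForm.zeroForm ε Q))) :=
  (f.sumRefl (SplitFormation.boundary (QForm.zeroForm ε Q))).conj
    (SplitIso.boundarySum v (QForm.zeroForm ε Q))
    (SplitIso.boundarySum v' (QForm.zeroForm ε Q)).symm

variable (Z)

/-- `Iso(∂v, ∂v')`: the stable homotopy classes of stable isomorphisms `∂v ≅ ∂v'`. -/
def BoundaryIso (v v' : QForm Λ ε) : Type (u + 1) :=
  Quot (StableIso.Homotopic (Z := Z) (y := SplitFormation.boundary v)
    (z := SplitFormation.boundary v'))

/-- `bIso(v, v')`: the orbits of `Aut(v) × Aut(v')` on `Iso(∂v, ∂v')`, where `(g, h)` carries `[f]`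
to `[∂h ∘ f ∘ ∂g^{-1}]`. -/
def BIso (v v' : QForm Λ ε) : Type (u + 1) :=
  Quot fun a b : BoundaryIso Z v v' =>
    ∃ (f : StableIso Z (SplitFormation.boundary v) (SplitFormation.boundary v'))
      (g : Isometry Z v v) (h : Isometry Z v' v'),
      a = Quot.mk _ f ∧ b = Quot.mk _ (f.conjIsometry g h)

variable {Z}

/-- The class in `bIso(v, v')` of a stable isomorphism `∂v ≅ ∂v'`. -/
def BIso.mk {v v' : QForm Λ ε}
    (f : StableIso Z (SplitFormation.boundary v) (SplitFormation.boundary v')) : BIso Z v v' :=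
  Quot.mk _ (Quot.mk _ f)

/-- An `s`-basis of `Λ^k`. -/
structure SBasis (Λ : Type u) [Ring Λ] (k : ℕ) where
  m : ℕ
  n : ℕ
  sb : ((Fin k → Λ) × (Fin m → Λ)) ≃ₗ[Λ] (Fin n → Λ)

/-- The based module `(Λ^k, B)`. -/
abbrev SBasis.mod {k : ℕ} (B : SBasis Λ k) : BasedModule Λ where
  carrier := Fin k → Λ
  m := B.m
  n := B.n
  sb := B.sb

/-- The standard basis. -/
def SBasis.std (Λ : Type u) [Ring Λ] (k : ℕ) : SBasis Λ k where
  m := 0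
  n := k
  sb := LinearEquiv.prodUnique

/-- The form `v ⊕ ((Λ^k, B), 0)`. -/
abbrev QForm.stab (v : QForm Λ ε) {k : ℕ} (B : SBasis Λ k) : QForm Λ ε :=
  v.sum (QForm.zeroForm ε B.mod)

/-- A simple isomorphism, as an isometry of zero forms. -/
def Isometry.zero {P Q : BasedModule Λ} (e : P ≃ₗ[Λ] Q) (he : IsSimple Z e) :
    Isometry Z (QForm.zeroForm ε P) (QForm.zeroForm ε Q) :=
  ⟨e, he, map_zero _⟩

/-- If `(Λ^k, B) ⊕ (Λ^l, D) = (Λ^{k+l}, C)`, the identification of `(v ⊕ (Λ^k, B)) ⊕ (Λ^l, D)` with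
`v ⊕ (Λ^{k+l}, C)`. -/
def Isometry.join (v : QForm Λ ε) {k l : ℕ} (B : SBasis Λ k) (D : SBasis Λ l)
    (C : SBasis Λ (k + l))
    (h : IsSimple Z (M := B.mod.prod D.mod) (N := C.mod) (joinFin Λ k l)) :
    Isometry Z ((v.stab B).sum (QForm.zeroForm ε D.mod)) (v.stab C) where
  e := (LinearEquiv.prodAssoc Λ v.M (Fin k → Λ) (Fin l → Λ)).trans
    ((LinearEquiv.refl Λ v.M).prodCongr (joinFin Λ k l))
  simple := IsSimple.trans (M := (v.M.prod B.mod).prod D.mod) (N := v.M.prod (B.mod.prod D.mod))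
    (P := v.M.prod C.mod) (.of_eq_zero (torsion_prodAssoc v.M B.mod D.mod))
    (IsSimple.prod (M := v.M) (N := v.M) (M' := B.mod.prod D.mod) (N' := C.mod) (.refl v.M) h)
  isom := by
    simp only [map_zero, add_zero, QGrp.pull_pull]
    rfl

variable (Z)

/-- The index set of the direct system for `sbIso(v, v')`, with an element of the set at the
index. -/
structure SBIso.Pre (v v' : QForm Λ ε) : Type (u + 1) where
  k : ℕ
  B : SBasis Λ k
  elt : BIso Z (v.stab B) (v'.stab B)

/-- The transition maps `[f] ↦ [f ⊕ ∂ id_D]` of the direct system, from the index `(Λ^k, B)` to the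
index `(Λ^{k+l}, C) = (Λ^k, B) ⊕ (Λ^l, D)`. -/
inductive SBIso.Rel (v v' : QForm Λ ε) : SBIso.Pre Z v v' → SBIso.Pre Z v v' → Prop
  | mk {k l : ℕ} (B : SBasis Λ k) (D : SBasis Λ l) (C : SBasis Λ (k + l))
      (h : IsSimple Z (M := B.mod.prod D.mod) (N := C.mod) (joinFin Λ k l))
      (f : StableIso Z (SplitFormation.boundary (v.stab B))
        (SplitFormation.boundary (v'.stab B))) :
      SBIso.Rel v v' ⟨k, B, BIso.mk f⟩
        ⟨k + l, C, BIso.mk ((f.stab D.mod).conjIsometry (Isometry.join v B D C h)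
          (Isometry.join v' B D C h))⟩

/-- The stable boundary isomorphism set `sbIso(v, v')`, the direct limit of the sets
`bIso(v ⊕ (Q, 0), v' ⊕ (Q, 0))` over the based modules `Q = (Λ^k, B)`. -/
def SBIso (v v' : QForm Λ ε) : Type (u + 1) := Quot (SBIso.Rel Z v v')

variable {Z}

/-- The class in `sbIso(v, v')` of a stable isomorphism `∂(v ⊕ (Q, 0)) ≅ ∂(v' ⊕ (Q, 0))`. -/
def SBIso.mk {v v' : QForm Λ ε} {k : ℕ} (B : SBasis Λ k)
    (f : StableIso Z (SplitFormation.boundary (v.stab B)) (SplitFormation.boundary (v'.stab B))) :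
    SBIso Z v v' :=
  Quot.mk _ ⟨k, B, BIso.mk f⟩

/-- The element `1 = [∂ id]` of `sbAut(v) = sbIso(v, v)`. -/
instance (v : QForm Λ ε) : One (SBIso Z v v) := ⟨SBIso.mk (SBasis.std Λ 0) (StableIso.refl _)⟩

/-- The union `w ∪_f (-w')` along a stable isomorphism `f = (α, β, ν)` from `∂w`, `w = (V, θ)`, to
`∂w'`, `w' = (V', θ')`: the form on `V ⊕ V'^*` given by the matrix `(θ, 0; ε a, -s)`, where
`a : V → V'` is the first entry of `α` and `s ∈ Q_ε(V'^*)` is the first entry of `α ν α^*`. -/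
def unionForm {w w' : QForm Λ ε}
    (f : StableIso Z (SplitFormation.boundary w) (SplitFormation.boundary w')) : QForm Λ ε where
  M := w.M.prod w'.M.dual
  q := QGrp.pull (LinearMap.fst Λ w.M (SDual Λ w'.M)) w.q +
    QGrp.mk ε ((ε : ℤ) • (dualMap (LinearMap.snd Λ w.M (SDual Λ w'.M))).comp
      (ev.comp (((LinearMap.fst Λ w'.M f.P').comp (f.f.α.toLinearMap.comp
        (LinearMap.inl Λ w.M f.P))).comp (LinearMap.fst Λ w.M (SDual Λ w'.M))))) -
    QGrp.pull (LinearMap.snd Λ w.M (SDual Λ w'.M))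
      (QGrp.pull ((dualMap f.f.α.toLinearMap).comp (dualMap (LinearMap.fst Λ w'.M f.P'))) f.f.ν)

end Split

section Invariants

variable {Λ : Type u} [Ring Λ] [StarRing Λ] [InvariantBasisNumber Λ]
variable {Z : AddSubgroup (RedK1 Λ)} {ε : ℤˣ}

/-- The isometry `h : (V, θ) ⊕ H_ε(V^⊥) ≅ (V^⊥, -θ^⊥) ⊕ (M, ψ)` is the one determined by the
representative `ψ : M → M^*` and the section `σ` of `M → (V^⊥)^*`:
`h (x, w, u) = (c, j^⊥ c + σ u + j x)` with `c = -σ^* φ^* j x + w - σ^* ψ^* σ u`. -/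
def IsGluing (x : QuasiFormation Z ε) (p : x.Perp) (ψ : x.form.M →ₗ[Λ] SDual Λ x.form.M)
    (σ : SDual Λ p.W →ₗ[Λ] x.form.M)
    (h : Isometry Z (x.vform.sum (QForm.hyp ε p.W)) ((QuasiFormation.pform p).sum x.form)) :
    Prop :=
  ∀ (a : x.V) (w : p.W) (u : SDual Λ p.W),
    ev (h.e (a, (w, u))).1 = ev w - dualMap σ (adj x.form.phi (x.jV a)) -
      dualMap σ (adj ψ (σ u)) ∧
    (h.e (a, (w, u))).2 = p.i (h.e (a, (w, u))).1 + σ u + x.jV a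

/-- The stable isomorphism `∂(V, θ) ⊕ (M', M'^*) ≅ ∂(V^⊥, -θ^⊥) ⊕ (M, M^*)` induced by an isometry
`h : (V, θ) ⊕ (M', ψ') ≅ (V^⊥, -θ^⊥) ⊕ (M, ψ)`, where `(M', ψ') = H_ε(V^⊥)`. -/
noncomputable def gluingIso (x : QuasiFormation Z ε) (p : x.Perp)
    (h : Isometry Z (x.vform.sum (QForm.hyp ε p.W)) ((QuasiFormation.pform p).sum x.form)) :
    StableIso Z (SplitFormation.boundary x.vform)
      (SplitFormation.boundary (QuasiFormation.pform p)) where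
  P := p.W.prod p.W.dual
  P' := x.form.M
  f := ((SplitIso.refl (SplitFormation.boundary x.vform)).sum
      (SplitIso.ofSimpleForm (QForm.hyp ε p.W) (QForm.hyp_isSimpleForm p.W)).symm).trans <|
    (SplitIso.boundarySum x.vform (QForm.hyp ε p.W)).symm.trans <|
    (SplitIso.ofIsometry h).trans <|
    (SplitIso.boundarySum (QuasiFormation.pform p) x.form).trans
    ((SplitIso.refl (SplitFormation.boundary (QuasiFormation.pform p))).sum
      (SplitIso.ofSimpleForm x.form x.simple))

/-- `f` is a stable isomorphism `f_j : ∂(V, θ) ≅ ∂(V^⊥, -θ^⊥)` associated with the quasi-formation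
`x = (M, ψ; L, V)`, for some choice of a representative of `ψ ∈ Q_ε(M)` and of a section of
`M → (V^⊥)^*`. -/
def IsBoundaryIso (x : QuasiFormation Z ε) (p : x.Perp)
    (f : StableIso Z (SplitFormation.boundary x.vform)
      (SplitFormation.boundary (QuasiFormation.pform p))) : Prop :=
  ∃ (ψ : x.form.M →ₗ[Λ] SDual Λ x.form.M) (σ : SDual Λ p.W →ₗ[Λ] x.form.M)
    (h : Isometry Z (x.vform.sum (QForm.hyp ε p.W)) ((QuasiFormation.pform p).sum x.form)),
    QGrp.mk ε ψ = x.form.q ∧ (∀ u, x.form.perpMap p.i (σ u) = u) ∧ IsGluing x p ψ σ h ∧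
      f = gluingIso x p h

/-- The graph of `b : [M, ψ; L, V] ↦ ([V, θ], [V^⊥, -θ^⊥])`. -/
def IsB (ξ : LMonoid Z ε) (s : ZSForm Z ε × ZSForm Z ε) : Prop :=
  ∃ (x : QuasiFormation Z ε) (p : x.Perp), LMonoid.mk x = ξ ∧
    (ZSForm.mk Z x.vform, ZSForm.mk Z (QuasiFormation.pform p)) = s

/-- The graph of `δ : l_{2q+1}(v, v') → sbIso(v, v')`: `s = [∂l ∘ (f_j ⊕ ∂ id_Q) ∘ ∂k^{-1}]` for a
representative `(M, ψ; L, V)` of `ξ` and isometries `k : (V, θ) ⊕ (Q, 0) ≅ v ⊕ (P, 0)` and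
`l : (V^⊥, -θ^⊥) ⊕ (Q, 0) ≅ v' ⊕ (P, 0)`, where `P = (Λ^n, B)`. -/
def IsDelta (v v' : QForm Λ ε) (ξ : LMonoid Z ε) (s : SBIso Z v v') : Prop :=
  ∃ (x : QuasiFormation Z ε) (p : x.Perp)
    (f : StableIso Z (SplitFormation.boundary x.vform)
      (SplitFormation.boundary (QuasiFormation.pform p)))
    (Q : BasedModule Λ) (n : ℕ) (B : SBasis Λ n)
    (k : Isometry Z (x.vform.sum (QForm.zeroForm ε Q)) (v.stab B))
    (l : Isometry Z ((QuasiFormation.pform p).sum (QForm.zeroForm ε Q)) (v'.stab B)),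
    LMonoid.mk x = ξ ∧ IsBoundaryIso x p f ∧ SBIso.mk B ((f.stab Q).conjIsometry k l) = s

/-- `κ : sbIso(v, v') → L^s_{2q}(Λ)` is the map `[f] ↦ [(v ⊕ (Q, 0)) ∪_f -(v' ⊕ (Q, 0))]`; in
particular the union is always a simple form. -/
def IsKappa (v v' : QForm Λ ε) (κ : SBIso Z v v' → SimpleLEven Z ε) : Prop :=
  ∀ (k : ℕ) (B : SBasis Λ k)
    (f : StableIso Z (SplitFormation.boundary (v.stab B)) (SplitFormation.boundary (v'.stab B))),
    ∃ hf : (unionForm f).IsSimpleForm Z, κ (SBIso.mk B f) = SimpleLEven.mk (unionForm f) hf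

end Invariants

end QuadL

open QuadL

set_option linter.unusedSectionVars false

/-! The monoid $l_{2q+1}(\Lambda)$ and the stable boundary automorphisms are both compared with a
third set, `PairClass`: pairs $(M,\psi;V)$ of a form and a based module mapping to it, up to
isometries that are simple on $V$ and up to the addition of hyperbolic pairs $(H_\epsilon(P);P)$.

Forgetting $L$ sends $[M,\psi;L,V]$ to the class of $(M,\psi;V)$. This respects the congruence
because $(M,\psi;L)$ is itself a hyperbolic pair when $L$ is a simple Lagrangian
(`IsSimpleLagrangian.exists_pairIso`, `near_of_rel`). Its fibres are the orbits of
$L^s_{2q+1}(\Lambda)$: an isometry of pairs does not match the Lagrangians, but the image of one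
Lagrangian and the other one form a simple formation, which is the difference of the two classes
(`LMonoid.pairClass_eq_iff`).

Gluing sends a stable isomorphism $f$ to the union $(w\cup_f(-w');W)$, and this is injective on
$\mathrm{sbIso}$ (`SBIso.pairClass_injective`). Indeed $W'$ sits in the union as the annihilator of
$W$ with the negative of its form, so an isomorphism of unions restricts to isometries $w\cong w_1$
and $w'\cong w_1'$; what is left of it is a map $W'^*\to W$, and the isometry condition on this map
is the homotopy condition (`homotopic_conj_of_pairIso`). The argument depends on the fact that the
stable homotopy class of $f=(\alpha,\beta,\nu)$ is determined by the entries $a$ and $s$ that enter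
the union: the trivial summands impose no condition of their own (`SplitIso.transported_eq`,
`StableIso.homotopic_of_corner`).

The map $\delta$ is compatible with these two invariants, because gluing along $f_j$ gives back
$(M,\psi;V)$ (`nonempty_pair_of_isBoundaryIso`). So $\delta$ is well defined and its fibres are the
orbits. The map $b$ depends only on the pair, since $V^\perp$ is determined by $V$; and $\kappa$ is
the class of the form of the pair. If the union along $f$ is stably hyperbolic, a Lagrangian in a
stabilisation turns it into a quasi-formation that $\delta$ sends to $[f]$. The union along the
identity is the double of $v$, and a shear identifies the double of $(K,[\rho])$ with the pair of
the elementary quasi-formation of $\rho$; this gives the last statement.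

All isomorphisms have to be simple. The tools are that shears have trivial torsion
(`torsion_shear`), that duals of simple isomorphisms are simple (`IsSimple.dualCongr`), and that an
invertible block can be cancelled (`SEquiv.exists_of_block`). They give the simplicity of unions in
`exists_union_equiv`. -/

namespace QuadL

/-! ### Torsion of automorphisms, of $s$-bases and of shears. -/

section TorsionTools

variable {Λ : Type u} [Ring Λ] [InvariantBasisNumber Λ]

/-- A change of basis conjugates the matrix, and $\widetilde K_1(\Lambda)$ is abelian. -/
theorem tors_self_congr {X : Type u} [AddCommGroup X] [Module Λ X] (a b : Frame Λ X)
    (s : X ≃ₗ[Λ] X) : tors a a s = tors b b s := by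
  have h1 := tors_trans a a b s (LinearEquiv.refl Λ X)
  have h2 := tors_trans a b b (LinearEquiv.refl Λ X) s
  rw [LinearEquiv.trans_refl] at h1
  rw [LinearEquiv.refl_trans, h1, add_comm] at h2
  exact add_left_cancel h2

/-- The torsion of an automorphism can be computed in the stabilised `s`-basis. -/
theorem torsion_self (M : BasedModule Λ) (s : M ≃ₗ[Λ] M) :
    torsion (M := M) (N := M) s =
      tors M.frame M.frame (s.prodCongr (LinearEquiv.refl Λ (Fin M.m → Λ))) := by
  have h : stabIso (M := M) (N := M) s =
      ((s.prodCongr (LinearEquiv.refl Λ (Fin M.m → Λ))).prodCongr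
        (LinearEquiv.refl Λ (Fin M.m → Λ))).trans
      (stabIso (M := M) (N := M) (LinearEquiv.refl Λ M)) := LinearEquiv.ext fun _ => rfl
  have h2 := torsion_refl M
  rw [torsion] at h2
  rw [torsion, h, tors_trans _ (M.frame.prod (Frame.std Λ M.m)), h2, tors_prod_refl, add_zero]

theorem torsion_std {K : ℕ} (g : (Fin K → Λ) ≃ₗ[Λ] (Fin K → Λ)) :
    torsion (M := BasedModule.std Λ K) (N := BasedModule.std Λ K) g = RedK1.cls g := by
  rw [torsion_self]
  have h : tors (BasedModule.std Λ K).frame (Frame.std Λ K) LinearEquiv.prodUnique = 0 :=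
    tors_perm _ _ _ (Equiv.refl _) fun _ => rfl
  rw [tors_conj _ _ _ _ _ _ h h _ g (LinearEquiv.ext fun _ => rfl)]
  exact tors_eq (LinearEquiv.refl Λ _) (LinearEquiv.refl Λ _) g

/-- The `s`-basis of `M`, as an isomorphism `M ⊕ Λ^m ≅ Λ^n` of based modules, is simple. -/
theorem torsion_sb (M : BasedModule Λ) :
    torsion (M := M.prod (BasedModule.std Λ M.m)) (N := BasedModule.std Λ M.n) M.sb = 0 := by
  let X := BasedModule.std Λ M.m
  let F : Frame Λ ((M × (Fin M.m → Λ)) × (Fin M.m → Λ)) := M.frame.prod (Frame.std Λ M.m)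
  let S : ((M × (Fin M.m → Λ)) × (Fin M.m → Λ)) ≃ₗ[Λ] ((M × (Fin M.m → Λ)) × (Fin M.m → Λ)) :=
    rightComm Λ M (Fin M.m → Λ) (Fin M.m → Λ)
  -- The torsion of `M.sb` involves two copies of $\Lambda^m$, the summand and the stabilisation, in
  -- the wrong order; `S` exchanges them. Since `S` is an automorphism, its torsion may be computed
  -- in any basis, so `torsion_rightComm` applies.
  have hS : tors F F S = 0 := by
    have h1 := torsion_rightComm M X X
    have h2 := torsion_self ((M.prod X).prod X) S
    rw [h2, tors_self_congr _ (F.prod (Frame.std Λ _)), tors_prod_refl] at h1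
    exact h1
  let T := M.prod X
  have h0 : tors (T.frame.prod (Frame.std Λ 0)) F
      (((LinearEquiv.prodUnique : ((T × (Fin T.m → Λ)) × (Fin 0 → Λ)) ≃ₗ[Λ] _)).trans S) = 0 := by
    have h3 : tors (T.frame.prod (Frame.std Λ 0)) F
        ((LinearEquiv.prodUnique : ((T × (Fin T.m → Λ)) × (Fin 0 → Λ)) ≃ₗ[Λ] _).trans S) = 0 := by
      refine tors_perm _ _ _ (Equiv.refl _) fun x => ?_
      obtain ⟨⟨⟨x, a⟩, w⟩, z⟩ := x
      have h4 := BasedModule.prod_sb M X (x, a) (w, 0)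
      have h5 : joinFin Λ M.m 0 (w, 0) = w := by
        ext i
        exact joinFin_inl Λ M.m 0 (w, 0) i
      have h6 : T.sb ((x, a), w) = (M.frame.prod (Frame.std Λ M.m)).e ((x, w), a) := by
        refine Eq.trans ?_ h4
        exact congrArg (fun t => T.sb ((x, a), t)) h5.symm
      change F.e ((x, w), a) = fun i => (T.frame.prod (Frame.std Λ 0)).e (((x, a), w), z) i
      rw [← h6]
      ext i
      exact (joinFin_inl Λ _ 0 (T.sb ((x, a), w), z) i).symm
    exact h3
  have hd : tors ((BasedModule.std Λ M.n).frame.prod (Frame.std Λ T.m))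
      ((Frame.std Λ M.n).prod (Frame.std Λ M.m))
      ((LinearEquiv.prodUnique : ((Fin M.n → Λ) × (Fin 0 → Λ)) ≃ₗ[Λ] _).prodCongr
        (LinearEquiv.refl Λ (Fin M.m → Λ))) = 0 := by
    exact tors_perm _ _ _ (Equiv.refl _) fun _ => rfl
  have he : tors F ((Frame.std Λ M.n).prod (Frame.std Λ M.m))
      (M.sb.prodCongr (LinearEquiv.refl Λ (Fin M.m → Λ))) = 0 := by
    exact tors_perm _ _ _ (Equiv.refl _) fun _ => rfl
  have key := tors_conj (T.frame.prod (Frame.std Λ 0))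
    ((BasedModule.std Λ M.n).frame.prod (Frame.std Λ T.m)) F
    ((Frame.std Λ M.n).prod (Frame.std Λ M.m)) _ _ h0 hd
    (stabIso (M := T) (N := BasedModule.std Λ M.n) M.sb)
    (S.trans (M.sb.prodCongr (LinearEquiv.refl Λ (Fin M.m → Λ)))) (LinearEquiv.ext fun _ => rfl)
  rw [tors_trans _ F, hS, he, add_zero] at key
  exact key

/-- `(x, y) ↦ (x, y + f x)`. -/
def shear {X Y : Type u} [AddCommGroup X] [Module Λ X] [AddCommGroup Y] [Module Λ Y]
    (f : X →ₗ[Λ] Y) : (X × Y) ≃ₗ[Λ] (X × Y) :=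
  LinearEquiv.ofLinearMap
    ((LinearMap.fst Λ X Y).prod (LinearMap.snd Λ X Y + f.comp (LinearMap.fst Λ X Y)))
    ((LinearMap.fst Λ X Y).prod (LinearMap.snd Λ X Y - f.comp (LinearMap.fst Λ X Y)))
    (by ext <;> simp) (by ext <;> simp)

/-- After the addition of a second copy of $N$, the shear is a commutator of two elementary
automorphisms, as in $e_{12}(f)=[e_{13}(f),e_{32}(1)]$, and torsion takes values in an abelian
group. -/
theorem torsion_shear {M N : BasedModule Λ} (f : M →ₗ[Λ] N) :
    torsion (M := M.prod N) (N := M.prod N) (shear f) = 0 := by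
  let D := (M.prod N).prod N
  let a : D ≃ₗ[Λ] D := shear (X := M × N) (Y := N) (-f.comp (LinearMap.fst Λ M N))
  let b : D ≃ₗ[Λ] D := (LinearEquiv.prodComm Λ (M × N) N).trans
    ((shear (X := N) (Y := M × N) (LinearMap.inr Λ M N)).trans
      (LinearEquiv.prodComm Λ N (M × N)))
  have h : (shear f).prodCongr (LinearEquiv.refl Λ N) =
      b.symm.trans (a.symm.trans (b.trans a)) := by
    refine LinearEquiv.ext fun x => ?_
    obtain ⟨⟨x, y⟩, z⟩ := x
    change ((x, y + f x), z) = (((x - 0, y - z) + (0, z - -f (x - 0)) : M × N),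
      z - -f (x - 0) + -f (x - 0 + 0))
    simp only [sub_zero, add_zero, Prod.mk_add_mk, sub_neg_eq_add, add_neg_cancel_right]
    rw [← add_assoc, sub_add_cancel]
  have h1 := torsion_prod (M := M.prod N) (N := M.prod N) (M' := N) (N' := N) (shear f)
    (LinearEquiv.refl Λ N)
  rw [torsion_refl, add_zero] at h1
  rw [← h1, h]
  rw [torsion_trans (M := D) (N := D) (P := D), torsion_trans (M := D) (N := D) (P := D),
    torsion_trans (M := D) (N := D) (P := D), torsion_symm (M := D) (N := D),
    torsion_symm (M := D) (N := D)]
  abel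

end TorsionTools

/-! ### Duals of simple isomorphisms. -/

section DualTorsion

variable {Λ : Type u} [Ring Λ] [StarRing Λ] [InvariantBasisNumber Λ]

theorem torsion_dualPi (n : ℕ) :
    torsion (M := (BasedModule.std Λ n).dual) (N := BasedModule.std Λ n) (dualPi n) = 0 := by
  refine torsion_perm (M := (BasedModule.std Λ n).dual) (N := BasedModule.std Λ n) _
    (Equiv.refl _) (Equiv.refl _) fun f w => ?_
  refine BasedModule.dual_sb_ext (BasedModule.std Λ n) fun x a => ?_
  change ((dualPi n).symm (dualPi n f)) x = f x + ((dualPi 0).symm w) a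
  rw [LinearEquiv.symm_apply_apply]
  have : ((dualPi 0).symm w) a = 0 := by rw [dualPi_symm_apply]; simp
  rw [this, add_zero]

theorem torsion_joinFin (n k : ℕ) :
    torsion (M := (BasedModule.std Λ n).prod (BasedModule.std Λ k))
      (N := BasedModule.std Λ (n + k)) (joinFin Λ n k) = 0 := by
  refine torsion_perm (M := (BasedModule.std Λ n).prod (BasedModule.std Λ k))
    (N := BasedModule.std Λ (n + k)) _ (Equiv.refl _) (Equiv.refl _) fun x w => ?_
  obtain ⟨w, rfl⟩ := (joinFin Λ 0 0).surjective w
  exact (BasedModule.prod_sb (BasedModule.std Λ n) (BasedModule.std Λ k) x w).symm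

/-- The torsion of the dual of an isomorphism. -/
def dualTorsion {M N : BasedModule Λ} (e : M ≃ₗ[Λ] N) : RedK1 Λ :=
  torsion (M := N.dual) (N := M.dual) (dualCongr e)

theorem dualTorsion_trans {M N P : BasedModule Λ} (e : M ≃ₗ[Λ] N) (f : N ≃ₗ[Λ] P) :
    dualTorsion (M := M) (N := P) (e.trans f) = dualTorsion e + dualTorsion f := by
  have h := torsion_trans (M := P.dual) (N := N.dual) (P := M.dual) (dualCongr f) (dualCongr e)
  rw [add_comm]
  exact h

theorem dualTorsion_refl (M : BasedModule Λ) :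
    dualTorsion (M := M) (N := M) (LinearEquiv.refl Λ M) = 0 := torsion_refl M.dual

theorem dualTorsion_symm {M N : BasedModule Λ} (e : M ≃ₗ[Λ] N) :
    dualTorsion (M := N) (N := M) e.symm = - dualTorsion e := by
  have := dualTorsion_trans (P := M) e e.symm
  rw [LinearEquiv.self_trans_symm, dualTorsion_refl] at this
  exact (neg_eq_of_add_eq_zero_right this.symm).symm

theorem dualTorsion_prod {M N M' N' : BasedModule Λ} (e : M ≃ₗ[Λ] N) (e' : M' ≃ₗ[Λ] N') :
    dualTorsion (M := M.prod M') (N := N.prod N') (e.prodCongr e') =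
      dualTorsion e + dualTorsion e' := by
  have h1 := torsion_trans (M := (N.prod N').dual) (N := N.dual.prod N'.dual)
    (P := (M.prod M').dual) (dualProd (Λ := Λ) N N')
    (((dualCongr e).prodCongr (dualCongr e')).trans (dualProd (Λ := Λ) M M').symm)
  have h2 := torsion_trans (M := N.dual.prod N'.dual) (N := M.dual.prod M'.dual)
    (P := (M.prod M').dual) ((dualCongr e).prodCongr (dualCongr e')) (dualProd (Λ := Λ) M M').symm
  have h3 := torsion_symm (M := (M.prod M').dual) (N := M.dual.prod M'.dual)
    (dualProd (Λ := Λ) M M')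
  have h4 := torsion_prod (M := N.dual) (N := M.dual) (M' := N'.dual) (N' := M'.dual)
    (dualCongr e) (dualCongr e')
  rw [h2, h3, h4, torsion_dualProd, torsion_dualProd, neg_zero, add_zero, zero_add] at h1
  refine Eq.trans ?_ h1
  refine congrArg (torsion (M := (N.prod N').dual) (N := (M.prod M').dual))
    (LinearEquiv.ext fun f => SDual.ext fun x => ?_)
  change f (e x.1, e' x.2) = f (e x.1, 0) + f (0, e' x.2)
  rw [← map_add]
  simp

theorem dualTorsion_rightComm (M N P : BasedModule Λ) :
    dualTorsion (M := (M.prod N).prod P) (N := (M.prod P).prod N) (rightComm Λ M N P) = 0 := by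
  have a1 : ∀ (A B C : BasedModule Λ), torsion (M := ((A.prod B).prod C).dual)
      (N := (A.dual.prod B.dual).prod C.dual) ((dualProd (Λ := Λ) (A × B) C).trans
        ((dualProd (Λ := Λ) A B).prodCongr (LinearEquiv.refl Λ C.dual))) = 0 := by
    intro A B C
    have h1 := torsion_trans (M := ((A.prod B).prod C).dual) (N := (A.prod B).dual.prod C.dual)
      (P := (A.dual.prod B.dual).prod C.dual) (dualProd (Λ := Λ) (A × B) C)
      ((dualProd (Λ := Λ) A B).prodCongr (LinearEquiv.refl Λ C.dual))
    have h2 := torsion_prod (M := (A.prod B).dual) (N := A.dual.prod B.dual) (M' := C.dual)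
      (N' := C.dual) (dualProd (Λ := Λ) A B) (LinearEquiv.refl Λ C.dual)
    have h3 := torsion_dualProd (A.prod B) C
    rw [h1, h2, h3, torsion_dualProd, torsion_refl]
    simp
  have h1 := torsion_trans (M := ((M.prod P).prod N).dual)
    (N := (M.dual.prod P.dual).prod N.dual) (P := (M.dual.prod N.dual).prod P.dual)
    ((dualProd (Λ := Λ) (M × P) N).trans
        ((dualProd (Λ := Λ) M P).prodCongr (LinearEquiv.refl Λ N.dual)))
    (rightComm Λ M.dual P.dual N.dual)
  have h2 := torsion_trans (M := ((M.prod P).prod N).dual)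
    (N := ((M.prod N).prod P).dual) (P := (M.dual.prod N.dual).prod P.dual)
    (dualCongr (rightComm Λ M N P))
    ((dualProd (Λ := Λ) (M × N) P).trans
        ((dualProd (Λ := Λ) M N).prodCongr (LinearEquiv.refl Λ P.dual)))
  rw [a1, torsion_rightComm, add_zero] at h1
  rw [a1, add_zero] at h2
  refine h2.symm.trans (Eq.trans ?_ h1)
  refine congrArg (torsion (M := ((M.prod P).prod N).dual)
    (N := (M.dual.prod N.dual).prod P.dual)) (LinearEquiv.ext fun f => ?_)
  rfl

/-- The $s$-basis of $M^*$ is the dual of the inverse of the $s$-basis of $M$, composed with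
identifications of trivial torsion. So the claim is `torsion_sb` for $M^*$. -/
theorem dualTorsion_sb (M : BasedModule Λ) :
    dualTorsion (M := M.prod (BasedModule.std Λ M.m)) (N := BasedModule.std Λ M.n) M.sb = 0 := by
  let X := BasedModule.std Λ M.m
  let Y := BasedModule.std Λ M.n
  have h0 := torsion_sb M.dual
  have h1 := torsion_trans (M := M.dual.prod X) (N := M.dual.prod X.dual) (P := Y)
    ((LinearEquiv.refl Λ (SDual Λ M)).prodCongr (dualPi M.m).symm)
    ((dualProd (Λ := Λ) M (Fin M.m → Λ)).symm.trans ((dualCongr M.sb.symm).trans (dualPi M.n)))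
  have h2 := torsion_trans (M := M.dual.prod X.dual) (N := (M.prod X).dual) (P := Y)
    (dualProd (Λ := Λ) M (Fin M.m → Λ)).symm ((dualCongr M.sb.symm).trans (dualPi M.n))
  have h3 := torsion_trans (M := (M.prod X).dual) (N := Y.dual) (P := Y)
    (dualCongr M.sb.symm) (dualPi M.n)
  have h4 := torsion_symm (M := (M.prod X).dual) (N := M.dual.prod X.dual)
    (dualProd (Λ := Λ) M X)
  have h5 := torsion_prod (M := M.dual) (N := M.dual) (M' := X) (N' := X.dual)
    (LinearEquiv.refl Λ (SDual Λ M)) (dualPi M.m).symm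
  have h6 := torsion_symm (M := X.dual) (N := X) (dualPi M.m)
  have h7 := dualTorsion_symm (M := M.prod X) (N := Y) M.sb
  rw [torsion_dualProd, neg_zero] at h4
  rw [torsion_dualPi, neg_zero] at h6
  rw [h6, torsion_refl, add_zero] at h5
  rw [torsion_dualPi, add_zero] at h3
  rw [h3, h4, zero_add] at h2
  rw [h5, h2, zero_add] at h1
  have h8 := h1.symm.trans h0
  have h9 : dualTorsion (M := Y) (N := M.prod X) M.sb.symm = 0 := h8
  rw [h7, neg_eq_zero] at h9
  exact h9

theorem dualTorsion_joinFin (n k : ℕ) :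
    dualTorsion (M := (BasedModule.std Λ n).prod (BasedModule.std Λ k))
      (N := BasedModule.std Λ (n + k)) (joinFin Λ n k) = 0 := by
  let A := BasedModule.std Λ n
  let B := BasedModule.std Λ k
  let C := BasedModule.std Λ (n + k)
  have h1 := torsion_trans (M := C.dual) (N := (A.prod B).dual) (P := A.dual.prod B.dual)
    (dualCongr (joinFin Λ n k)) (dualProd (Λ := Λ) A B)
  have h2 := torsion_trans (M := C.dual) (N := A.dual.prod B.dual) (P := A.prod B)
    ((dualCongr (joinFin Λ n k)).trans (dualProd (Λ := Λ) A B))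
    ((dualPi n).prodCongr (dualPi k))
  have h3 := torsion_prod (M := A.dual) (N := A) (M' := B.dual) (N' := B) (dualPi (Λ := Λ) n)
    (dualPi k)
  have h4 := torsion_trans (M := C.dual) (N := C) (P := A.prod B) (dualPi (n + k))
    (joinFin Λ n k).symm
  have h5 := torsion_symm (M := A.prod B) (N := C) (joinFin Λ n k)
  rw [torsion_dualPi, torsion_dualPi, add_zero] at h3
  rw [torsion_dualProd, add_zero] at h1
  rw [torsion_joinFin, neg_zero] at h5
  rw [torsion_dualPi, h5, add_zero] at h4
  rw [h3, h1, add_zero] at h2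
  refine h2.symm.trans (Eq.trans ?_ h4)
  refine congrArg (torsion (M := C.dual) (N := A.prod B)) (LinearEquiv.ext fun f => ?_)
  have h6 : ∀ w : (Fin n → Λ) × (Fin k → Λ), ∀ x,
      ((dualPi (n + k)).symm (joinFin Λ n k w)) (joinFin Λ n k x) =
      ((dualPi n).symm w.1) x.1 + ((dualPi k).symm w.2) x.2 := dualPi_symm_joinFin n k
  apply (joinFin Λ n k).injective
  apply (dualPi (Λ := Λ) (n + k)).symm.injective
  refine SDual.ext fun y => ?_
  obtain ⟨x, rfl⟩ := (joinFin Λ n k).surjective y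
  rw [h6]
  change ((dualPi n).symm (dualPi n (dualProd (Λ := Λ) A B (dualCongr (joinFin Λ n k) f)).1)) x.1 +
    ((dualPi k).symm (dualPi k (dualProd (Λ := Λ) A B (dualCongr (joinFin Λ n k) f)).2)) x.2 =
    ((dualPi (n + k)).symm (joinFin Λ n k ((joinFin Λ n k).symm (dualPi (n + k) f))))
      (joinFin Λ n k x)
  rw [LinearEquiv.apply_symm_apply, LinearEquiv.symm_apply_apply, LinearEquiv.symm_apply_apply,
    LinearEquiv.symm_apply_apply]
  change f (joinFin Λ n k (x.1, 0)) + f (joinFin Λ n k (0, x.2)) = _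
  rw [← map_add, ← map_add]
  simp

/-- This connects `dualTorsion` with `StarInvariant`, which is a condition on automorphisms of
$\Lambda^n$ in the dual basis only. -/
theorem dualTorsion_std {K : ℕ} (g : (Fin K → Λ) ≃ₗ[Λ] (Fin K → Λ)) :
    dualTorsion (M := BasedModule.std Λ K) (N := BasedModule.std Λ K) g =
      RedK1.cls ((dualPi K).symm.trans ((dualCongr g).trans (dualPi K))) := by
  let C := BasedModule.std Λ K
  have h1 := torsion_std ((dualPi K).symm.trans ((dualCongr g).trans (dualPi K)))
  have h2 := torsion_trans (M := C) (N := C.dual) (P := C) (dualPi K).symm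
    ((dualCongr g).trans (dualPi K))
  have h3 := torsion_trans (M := C.dual) (N := C.dual) (P := C) (dualCongr g) (dualPi K)
  have h4 := torsion_symm (M := C.dual) (N := C) (dualPi K)
  rw [torsion_dualPi, neg_zero] at h4
  rw [torsion_dualPi, add_zero] at h3
  rw [h4, h3, zero_add] at h2
  rw [← h1]
  exact h2.symm

/-- Every based module becomes a standard one after adding a standard one. -/
theorem exists_standardization (M : BasedModule Λ) (k K : ℕ) (h : M.n + k = K) :
    ∃ a : ((M × (Fin M.m → Λ)) × (Fin k → Λ)) ≃ₗ[Λ] (Fin K → Λ),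
      torsion (M := (M.prod (BasedModule.std Λ M.m)).prod (BasedModule.std Λ k))
        (N := BasedModule.std Λ K) a = 0 ∧
      dualTorsion (M := (M.prod (BasedModule.std Λ M.m)).prod (BasedModule.std Λ k))
        (N := BasedModule.std Λ K) a = 0 := by
  subst h
  let X := BasedModule.std Λ M.m
  let Y := BasedModule.std Λ M.n
  let B := BasedModule.std Λ k
  let C := BasedModule.std Λ (M.n + k)
  refine ⟨(M.sb.prodCongr (LinearEquiv.refl Λ _)).trans (joinFin Λ M.n k), ?_, ?_⟩
  · have h1 := torsion_trans (M := (M.prod X).prod B) (N := Y.prod B) (P := C)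
      (M.sb.prodCongr (LinearEquiv.refl Λ _)) (joinFin Λ M.n k)
    have h2 := torsion_prod (M := M.prod X) (N := Y) (M' := B) (N' := B) M.sb
      (LinearEquiv.refl Λ _)
    have h3 := torsion_sb M
    rw [torsion_refl, h3, add_zero] at h2
    rw [h2, torsion_joinFin, add_zero] at h1
    exact h1
  · have h1 := dualTorsion_trans (M := (M.prod X).prod B) (N := Y.prod B) (P := C)
      (M.sb.prodCongr (LinearEquiv.refl Λ _)) (joinFin Λ M.n k)
    have h2 := dualTorsion_prod (M := M.prod X) (N := Y) (M' := B) (N' := B) M.sb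
      (LinearEquiv.refl Λ _)
    have h3 := dualTorsion_sb M
    rw [dualTorsion_refl, h3, add_zero] at h2
    rw [h2, dualTorsion_joinFin, add_zero] at h1
    exact h1

/-- The dual of a simple isomorphism is simple. -/
theorem IsSimple.dualCongr {Z : AddSubgroup (RedK1 Λ)} (hZ : StarInvariant Z)
    {M N : BasedModule Λ} {e : M ≃ₗ[Λ] N} (he : IsSimple Z e) :
    IsSimple Z (M := N.dual) (N := M.dual) (QuadL.dualCongr e) := by
  have hn : N.n + M.m = M.n + N.m :=
    Frame.n_eq (M.frame.prod (Frame.std Λ N.m)) (N.frame.prod (Frame.std Λ M.m)) (stabIso e)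
  let X := BasedModule.std Λ M.m
  let Y := BasedModule.std Λ N.m
  let C := BasedModule.std Λ (M.n + N.m)
  obtain ⟨a, ha, ha'⟩ := exists_standardization M N.m _ rfl
  obtain ⟨b, hb, hb'⟩ := exists_standardization N M.m _ hn
  let r : ((M.prod X).prod Y) ≃ₗ[Λ] ((M.prod Y).prod X) := QuadL.rightComm Λ M X Y
  let f : ((M.prod Y).prod X) ≃ₗ[Λ] ((N.prod Y).prod X) :=
    (e.prodCongr (LinearEquiv.refl Λ Y)).prodCongr (LinearEquiv.refl Λ X)
  have hr : torsion (M := (M.prod X).prod Y) (N := (M.prod Y).prod X) r = 0 :=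
    torsion_rightComm M X Y
  have hr' : dualTorsion (M := (M.prod X).prod Y) (N := (M.prod Y).prod X) r = 0 :=
    dualTorsion_rightComm M X Y
  have hf : torsion (M := (M.prod Y).prod X) (N := (N.prod Y).prod X) f = torsion e := by
    have h1 := torsion_prod (M := M.prod Y) (N := N.prod Y) (M' := X) (N' := X)
      (e.prodCongr (LinearEquiv.refl Λ Y)) (LinearEquiv.refl Λ X)
    have h2 := torsion_prod (M := M) (N := N) (M' := Y) (N' := Y) e (LinearEquiv.refl Λ Y)
    rw [h2, torsion_refl, torsion_refl, add_zero, add_zero] at h1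
    exact h1
  have hf' : dualTorsion (M := (M.prod Y).prod X) (N := (N.prod Y).prod X) f =
      dualTorsion e := by
    have h1 := dualTorsion_prod (M := M.prod Y) (N := N.prod Y) (M' := X) (N' := X)
      (e.prodCongr (LinearEquiv.refl Λ Y)) (LinearEquiv.refl Λ X)
    have h2 := dualTorsion_prod (M := M) (N := N) (M' := Y) (N' := Y) e (LinearEquiv.refl Λ Y)
    rw [h2, dualTorsion_refl, dualTorsion_refl, add_zero, add_zero] at h1
    exact h1
  -- `StarInvariant` applies only to automorphisms of some $\Lambda^n$. Therefore `e` is stabilised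
  -- by both complements and read in the two standardisations, which alters neither its torsion nor
  -- its dual torsion.
  let g : C ≃ₗ[Λ] C := a.symm.trans (r.trans (f.trans b))
  have hg : RedK1.cls g = torsion e := by
    rw [← torsion_std]
    have h1 := torsion_trans (M := C) (N := (M.prod X).prod Y) (P := C) a.symm
      (r.trans (f.trans b))
    have h2 := torsion_trans (M := (M.prod X).prod Y) (N := (M.prod Y).prod X) (P := C) r
      (f.trans b)
    have h3 := torsion_trans (M := (M.prod Y).prod X) (N := (N.prod Y).prod X) (P := C) f b
    have h4 := torsion_symm (M := (M.prod X).prod Y) (N := C) a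
    rw [h2, h3, h4, ha, hr, hf] at h1
    have hb2 : torsion (M := (N.prod Y).prod X) (N := C) b = 0 := hb
    rw [hb2, neg_zero, zero_add, zero_add, add_zero] at h1
    exact h1
  have hg' : dualTorsion (M := C) (N := C) g = dualTorsion e := by
    have h1 := dualTorsion_trans (M := C) (N := (M.prod X).prod Y) (P := C) a.symm
      (r.trans (f.trans b))
    have h2 := dualTorsion_trans (M := (M.prod X).prod Y) (N := (M.prod Y).prod X) (P := C) r
      (f.trans b)
    have h3 := dualTorsion_trans (M := (M.prod Y).prod X) (N := (N.prod Y).prod X) (P := C) f b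
    have h4 := dualTorsion_symm (M := (M.prod X).prod Y) (N := C) a
    rw [h2, h3, h4, ha', hr', hf'] at h1
    have hb2 : dualTorsion (M := (N.prod Y).prod X) (N := C) b = 0 := hb'
    rw [hb2, neg_zero, zero_add, zero_add, add_zero] at h1
    exact h1
  have h5 := hZ _ g (by rw [hg]; exact he)
  rw [← dualTorsion_std, hg'] at h5
  exact h5

end DualTorsion

/-! ### The calculus of simple isomorphisms. -/

section SimpleEquivalences

variable {Λ : Type u} [Ring Λ] [StarRing Λ] [InvariantBasisNumber Λ] {Z : AddSubgroup (RedK1 Λ)}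

variable (Z) in
/-- A simple isomorphism of based modules. -/
structure SEquiv (M N : BasedModule Λ) where
  e : M ≃ₗ[Λ] N
  simple : IsSimple Z e

namespace SEquiv

variable {M N P M' N' : BasedModule Λ}

def refl (M : BasedModule Λ) : SEquiv Z M M := ⟨LinearEquiv.refl Λ M, .refl M⟩

def symm (f : SEquiv Z M N) : SEquiv Z N M := ⟨f.e.symm, f.simple.symm⟩

def trans (f : SEquiv Z M N) (g : SEquiv Z N P) : SEquiv Z M P :=
  ⟨f.e.trans g.e, f.simple.trans g.simple⟩

def prod (f : SEquiv Z M N) (g : SEquiv Z M' N') : SEquiv Z (M.prod M') (N.prod N') :=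
  ⟨f.e.prodCongr g.e, f.simple.prod g.simple⟩

variable (Z)

def prodComm (M N : BasedModule Λ) : SEquiv Z (M.prod N) (N.prod M) :=
  ⟨LinearEquiv.prodComm Λ M N, .of_eq_zero (torsion_prodComm M N)⟩

def prodAssoc (M N P : BasedModule Λ) : SEquiv Z ((M.prod N).prod P) (M.prod (N.prod P)) :=
  ⟨LinearEquiv.prodAssoc Λ M N P, .of_eq_zero (torsion_prodAssoc M N P)⟩

def rightComm (M N P : BasedModule Λ) : SEquiv Z ((M.prod N).prod P) ((M.prod P).prod N) :=
  ⟨QuadL.rightComm Λ M N P, .of_eq_zero (torsion_rightComm M N P)⟩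

def prodProdProdComm (M N P R : BasedModule Λ) :
    SEquiv Z ((M.prod N).prod (P.prod R)) ((M.prod P).prod (N.prod R)) :=
  ⟨LinearEquiv.prodProdProdComm Λ M N P R, .of_eq_zero (torsion_prodProdProdComm M N P R)⟩

def sign (ε : ℤˣ) (M : BasedModule Λ) : SEquiv Z M M :=
  ⟨signEquiv Λ M ε, .of_eq_zero (torsion_sign M ε)⟩

def neg (M : BasedModule Λ) : SEquiv Z M M :=
  ⟨LinearEquiv.neg Λ, by
    have h : (LinearEquiv.neg Λ : M ≃ₗ[Λ] M) = signEquiv Λ M (-1) :=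
      LinearEquiv.ext fun x => by simp
    rw [h]
    exact .of_eq_zero (torsion_sign M (-1))⟩

def shear {M N : BasedModule Λ} (f : M →ₗ[Λ] N) : SEquiv Z (M.prod N) (M.prod N) :=
  ⟨QuadL.shear f, .of_eq_zero (torsion_shear f)⟩

/-- `(x, y) ↦ (x + f y, y)`. -/
def shearLeft {M N : BasedModule Λ} (f : N →ₗ[Λ] M) : SEquiv Z (M.prod N) (M.prod N) :=
  (prodComm Z M N).trans ((shear Z f).trans (prodComm Z N M))

theorem shearLeft_apply {M N : BasedModule Λ} (f : N →ₗ[Λ] M) (x : M) (y : N) :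
    (shearLeft Z f).e (x, y) = (x + f y, y) := rfl

def joinFin (n k : ℕ) : SEquiv Z ((BasedModule.std Λ n).prod (BasedModule.std Λ k))
    (BasedModule.std Λ (n + k)) := ⟨QuadL.joinFin Λ n k, .of_eq_zero (torsion_joinFin n k)⟩

def sb (M : BasedModule Λ) : SEquiv Z (M.prod (BasedModule.std Λ M.m)) (BasedModule.std Λ M.n) :=
  ⟨M.sb, .of_eq_zero (torsion_sb M)⟩

variable {Z}

/-- The number $m$ is arbitrary above `M.m`, so that several modules can be made standard by one and
the same complement. -/
theorem exists_std (M : BasedModule Λ) (m : ℕ) (h : M.m ≤ m) :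
    ∃ n, Nonempty (SEquiv Z (M.prod (BasedModule.std Λ m)) (BasedModule.std Λ n)) := by
  obtain ⟨k, rfl⟩ := Nat.exists_eq_add_of_le h
  exact ⟨M.n + k, ⟨((refl M).prod (joinFin Z M.m k).symm).trans
    ((prodAssoc Z M (BasedModule.std Λ M.m) (BasedModule.std Λ k)).symm.trans
      (((sb Z M).prod (refl _)).trans (joinFin Z M.n k)))⟩⟩

/-- An isomorphism `(a, r) ↦ (g a + k r, r)` is simple only if `g` is a simple isomorphism. -/
theorem exists_of_block {A C R : BasedModule Λ} (F : SEquiv Z (A.prod R) (C.prod R))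
    (g : A →ₗ[Λ] C) (k : R →ₗ[Λ] C) (h : ∀ a r, F.e (a, r) = (g a + k r, r)) :
    ∃ G : SEquiv Z A C, ∀ a, G.e a = g a := by
  let F' := F.trans (shearLeft Z (-k))
  have hF' : ∀ a r, F'.e (a, r) = (g a, r) := by
    intro a r
    change (shearLeft Z (-k)).e (F.e (a, r)) = _
    rw [h, shearLeft_apply]
    simp
  have hb : Function.Bijective g := by
    constructor
    · intro a b hab
      have h1 : F'.e (a, 0) = F'.e (b, 0) := by rw [hF', hF', hab]
      exact congrArg Prod.fst (F'.e.injective h1)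
    · intro c
      obtain ⟨⟨a, r⟩, har⟩ := F'.e.surjective (c, 0)
      rw [hF'] at har
      exact ⟨a, congrArg Prod.fst har⟩
  let e : A ≃ₗ[Λ] C := LinearEquiv.ofBijective g hb
  have h1 : F'.e = e.prodCongr (LinearEquiv.refl Λ R) := by
    refine LinearEquiv.ext fun x => ?_
    exact hF' x.1 x.2
  have h2 := torsion_prod (M := A) (N := C) (M' := R) (N' := R) e (LinearEquiv.refl Λ R)
  have h3 := F'.simple
  rw [torsion_refl, add_zero] at h2
  rw [IsSimple, h1, h2] at h3
  exact ⟨⟨e, h3⟩, fun _ => rfl⟩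

end SEquiv

end SimpleEquivalences

/-! ### Reflexivity and transposition. -/

section DualEquivalences

variable {Λ : Type u} [Ring Λ] [StarRing Λ] [InvariantBasisNumber Λ] {Z : AddSubgroup (RedK1 Λ)}

theorem BasedModule.ext_dual (M : BasedModule Λ) {x y : M} (h : ∀ u : SDual Λ M, u x = u y) :
    x = y := by
  refine (evEquiv M).injective (SDual.ext fun u => ?_)
  exact congrArg star (h u)

/-- The inverse of the identification `M = M^{**}`. -/
noncomputable def unev (M : BasedModule Λ) : SDual Λ (SDual Λ M) →ₗ[Λ] M :=
  (evEquiv M).symm.toLinearMap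

theorem ev_unev (M : BasedModule Λ) (ξ : SDual Λ (SDual Λ M)) : ev (unev M ξ) = ξ :=
  (evEquiv M).apply_symm_apply ξ

theorem apply_unev (M : BasedModule Λ) (ξ : SDual Λ (SDual Λ M)) (u : SDual Λ M) :
    u (unev M ξ) = star (ξ u) := by
  have h := congrArg (fun η : SDual Λ (SDual Λ M) => star (η u)) (ev_unev M ξ)
  simpa using h

/-- The dual `Y^* → X` of a homomorphism `X^* → Y`. -/
noncomputable def transpose {X : BasedModule Λ} {Y : Type u} [AddCommGroup Y] [Module Λ Y]
    (T : SDual Λ X →ₗ[Λ] Y) : SDual Λ Y →ₗ[Λ] X := (unev X).comp (dualMap T)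

theorem apply_transpose {X : BasedModule Λ} {Y : Type u} [AddCommGroup Y] [Module Λ Y]
    (T : SDual Λ X →ₗ[Λ] Y) (f : SDual Λ Y) (u : SDual Λ X) :
    u (transpose T f) = star (f (T u)) := apply_unev X _ u

namespace SEquiv

variable {M N P M' N' : BasedModule Λ}

variable (Z)

def dualProd (M N : BasedModule Λ) : SEquiv Z (M.prod N).dual (M.dual.prod N.dual) :=
  ⟨QuadL.dualProd M N, .of_eq_zero (torsion_dualProd M N)⟩

noncomputable def ev (M : BasedModule Λ) : SEquiv Z M M.dual.dual :=
  ⟨evEquiv M, .of_eq_zero (torsion_evEquiv M)⟩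

variable {Z} [hZ : Fact (StarInvariant Z)]

/-- The invariance of $Z$ under duality enters the later arguments through this definition; the
`Fact` makes it available without an explicit argument. -/
def dual (f : SEquiv Z M N) : SEquiv Z N.dual M.dual := ⟨dualCongr f.e, f.simple.dualCongr hZ.out⟩

end SEquiv

end DualEquivalences

/-! ### Based exact sequences. -/

section BasedSequences

variable {Λ : Type u} [Ring Λ] [StarRing Λ] [InvariantBasisNumber Λ] {Z : AddSubgroup (RedK1 Λ)}

variable {A B C A' B' C' : BasedModule Λ}

/-- Two sections differ by a map $C\to A$, that is, the two splittings differ by a shear. So a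
sequence that is based for one section is based for every section. -/
theorem BasedExact.exists_equiv {i : A →ₗ[Λ] B} {p : B →ₗ[Λ] C} (h : BasedExact Z i p)
    (s : C →ₗ[Λ] B) (hs : ∀ c, p (s c) = c) :
    ∃ e : SEquiv Z (A.prod C) B, ∀ a c, e.e (a, c) = i a + s c := by
  obtain ⟨s', e, hs', he, hes⟩ := h.based
  let e' : SEquiv Z (A.prod C) B := ⟨e, hes⟩
  let f : C →ₗ[Λ] A := (LinearMap.fst Λ A C).comp (e.symm.toLinearMap.comp (s - s'))
  have hf : ∀ c, i (f c) = s c - s' c := by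
    intro c
    have h1 : e (e.symm (s c - s' c)) = s c - s' c := e.apply_symm_apply _
    obtain ⟨a, ha⟩ := (h.exact (s c - s' c)).1 (by rw [map_sub, hs, hs', sub_self])
    have h2 : e (a, 0) = s c - s' c := by rw [he, map_zero, add_zero, ha]
    have h3 : f c = a := by
      change (e.symm (s c - s' c)).1 = a
      rw [← h2, LinearEquiv.symm_apply_apply]
    rw [h3, ha]
  refine ⟨(SEquiv.shearLeft Z f).trans e', fun a c => ?_⟩
  change e (a + f c, c) = _
  rw [he, map_add, hf]
  abel

/-- Based exact sequences are natural with respect to simple isomorphisms. -/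
theorem BasedExact.exists_map {i : A →ₗ[Λ] B} {p : B →ₗ[Λ] C} {i' : A' →ₗ[Λ] B'}
    {p' : B' →ₗ[Λ] C'} (h : BasedExact Z i p) (h' : BasedExact Z i' p') (T : SEquiv Z B B')
    (F : SEquiv Z C C') (hT : ∀ x, p' (T.e x) = F.e (p x)) :
    ∃ G : SEquiv Z A A', ∀ a, T.e (i a) = i' (G.e a) := by
  obtain ⟨s, e, hs, he, hes⟩ := h.based
  let e1 : SEquiv Z (A.prod C) B := ⟨e, hes⟩
  -- With the section transported along `T` and `F`, the map `T` becomes diagonal in the two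
  -- splittings. After composition with $F^{-1}$ it has the form $(a,c)\mapsto(g\,a,c)$, and the
  -- second factor cancels.
  let s' : C' →ₗ[Λ] B' := T.e.toLinearMap.comp (s.comp F.e.symm.toLinearMap)
  obtain ⟨e', he'⟩ := h'.exists_equiv s' (fun c => by
    change p' (T.e (s (F.e.symm c))) = c
    rw [hT, hs, LinearEquiv.apply_symm_apply])
  let X := (e1.trans T).trans (e'.symm.trans ((SEquiv.refl A').prod F.symm))
  let g : A →ₗ[Λ] A' := (LinearMap.fst Λ A' C').comp
    (e'.e.symm.toLinearMap.comp (T.e.toLinearMap.comp i))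
  have hg : ∀ a, e'.e (g a, 0) = T.e (i a) := by
    intro a
    obtain ⟨a', ha'⟩ := (h'.exact (T.e (i a))).1 (by
      rw [hT, (h.exact (i a)).2 ⟨a, rfl⟩, map_zero])
    have h1 : e'.e (a', 0) = T.e (i a) := by rw [he', map_zero, add_zero, ha']
    have h2 : g a = a' := by
      change (e'.e.symm (T.e (i a))).1 = a'
      rw [← h1, LinearEquiv.symm_apply_apply]
    rw [h2, h1]
  obtain ⟨G, hG⟩ := X.exists_of_block g 0 (fun a c => by
    change ((e'.e.symm (T.e (e (a, c)))).1, F.e.symm (e'.e.symm (T.e (e (a, c)))).2) = _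
    have h1 : e'.e.symm (T.e (e (a, c))) = (g a, F.e c) := by
      rw [LinearEquiv.symm_apply_eq, he, map_add, ← hg, he', he', map_zero, add_zero]
      change _ = i' (g a) + T.e (s (F.e.symm (F.e c)))
      rw [LinearEquiv.symm_apply_apply]
    rw [h1]
    simp)
  exact ⟨G, fun a => by rw [hG, ← hg, he', map_zero, add_zero]⟩

/-- The kernel $K$ gets its $s$-basis from $K\oplus C\cong B$: adding the complements of the
$s$-bases of $B$ and $C$ yields $K\oplus\Lambda^{C.n+B.m}\cong\Lambda^{B.n+C.m}$. This is the choice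
for which the splitting is simple. -/
theorem exists_basedExact (p : B →ₗ[Λ] C) (s : C →ₗ[Λ] B) (hs : ∀ c, p (s c) = c) :
    ∃ (A : BasedModule Λ) (i : A →ₗ[Λ] B), BasedExact Z i p := by
  let K : Type u := LinearMap.ker p
  let i : K →ₗ[Λ] B := (LinearMap.ker p).subtype
  let r : B →ₗ[Λ] K := (LinearMap.id - s.comp p).codRestrict (LinearMap.ker p) (fun x => by
    rw [LinearMap.mem_ker]
    change p (x - s (p x)) = 0
    rw [map_sub, hs, sub_self])
  have hpi : ∀ a, p (i a) = 0 := fun a => a.2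
  let e : (K × C) ≃ₗ[Λ] B := LinearEquiv.ofLinearMap (i.coprod s) (r.prod p)
    (by
      refine LinearMap.ext fun x => ?_
      change (x - s (p x)) + s (p x) = x
      abel)
    (by
      refine LinearMap.ext fun x => Prod.ext (Subtype.ext ?_) ?_
      · change (i x.1 + s x.2) - s (p (i x.1 + s x.2)) = i x.1
        rw [map_add, hpi, hs, zero_add, add_sub_cancel_right]
      · change p (i x.1 + s x.2) = x.2
        rw [map_add, hpi, hs, zero_add])
  let U := Fin C.n → Λ
  let S : BasedModule Λ := BasedModule.std Λ C.m
  let R : BasedModule Λ := BasedModule.std Λ B.m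
  let f1 : (K × (Fin (C.n + B.m) → Λ)) ≃ₗ[Λ] (K × ((C × S) × R)) :=
    (LinearEquiv.refl Λ K).prodCongr ((joinFin Λ C.n B.m).symm.trans
      (C.sb.symm.prodCongr (LinearEquiv.refl Λ R)))
  let f2 : (K × ((C × S) × R)) ≃ₗ[Λ] (((K × C) × R) × S) :=
    ((LinearEquiv.refl Λ K).prodCongr (rightComm Λ C S R)).trans
      ((LinearEquiv.prodAssoc Λ K (C × R) S).symm.trans
        ((LinearEquiv.prodAssoc Λ K C R).symm.prodCongr (LinearEquiv.refl Λ S)))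
  let f3 : (((K × C) × R) × S) ≃ₗ[Λ] ((B × R) × S) :=
    (e.prodCongr (LinearEquiv.refl Λ R)).prodCongr (LinearEquiv.refl Λ S)
  let f4 : ((B × R) × S) ≃ₗ[Λ] (Fin (B.n + C.m) → Λ) :=
    (B.sb.prodCongr (LinearEquiv.refl Λ S)).trans (joinFin Λ B.n C.m)
  let A : BasedModule Λ := ⟨K, C.n + B.m, B.n + C.m, f1.trans (f2.trans (f3.trans f4))⟩
  let T : BasedModule Λ := BasedModule.std Λ (C.n + B.m)
  have t1 : IsSimple Z (M := A.prod T) (N := A.prod ((C.prod S).prod R)) f1 :=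
    ((SEquiv.refl A).prod ((SEquiv.joinFin Z C.n B.m).symm.trans
      ((SEquiv.sb Z C).symm.prod (SEquiv.refl R)))).simple
  have t2 : IsSimple Z (M := A.prod ((C.prod S).prod R)) (N := ((A.prod C).prod R).prod S) f2 :=
    (((SEquiv.refl A).prod (SEquiv.rightComm Z C S R)).trans
      ((SEquiv.prodAssoc Z A (C.prod R) S).symm.trans
        ((SEquiv.prodAssoc Z A C R).symm.prod (SEquiv.refl S)))).simple
  have t4 : IsSimple Z (M := (B.prod R).prod S) (N := BasedModule.std Λ (B.n + C.m)) f4 :=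
    (((SEquiv.sb Z B).prod (SEquiv.refl S)).trans (SEquiv.joinFin Z B.n C.m)).simple
  have t5 : IsSimple Z (M := A.prod T) (N := BasedModule.std Λ (B.n + C.m))
    (f1.trans (f2.trans (f3.trans f4))) := (SEquiv.sb Z A).simple
  let F1 : SEquiv Z (A.prod T) (A.prod ((C.prod S).prod R)) := ⟨f1, t1⟩
  let F2 : SEquiv Z (A.prod ((C.prod S).prod R)) (((A.prod C).prod R).prod S) := ⟨f2, t2⟩
  let F4 : SEquiv Z ((B.prod R).prod S) (BasedModule.std Λ (B.n + C.m)) := ⟨f4, t4⟩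
  let F5 : SEquiv Z (A.prod T) (BasedModule.std Λ (B.n + C.m)) := ⟨_, t5⟩
  -- The composite `F5` is the $s$-basis of `A` itself, hence simple, and so are all its factors
  -- other than the stabilised splitting. Solving for that factor shows that it is simple, and the
  -- two standard summands are then cancelled.
  let F3 : SEquiv Z (((A.prod C).prod R).prod S) ((B.prod R).prod S) :=
    F2.symm.trans (F1.symm.trans (F5.trans F4.symm))
  have hF3 : ∀ x, F3.e x = f3 x := by
    intro x
    change f4.symm (f4 (f3 (f2 (f1 (f1.symm (f2.symm x)))))) = f3 x
    simp
  obtain ⟨G1, hG1⟩ := F3.exists_of_block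
    (e.prodCongr (LinearEquiv.refl Λ R)).toLinearMap 0 (fun a r => by rw [hF3]; simp [f3])
  obtain ⟨G2, hG2⟩ := G1.exists_of_block e.toLinearMap 0 (fun a r => by rw [hG1]; simp)
  refine ⟨A, i, Subtype.val_injective, fun x => ?_, s, G2.e, hs, fun a c => hG2 _, G2.simple⟩
  constructor
  · intro hx; exact ⟨⟨x, hx⟩, rfl⟩
  · rintro ⟨a, rfl⟩; exact hpi a

end BasedSequences

/-! ### Calculus in $Q_\epsilon$. -/

section Pairings

variable {Λ : Type u} [Ring Λ] [StarRing Λ] {ε : ℤˣ}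
variable {M N X Y : Type u} [AddCommGroup M] [Module Λ M] [AddCommGroup N] [Module Λ N]
  [AddCommGroup X] [Module Λ X] [AddCommGroup Y] [Module Λ Y]

theorem units_coe_mul_self (ε : ℤˣ) : (ε : ℤ) * (ε : ℤ) = 1 := by
  rw [← Units.val_mul, Int.units_mul_self]; rfl

namespace QGrp

/-- The class of `(x, y) ↦ p x (r y)`. -/
def pairing (ε : ℤˣ) (p : X →ₗ[Λ] SDual Λ Y) (r : X →ₗ[Λ] Y) : QGrp Λ ε X :=
  mk ε ((dualMap r).comp p)

theorem pairing_ext {Y' : Type u} [AddCommGroup Y'] [Module Λ Y'] {p : X →ₗ[Λ] SDual Λ Y}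
    {r : X →ₗ[Λ] Y} {p' : X →ₗ[Λ] SDual Λ Y'} {r' : X →ₗ[Λ] Y'}
    (h : ∀ x y, p x (r y) = p' x (r' y)) : pairing ε p r = pairing ε p' r' :=
  congrArg (mk ε) (LinearMap.ext fun x => SDual.ext fun y => h x y)

/-- This is the relation $[\chi]=[\epsilon\chi^*]$. It serves to move a term to the other side of a
pairing. -/
theorem pairing_star {Y' : Type u} [AddCommGroup Y'] [Module Λ Y'] {p : X →ₗ[Λ] SDual Λ Y}
    {r : X →ₗ[Λ] Y} {p' : X →ₗ[Λ] SDual Λ Y'} {r' : X →ₗ[Λ] Y'}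
    (h : ∀ x y, p x (r y) = (ε : ℤ) • star (p' y (r' x))) : pairing ε p r = pairing ε p' r' := by
  rw [pairing, pairing, ← mk_adj]
  refine congrArg (mk ε) (LinearMap.ext fun x => SDual.ext fun y => ?_)
  change (ε : ℤ) • star (p y (r x)) = p' x (r' y)
  rw [h, star_zsmul, star_star, smul_smul, units_coe_mul_self, one_smul]

theorem pairing_add_left (p p' : X →ₗ[Λ] SDual Λ Y) (r : X →ₗ[Λ] Y) :
    pairing ε (p + p') r = pairing ε p r + pairing ε p' r := by
  rw [pairing, pairing, pairing, ← map_add]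
  rfl

theorem pairing_add_right (p : X →ₗ[Λ] SDual Λ Y) (r r' : X →ₗ[Λ] Y) :
    pairing ε p (r + r') = pairing ε p r + pairing ε p r' := by
  rw [pairing, pairing, pairing, ← map_add]
  refine congrArg (mk ε) (LinearMap.ext fun x => SDual.ext fun y => ?_)
  exact map_add (p x) _ _

theorem pairing_zero_left (r : X →ₗ[Λ] Y) : pairing ε (0 : X →ₗ[Λ] SDual Λ Y) r = 0 := by
  have h := pairing_add_left (ε := ε) (0 : X →ₗ[Λ] SDual Λ Y) 0 r
  rw [add_zero] at h
  exact left_eq_add.1 h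

theorem pairing_zero_right (p : X →ₗ[Λ] SDual Λ Y) : pairing ε p (0 : X →ₗ[Λ] Y) = 0 := by
  have h := pairing_add_right (ε := ε) p 0 0
  rw [add_zero] at h
  exact left_eq_add.1 h

theorem pairing_neg_left (p : X →ₗ[Λ] SDual Λ Y) (r : X →ₗ[Λ] Y) :
    pairing ε (-p) r = - pairing ε p r := by
  have h := pairing_add_left (ε := ε) p (-p) r
  rw [add_neg_cancel, pairing_zero_left] at h
  exact (neg_eq_of_add_eq_zero_right h.symm).symm

theorem pairing_neg_right (p : X →ₗ[Λ] SDual Λ Y) (r : X →ₗ[Λ] Y) :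
    pairing ε p (-r) = - pairing ε p r := by
  have h := pairing_add_right (ε := ε) p r (-r)
  rw [add_neg_cancel, pairing_zero_right] at h
  exact (neg_eq_of_add_eq_zero_right h.symm).symm

theorem pairing_sub_right (p : X →ₗ[Λ] SDual Λ Y) (r r' : X →ₗ[Λ] Y) :
    pairing ε p (r - r') = pairing ε p r - pairing ε p r' := by
  rw [sub_eq_add_neg, pairing_add_right, pairing_neg_right, sub_eq_add_neg]

theorem pull_pairing (h : M →ₗ[Λ] X) (p : X →ₗ[Λ] SDual Λ Y) (r : X →ₗ[Λ] Y) :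
    pull h (pairing ε p r) = pairing ε (p.comp h) (r.comp h) := rfl

theorem symm_pairing (p : X →ₗ[Λ] SDual Λ Y) (r : X →ₗ[Λ] Y) (x y : X) :
    symm (pairing ε p r) x y = p x (r y) + (ε : ℤ) • star (p y (r x)) := rfl

theorem pairing_symm_comm (q : QGrp Λ ε M) (f g : X →ₗ[Λ] M) :
    pairing ε ((symm q).comp f) g = pairing ε ((symm q).comp g) f :=
  pairing_star fun _ _ => symm_symm q _ _

/-- The pullback is quadratic in the map. Of the two mixed terms, one is replaced by $\epsilon$
times its adjoint, and together they form the symmetrisation. -/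
theorem pull_add (f g : X →ₗ[Λ] M) (q : QGrp Λ ε M) :
    pull (f + g) q = pull f q + pull g q + pairing ε ((symm q).comp f) g := by
  obtain ⟨χ, rfl⟩ := mk_surjective q
  have h1 : pairing ε ((symm (mk ε χ)).comp f) g =
      mk ε ((dualMap g).comp (χ.comp f)) + mk ε ((dualMap f).comp (χ.comp g)) := by
    have h2 : (dualMap g).comp ((symm (mk ε χ)).comp f) =
        (dualMap g).comp (χ.comp f) + (ε : ℤ) • adj ((dualMap f).comp (χ.comp g)) := by
      refine LinearMap.ext fun x => SDual.ext fun y => ?_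
      rfl
    rw [pairing, h2, map_add, mk_adj]
  have h3 : pullHom (f + g) χ = pullHom f χ + pullHom g χ +
      ((dualMap g).comp (χ.comp f) + (dualMap f).comp (χ.comp g)) := by
    refine LinearMap.ext fun x => SDual.ext fun y => ?_
    change χ (f x + g x) (f y + g y) = χ (f x) (f y) + χ (g x) (g y) +
      (χ (f x) (g y) + χ (g x) (f y))
    simp only [map_add, SDual.add_apply]
    abel
  rw [h1, pull_mk, h3, map_add, map_add, map_add]
  rfl

theorem pull_neg (f : X →ₗ[Λ] M) (q : QGrp Λ ε M) : pull (-f) q = pull f q := by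
  obtain ⟨χ, rfl⟩ := mk_surjective q
  refine congrArg (mk ε) (LinearMap.ext fun x => SDual.ext fun y => ?_)
  change χ (-f x) (-f y) = χ (f x) (f y)
  simp

theorem pull_sub (f g : X →ₗ[Λ] M) (q : QGrp Λ ε M) :
    pull (f - g) q = pull f q + pull g q - pairing ε ((symm q).comp f) g := by
  rw [sub_eq_add_neg, pull_add, pull_neg, pairing_neg_right, sub_eq_add_neg]

/-- Quadraticity for $f+(-f)=0$. -/
theorem pairing_symm_self (q : QGrp Λ ε M) (f : X →ₗ[Λ] M) :
    pairing ε ((symm q).comp f) f = pull f q + pull f q := by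
  have h := pull_add f (-f) q
  rw [add_neg_cancel, pull_zero, pull_neg, pairing_neg_right] at h
  exact (eq_of_sub_eq_zero (by rw [sub_eq_add_neg, ← h])).symm

end QGrp

end Pairings

section PairingForms

variable {Λ : Type u} [Ring Λ] [StarRing Λ] {ε : ℤˣ}

theorem QForm.hyp_q (P : BasedModule Λ) : (QForm.hyp ε P).q =
    QGrp.pairing ε (LinearMap.snd Λ P (SDual Λ P)) (LinearMap.fst Λ P (SDual Λ P)) := rfl

theorem QForm.phi_symm (v : QForm Λ ε) (x y : v.M) :
    v.phi x y = (ε : ℤ) • star (v.phi y x) := QGrp.symm_symm v.q x y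

end PairingForms

/-! ### Homotopies of isomorphisms of split formations. -/

section SplitIsoCalculus

variable {Λ : Type u} [Ring Λ] [StarRing Λ] [InvariantBasisNumber Λ]
variable {Z : AddSubgroup (RedK1 Λ)} {ε : ℤˣ}

namespace SplitIso

section General

variable {y z w : SplitFormation Λ ε}

/-- `α ν α^*`. -/
def transported (f : SplitIso Z y z) : QGrp Λ ε (SDual Λ z.F) :=
  QGrp.pull (dualMap f.α.toLinearMap) f.ν

/-- Here and in the next two lemmas the three equations of an isomorphism are read on the target, in
terms of $\beta^{-1}$ and $\alpha\nu\alpha^*$. These are the terms in which homotopies and unions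
are expressed. -/
theorem mu_alpha (f : SplitIso Z y z) (g : z.G) (x : y.F) :
    z.μ g (f.α x) = y.μ (f.β.symm g) x := by
  have h := f.eqμ_apply (f.β.symm g)
  rw [LinearEquiv.apply_symm_apply] at h
  rw [← h]
  simp

theorem symm_transported_mu (f : SplitIso Z y z) (w : SDual Λ z.F) (g : z.G) :
    QGrp.symm f.transported w (z.μ g) = w (z.γ g) - w (f.α (y.γ (f.β.symm g))) := by
  have h := f.eqγ_apply (f.β.symm g) w
  rw [LinearEquiv.apply_symm_apply] at h
  rw [← h, transported, QGrp.symm_pull]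
  have h2 : dualMap f.α.toLinearMap (z.μ g) = y.μ (f.β.symm g) :=
    SDual.ext fun x => f.mu_alpha g x
  rw [h2]
  abel

theorem pull_mu_transported (f : SplitIso Z y z) :
    QGrp.pull z.μ f.transported = z.θ - QGrp.pull f.β.symm.toLinearMap y.θ := by
  have h1 := f.symm.eqθ
  have h2 : f.symm.ν = -f.transported := rfl
  have h3 : f.symm.β = f.β.symm := rfl
  rw [h2, h3, map_neg] at h1
  rw [← h1]
  abel

/-- A homotopy is used through its transpose $F'^*\to G$ and tested against functionals. The
condition on $\beta$ is dropped, since `homotopic_of_data` recovers it from the other two. -/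
theorem homotopic_data {f f' : SplitIso Z y z} (h : f.Homotopic f') :
    ∃ Δ : SDual Λ z.F →ₗ[Λ] y.G,
      (∀ (u : SDual Λ z.F) (x : y.F), u (f'.α x) = u (f.α x) + y.μ (Δ u) x) ∧
      f'.transported - f.transported =
        -QGrp.pairing ε LinearMap.id (f'.α.toLinearMap.comp (y.γ.comp Δ)) +
          QGrp.pull Δ y.θ := by
  obtain ⟨D, Δ, h0, -, hα, hν⟩ := h
  have h1 : ∀ (f : SDual Λ y.G) (u : SDual Λ z.F), u (D f) = star (f (Δ u)) := by
    intro f u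
    exact (congrArg (fun t : SDual Λ z.F →ₗ[Λ] SDual Λ (SDual Λ y.G) => t u f) h0).symm
  refine ⟨Δ, fun u x => ?_, ?_⟩
  · have h2 := congrArg (fun t : y.F →ₗ[Λ] z.F => u (t x)) hα
    change u (f'.α x - f.α x) = u (D (adj y.μ x)) at h2
    rw [h1, adj_apply, star_star, map_sub] at h2
    rw [← h2]; abel
  · refine hν.trans (congrArg (fun t => t + QGrp.pull Δ y.θ) ?_)
    rw [← QGrp.pairing_neg_right]
    have h3 : ∀ (p : SDual Λ z.F →ₗ[Λ] z.F), QGrp.mk ε (ev.comp p) =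
        QGrp.pairing ε (ev.comp p) (LinearMap.id : SDual Λ z.F →ₗ[Λ] SDual Λ z.F) := fun _ => rfl
    rw [h3]
    refine QGrp.pairing_star fun u w => ?_
    change star (w ((-(ε : ℤ)) • f'.α (y.γ (Δ u)))) = (ε : ℤ) • star (w (-f'.α (y.γ (Δ u))))
    rw [map_zsmul, map_neg, star_zsmul, star_neg, neg_smul, smul_neg]

/-- A homotopy is determined by its effect on `α` and `α ν α^*`. -/
theorem homotopic_of_data {f f' : SplitIso Z y z}
    (hinj : ∀ g : y.G, y.γ g = 0 → y.μ g = 0 → g = 0) (Δ : SDual Λ z.F →ₗ[Λ] y.G)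
    (hα : ∀ (u : SDual Λ z.F) (x : y.F), u (f'.α x) = u (f.α x) + y.μ (Δ u) x)
    (hν : f'.transported - f.transported =
        -QGrp.pairing ε LinearMap.id (f'.α.toLinearMap.comp (y.γ.comp Δ)) +
          QGrp.pull Δ y.θ) : f.Homotopic f' := by
  have h1 : ∀ (f : SDual Λ y.G) (u : SDual Λ z.F), u (transpose Δ f) = star (f (Δ u)) :=
    fun f u => apply_transpose Δ f u
  -- The condition on $\beta$ follows from the others: the element below is annihilated by $\gamma$,
  -- by the symmetrisation of the condition on $\alpha\nu\alpha^*$, and by $\mu$, by the condition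
  -- on $\alpha$; and $(\gamma;\mu)$ is injective.
  have hβ : ∀ g : z.G, f'.β.symm g - f.β.symm g - Δ (z.μ g) = 0 := by
    intro g
    have hrel : ∀ a b : y.G, y.μ a (y.γ b) = QGrp.symm y.θ a b := fun a b =>
      congrArg (fun t : y.G →ₗ[Λ] SDual Λ y.G => t a b) y.rel
    refine hinj _ ?_ (SDual.ext fun x => ?_)
    · apply f.α.injective
      rw [map_zero]
      refine z.F.ext_dual fun w => ?_
      have e1 := f.symm_transported_mu w g
      have e2 := f'.symm_transported_mu w g
      have e3 := congrArg (fun t => QGrp.symm t w (z.μ g)) hν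
      change QGrp.symm (f'.transported - f.transported) w (z.μ g) = _ at e3
      rw [map_sub, map_add, map_neg, LinearMap.sub_apply, SDual.sub_apply, e1, e2] at e3
      change _ = -(QGrp.symm (QGrp.pairing ε LinearMap.id
        (f'.α.toLinearMap.comp (y.γ.comp Δ))) w (z.μ g)) +
          QGrp.symm (QGrp.pull Δ y.θ) w (z.μ g) at e3
      rw [QGrp.symm_pairing, QGrp.symm_pull] at e3
      change _ = -(w (f'.α (y.γ (Δ (z.μ g)))) +
        (ε : ℤ) • star (z.μ g (f'.α (y.γ (Δ w))))) + _ at e3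
      rw [f'.mu_alpha, hrel, ← QGrp.symm_symm, ← hrel, ← hrel] at e3
      have e4 := hα w (y.γ (f'.β.symm g))
      have e5 := hα w (y.γ (Δ (z.μ g)))
      simp only [map_sub, map_zero]
      have e6 : y.μ (Δ w) (y.γ (f'.β.symm g)) =
        w (f'.α (y.γ (f'.β.symm g))) - w (f.α (y.γ (f'.β.symm g))) := by rw [e4]; abel
      have e7 : y.μ (Δ w) (y.γ (Δ (z.μ g))) =
        w (f'.α (y.γ (Δ (z.μ g)))) - w (f.α (y.γ (Δ (z.μ g)))) := by rw [e5]; abel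
      rw [e6, e7] at e3
      have e8 := sub_eq_zero.2 e3
      rw [← neg_eq_zero, ← e8]
      abel
    · rw [map_sub, map_sub]
      change y.μ (f'.β.symm g) x - y.μ (f.β.symm g) x - y.μ (Δ (z.μ g)) x = 0
      rw [← f.mu_alpha, ← f'.mu_alpha, hα]
      abel
  refine ⟨transpose Δ, Δ, ?_, ?_, ?_, ?_⟩
  · refine LinearMap.ext fun u => SDual.ext fun f => ?_
    exact (h1 f u).symm
  · refine LinearMap.ext fun u => SDual.ext fun g => ?_
    change u (f'.β.symm g) - u (f.β.symm g) = star (z.μ g (transpose Δ u))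
    rw [h1, star_star, ← map_sub, sub_eq_zero.1 (hβ g)]
  · refine LinearMap.ext fun x => z.F.ext_dual fun u => ?_
    change u (f'.α x - f.α x) = u (transpose Δ (adj y.μ x))
    rw [h1, adj_apply, star_star, map_sub, hα]
    abel
  · refine hν.trans (congrArg (fun t => t + QGrp.pull Δ y.θ) ?_)
    rw [← QGrp.pairing_neg_right]
    have h3 : ∀ (p : SDual Λ z.F →ₗ[Λ] z.F), QGrp.mk ε (ev.comp p) =
        QGrp.pairing ε (ev.comp p) (LinearMap.id : SDual Λ z.F →ₗ[Λ] SDual Λ z.F) := fun _ => rfl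
    rw [h3]
    refine QGrp.pairing_star fun u w => ?_
    change u (-f'.α (y.γ (Δ w))) = (ε : ℤ) • star (star (u ((-(ε : ℤ)) • f'.α (y.γ (Δ w)))))
    rw [star_star, map_zsmul, map_neg, smul_smul, mul_neg, units_coe_mul_self, neg_one_smul]

theorem transported_trans (f : SplitIso Z y z) (g : SplitIso Z z w) :
    (f.trans g).transported =
      QGrp.pull (dualMap g.α.toLinearMap) f.transported + g.transported := by
  change QGrp.pull (dualMap (f.α.trans g.α).toLinearMap)
    (f.ν + QGrp.pull (dualMap f.α.symm.toLinearMap) g.ν) = _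
  rw [map_add, QGrp.pull_pull, transported, transported, QGrp.pull_pull]
  refine congrArg₂ (· + ·) rfl (congrArg (fun t => QGrp.pull t g.ν) ?_)
  refine LinearMap.ext fun u => SDual.ext fun x => ?_
  simp

end General

section Corner

variable {v v' : QForm Λ ε} {P P' : BasedModule Λ}

abbrev bd (v : QForm Λ ε) (P : BasedModule Λ) : SplitFormation Λ ε :=
  (SplitFormation.boundary v).sum (SplitFormation.trivial ε P)

/-- The first entry of `α`. -/
def corner (f : SplitIso Z (bd v P) (bd v' P')) : v.M →ₗ[Λ] v'.M :=
  (LinearMap.fst Λ v'.M P').comp (f.α.toLinearMap.comp (LinearMap.inl Λ v.M P))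

/-- The first entry of `α ν α^*`. -/
def cornerQ (f : SplitIso Z (bd v P) (bd v' P')) : QGrp Λ ε (SDual Λ v'.M) :=
  QGrp.pull (dualMap (LinearMap.fst Λ v'.M P')) f.transported

/-- The upper right entry of `β^{-1}`. -/
def backMap (f : SplitIso Z (bd v P) (bd v' P')) : SDual Λ P' →ₗ[Λ] v.M :=
  (LinearMap.fst Λ v.M (SDual Λ P)).comp
    (f.β.symm.toLinearMap.comp (LinearMap.inr Λ v'.M (SDual Λ P')))

/-- The upper left entry of `β^{-1}`. -/
def backForm (f : SplitIso Z (bd v P) (bd v' P')) : v'.M →ₗ[Λ] v.M :=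
  (LinearMap.fst Λ v.M (SDual Λ P)).comp
    (f.β.symm.toLinearMap.comp (LinearMap.inl Λ v'.M (SDual Λ P')))

variable (f f' : SplitIso Z (bd v P) (bd v' P'))

/-- On the trivial summand $\mu'$ is the identity of $P'^*$, so the second equation evaluated there
expresses the lower left entry of $\alpha$ by $\beta^{-1}$. -/
theorem snd_alpha (r : SDual Λ P') (x : v.M) :
    r ((f.α (x, 0)).2) = v.phi (f.backMap r) x := by
  have h := f.mu_alpha ((0 : v'.M), r) (x, (0 : P))
  change v'.phi 0 (f.α (x, 0)).1 + r (f.α (x, 0)).2 =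
    v.phi (f.backMap r) x + (f.β.symm ((0 : v'.M), r)).2 0 at h
  rw [map_zero, map_zero, add_zero] at h
  exact (zero_add _).symm.trans h

theorem phi_corner (x' : v'.M) (x : v.M) :
    v'.phi x' (f.corner x) = v.phi (f.backForm x') x := by
  have h := f.mu_alpha (x', (0 : SDual Λ P')) (x, (0 : P))
  change v'.phi x' (f.corner x) + (0 : SDual Λ P') (f.α (x, 0)).2 =
    v.phi (f.backForm x') x + (f.β.symm (x', (0 : SDual Λ P'))).2 0 at h
  rw [map_zero, add_zero] at h
  exact (add_zero _).symm.trans h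

theorem symm_cornerQ_phi (u : SDual Λ v'.M) (x' : v'.M) :
    QGrp.symm f.cornerQ u (v'.phi x') = u x' - u (f.corner (f.backForm x')) := by
  have h := f.symm_transported_mu (dualMap (LinearMap.fst Λ v'.M P') u) (x', (0 : SDual Λ P'))
  rw [cornerQ, QGrp.symm_pull]
  have h2 : (bd v' P').μ (x', (0 : SDual Λ P')) =
      dualMap (LinearMap.fst Λ v'.M P') (v'.phi x') :=
    SDual.ext fun x => add_zero _
  rw [h2] at h
  exact h

theorem pull_phi_cornerQ :
    QGrp.pull v'.phi f.cornerQ = v'.q - QGrp.pull f.backForm v.q := by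
  have h := congrArg (QGrp.pull (LinearMap.inl Λ v'.M (SDual Λ P'))) f.pull_mu_transported
  rw [map_sub, QGrp.pull_pull] at h
  have h2 : (bd v' P').μ.comp (LinearMap.inl Λ v'.M (SDual Λ P')) =
      (dualMap (LinearMap.fst Λ v'.M P')).comp v'.phi :=
    LinearMap.ext fun x' => SDual.ext fun x => add_zero _
  rw [h2, ← QGrp.pull_pull] at h
  refine h.trans ?_
  simp only [QGrp.pull_pull, map_zero, add_zero]
  exact congrArg (fun t => t - QGrp.pull f.backForm v.q) (QGrp.pull_id v'.q)

/-- The part of $\alpha\nu\alpha^*$ outside the corner is no independent datum. On $P'^*\subseteq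
V'^*\oplus P'^*$ the map $\mu'$ is the identity, so the third equation computes the restriction of
$\alpha\nu\alpha^*$ to $P'^*$, and the first equation computes the mixed term. -/
theorem transported_eq : f.transported =
    QGrp.pull (dualMap (LinearMap.inl Λ v'.M P')) f.cornerQ -
      QGrp.pull (f.backMap.comp (dualMap (LinearMap.inr Λ v'.M P'))) v.q -
      QGrp.pairing ε (dualMap (LinearMap.inl Λ v'.M P'))
        (f.corner.comp (f.backMap.comp (dualMap (LinearMap.inr Λ v'.M P')))) := by
  let p1 := (dualMap (LinearMap.fst Λ v'.M P')).comp (dualMap (LinearMap.inl Λ v'.M P'))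
  let p2 := (dualMap (LinearMap.snd Λ v'.M P')).comp (dualMap (LinearMap.inr Λ v'.M P'))
  have h0 : (LinearMap.id : SDual Λ (v'.M × P') →ₗ[Λ] _) = p1 + p2 := by
    refine LinearMap.ext fun u => SDual.ext fun x => ?_
    change u x = u (x.1, 0) + u (0, x.2)
    rw [← map_add]; simp
  have hμ : ∀ r : SDual Λ P', (bd v' P').μ ((0 : v'.M), r) =
      dualMap (LinearMap.snd Λ v'.M P') r := by
    intro r
    refine SDual.ext fun x => ?_
    change v'.phi 0 x.1 + r x.2 = r x.2
    rw [map_zero]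
    exact zero_add _
  have h2 : QGrp.pull (dualMap (LinearMap.snd Λ v'.M P')) f.transported =
      -QGrp.pull f.backMap v.q := by
    have h := congrArg (QGrp.pull (LinearMap.inr Λ v'.M (SDual Λ P'))) f.pull_mu_transported
    rw [map_sub, QGrp.pull_pull] at h
    have h3 : (bd v' P').μ.comp (LinearMap.inr Λ v'.M (SDual Λ P')) =
      dualMap (LinearMap.snd Λ v'.M P') := LinearMap.ext hμ
    rw [h3] at h
    refine h.trans ?_
    simp only [QGrp.pull_pull, map_zero, add_zero]
    have h4 : (LinearMap.fst Λ v'.M (SDual Λ P')).comp (LinearMap.inr Λ v'.M (SDual Λ P')) = 0 :=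
      rfl
    rw [h4, QGrp.pull_zero, zero_sub]
    rfl
  have h3 : QGrp.pairing ε ((QGrp.symm f.transported).comp p1) p2 =
      -QGrp.pairing ε (dualMap (LinearMap.inl Λ v'.M P'))
        (f.corner.comp (f.backMap.comp (dualMap (LinearMap.inr Λ v'.M P')))) := by
    rw [← QGrp.pairing_neg_right]
    refine QGrp.pairing_ext fun u w => ?_
    have h4 := f.symm_transported_mu (p1 u) ((0 : v'.M), dualMap (LinearMap.inr Λ v'.M P') w)
    rw [hμ] at h4
    refine h4.trans ?_
    change (p1 u) (0 : v'.M × P') - _ = _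
    rw [map_zero, zero_sub]
    change _ = dualMap (LinearMap.inl Λ v'.M P') u (-_)
    rw [map_neg]
    rfl
  conv_lhs => rw [← QGrp.pull_id f.transported, h0, QGrp.pull_add, h3, ← QGrp.pull_pull,
    ← QGrp.pull_pull, h2]
  rw [map_neg, cornerQ, QGrp.pull_pull, QGrp.pull_pull]
  abel

/-- `SplitFormation` does not record that $(\gamma;\mu)$ is injective. For $\partial v\oplus(P,P^*)$
the map $\gamma$ detects the first coordinate, and then $\mu$ detects the second. -/
theorem bd_injective (g : (bd v P).G) (h1 : (bd v P).γ g = 0) (h2 : (bd v P).μ g = 0) :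
    g = 0 := by
  have h3 : g.1 = 0 := congrArg Prod.fst h1
  refine Prod.ext h3 (SDual.ext fun x => ?_)
  have h4 := congrArg (fun t : SDual Λ (v.M × P) => t (0, x)) h2
  change v.phi g.1 0 + g.2 x = 0 at h4
  rw [map_zero, zero_add] at h4
  exact h4

/-- Isomorphisms are homotopic if their corners are related by a homotopy. -/
theorem homotopic_of_corner (t : SDual Λ v'.M →ₗ[Λ] v.M)
    (ha : ∀ u x, u (f'.corner x) = u (f.corner x) + v.phi (t u) x)
    (hs : f'.cornerQ - f.cornerQ =
      -QGrp.pairing ε LinearMap.id (f'.corner.comp t) + QGrp.pull t v.q) : f.Homotopic f' := by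
  let p1 := dualMap (LinearMap.inl Λ v'.M P')
  let p2 := dualMap (LinearMap.inr Λ v'.M P')
  let D := f'.backMap - f.backMap
  let d := t.comp p1 + D.comp p2
  -- The choice is forced by the condition on $\alpha$. On $V$ it requires `t` on $V'^*$ and, by
  -- `snd_alpha`, the difference of the back maps on $P'^*$. On $P$, where $\mu$ is the identity of
  -- $P^*$, it requires the difference of the restrictions of $\alpha'^*$ and $\alpha^*$.
  let Δ : SDual Λ (v'.M × P') →ₗ[Λ] (v.M × SDual Λ P) :=
    d.prod ((dualMap (LinearMap.inr Λ v.M P)).comp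
      (dualMap f'.α.toLinearMap - dualMap f.α.toLinearMap))
  have hu : ∀ (u : SDual Λ (v'.M × P')) (x : v'.M × P'), u x = p1 u x.1 + p2 u x.2 := by
    intro u x
    change u x = u (x.1, 0) + u (0, x.2)
    rw [← map_add]; simp
  refine homotopic_of_data bd_injective Δ ?_ ?_
  · intro u x
    have h1 : ∀ g : SplitIso Z (bd v P) (bd v' P'), u (g.α x) =
        p1 u (g.corner x.1) + v.phi (g.backMap (p2 u)) x.1 + u (g.α (0, x.2)) := by
      intro g
      have h2 : u (g.α x) = u (g.α (x.1, 0)) + u (g.α (0, x.2)) := by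
        rw [← map_add, ← map_add]; simp
      rw [h2, hu u (g.α (x.1, 0)), g.snd_alpha]
      rfl
    rw [h1, h1 f, ha]
    change _ = _ + (v.phi (t (p1 u) + (f'.backMap (p2 u) - f.backMap (p2 u))) x.1 +
      (u (f'.α (0, x.2)) - u (f.α (0, x.2))))
    rw [map_add, map_sub, SDual.add_apply, SDual.sub_apply]
    abel
  · have h1 : QGrp.pairing ε LinearMap.id (f'.α.toLinearMap.comp ((bd v P).γ.comp Δ)) =
        QGrp.pairing ε p1 (f'.corner.comp d) +
          QGrp.pairing ε (v.phi.comp (f'.backMap.comp p2)) d := by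
      rw [QGrp.pairing, QGrp.pairing, QGrp.pairing, ← map_add]
      refine congrArg (QGrp.mk ε) (LinearMap.ext fun w => SDual.ext fun u => ?_)
      change w (f'.α (d u, 0)) = p1 w (f'.corner (d u)) + v.phi (f'.backMap (p2 w)) (d u)
      rw [hu w, f'.snd_alpha]
      rfl
    have h2 : QGrp.pull Δ (bd v P).θ = QGrp.pull d v.q := by
      simp only [QGrp.pull_pull, map_zero, add_zero]
      rfl
    rw [h1, h2, f.transported_eq, f'.transported_eq]
    have h3 : f'.cornerQ = f.cornerQ - QGrp.pairing ε LinearMap.id (f'.corner.comp t) +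
        QGrp.pull t v.q := by
      rw [sub_eq_iff_eq_add] at hs
      rw [hs]; abel
    have h4 : QGrp.pairing ε p1 (f.corner.comp (f.backMap.comp p2)) =
        QGrp.pairing ε p1 (f'.corner.comp (f.backMap.comp p2)) -
          QGrp.pairing ε (v.phi.comp (t.comp p1)) (f.backMap.comp p2) := by
      rw [QGrp.pairing, QGrp.pairing, QGrp.pairing, ← map_sub]
      refine congrArg (QGrp.mk ε) (LinearMap.ext fun w => SDual.ext fun u => ?_)
      change p1 w (f.corner (f.backMap (p2 u))) = p1 w (f'.corner (f.backMap (p2 u))) -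
        v.phi (t (p1 w)) (f.backMap (p2 u))
      rw [ha]; abel
    have h5 : f.backMap.comp p2 = f'.backMap.comp p2 - D.comp p2 := by
      rw [← LinearMap.sub_comp, sub_sub_cancel]
    change QGrp.pull p1 f'.cornerQ - _ - QGrp.pairing ε p1 (f'.corner.comp (f'.backMap.comp p2)) -
      (QGrp.pull p1 f.cornerQ - _ - QGrp.pairing ε p1 (f.corner.comp (f.backMap.comp p2))) = _
    rw [h4, h5, h3]
    have h6 : QGrp.pairing ε (v.phi.comp (t.comp p1)) (f'.backMap.comp p2) =
        QGrp.pairing ε (v.phi.comp (f'.backMap.comp p2)) (t.comp p1) :=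
      QGrp.pairing_symm_comm v.q _ _
    have h7 : QGrp.pull p1 (QGrp.pairing ε LinearMap.id (f'.corner.comp t)) =
      QGrp.pairing ε p1 (f'.corner.comp (t.comp p1)) := rfl
    have h8 : QGrp.pull (f'.backMap.comp p2 - D.comp p2) v.q =
        QGrp.pull (f'.backMap.comp p2) v.q + QGrp.pull (D.comp p2) v.q -
          QGrp.pairing ε (v.phi.comp (f'.backMap.comp p2)) (D.comp p2) := QGrp.pull_sub _ _ _
    have h9 : QGrp.pull d v.q = QGrp.pull (t.comp p1) v.q + QGrp.pull (D.comp p2) v.q +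
        QGrp.pairing ε (v.phi.comp (t.comp p1)) (D.comp p2) := QGrp.pull_add _ _ _
    have h10 : f'.corner.comp d = f'.corner.comp (t.comp p1) + f'.corner.comp (D.comp p2) :=
      LinearMap.comp_add _ _ _
    rw [h8, h9, h10, map_add, map_sub, h7, QGrp.pull_pull, LinearMap.comp_sub,
      QGrp.pairing_sub_right, QGrp.pairing_sub_right, h6, QGrp.pairing_add_right]
    change _ = -(_ + QGrp.pairing ε (v.phi.comp (f'.backMap.comp p2))
      (t.comp p1 + D.comp p2)) + _
    rw [QGrp.pairing_add_right]
    abel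

end Corner

end SplitIso

end SplitIsoCalculus

/-! ### The corner entries under composition, stabilisation and conjugation. -/

section Corners

variable {Λ : Type u} [Ring Λ] [StarRing Λ] [InvariantBasisNumber Λ]
variable {Z : AddSubgroup (RedK1 Λ)} {ε : ℤˣ}

namespace SplitIso

variable {y z w y' z' : SplitFormation Λ ε}

theorem transported_of_nu {f : SplitIso Z y z} (h : f.ν = 0) : f.transported = 0 := by
  rw [transported, h, map_zero]

theorem transported_symm_of_nu {f : SplitIso Z y z} (h : f.ν = 0) : f.symm.transported = 0 := by
  refine transported_of_nu ?_
  change -QGrp.pull _ f.ν = 0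
  rw [h, map_zero, neg_zero]

theorem transported_sum (f : SplitIso Z y z) (f' : SplitIso Z y' z') :
    (f.sum f').transported = QGrp.pull (dualMap (LinearMap.inl Λ z.F z'.F)) f.transported +
      QGrp.pull (dualMap (LinearMap.inr Λ z.F z'.F)) f'.transported := by
  change QGrp.pull (dualMap (f.α.prodCongr f'.α).toLinearMap)
    (QGrp.pull (dualMap (LinearMap.inl Λ y.F y'.F)) f.ν +
      QGrp.pull (dualMap (LinearMap.inr Λ y.F y'.F)) f'.ν) = _
  rw [map_add, transported, transported]
  simp only [QGrp.pull_pull]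
  refine congrArg₂ (fun s t => QGrp.pull s f.ν + QGrp.pull t f'.ν) ?_ ?_
  · refine LinearMap.ext fun u => SDual.ext fun x => ?_
    simp
  · refine LinearMap.ext fun u => SDual.ext fun x => ?_
    simp

theorem transported_refl (y : SplitFormation Λ ε) : (refl (Z := Z) y).transported = 0 :=
  transported_of_nu rfl

/-- If $\mu$ has a right inverse, the third equation determines $\nu$; with $\theta=\theta'=0$ it
forces $\nu=0$. This applies to the isomorphisms between trivial formations that occur in a stable
homotopy. -/
theorem transported_of_mu (f : SplitIso Z y z) (hy : y.θ = 0) (hz : z.θ = 0)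
    (m : SDual Λ y.F →ₗ[Λ] y.G) (hm : y.μ.comp m = LinearMap.id) : f.transported = 0 := by
  have h := congrArg (QGrp.pull m) f.eqθ
  rw [hy, hz, zero_add, map_zero, map_zero, QGrp.pull_pull, hm, QGrp.pull_id] at h
  exact transported_of_nu h

end SplitIso

namespace StableIso

variable {v v' w w' : QForm Λ ε}
variable (f : StableIso Z (SplitFormation.boundary v) (SplitFormation.boundary v'))

/-- Together with the next lemma: the extensions in the definition of stable homotopy do not change
the two entries that define the union. -/
theorem corner_extend {A B R : BasedModule Λ}
    (g : SplitIso Z (SplitFormation.trivial ε A)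
      ((SplitFormation.trivial ε f.P).sum (SplitFormation.trivial ε R)))
    (h : SplitIso Z ((SplitFormation.trivial ε f.P').sum (SplitFormation.trivial ε R))
      (SplitFormation.trivial ε B)) : (f.extend g h).corner = f.f.corner := by
  refine LinearMap.ext fun x => ?_
  change (f.f.α (x, (g.α 0).1)).1 = (f.f.α (x, 0)).1
  rw [map_zero]
  rfl

theorem cornerQ_extend {A B R : BasedModule Λ}
    (g : SplitIso Z (SplitFormation.trivial ε A)
      ((SplitFormation.trivial ε f.P).sum (SplitFormation.trivial ε R)))
    (h : SplitIso Z ((SplitFormation.trivial ε f.P').sum (SplitFormation.trivial ε R))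
      (SplitFormation.trivial ε B)) : (f.extend g h).cornerQ = f.f.cornerQ := by
  have hg : g.transported = 0 := g.transported_of_mu rfl
    (by simp) LinearMap.id rfl
  have hh : h.transported = 0 := h.transported_of_mu (by simp) rfl
    (dualProd (Λ := Λ) f.P' R).toLinearMap
    (LinearMap.ext fun u => (dualProd (Λ := Λ) f.P' R).symm_apply_apply u)
  rw [SplitIso.cornerQ, SplitIso.cornerQ, extend, SplitIso.transported_trans,
    SplitIso.transported_trans, SplitIso.transported_trans, SplitIso.transported_trans,
    SplitIso.transported_sum, SplitIso.transported_sum, SplitIso.transported_sum, hg, hh,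
    SplitIso.transported_refl, SplitIso.transported_refl, SplitIso.transported_refl,
    SplitIso.transported_symm_of_nu (f := SplitIso.assoc _ _ _) rfl,
    SplitIso.transported_of_nu (f := SplitIso.assoc _ _ _) rfl]
  simp only [map_zero, zero_add, add_zero, QGrp.pull_pull]
  refine congrArg (fun t => QGrp.pull t f.f.transported) ?_
  refine LinearMap.ext fun u => SDual.ext fun x => ?_
  rfl

theorem corner_conjIsometry (k : Isometry Z v w) (l : Isometry Z v' w') :
    (f.conjIsometry k l).f.corner =
      l.e.toLinearMap.comp (f.f.corner.comp k.e.symm.toLinearMap) := rfl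

theorem cornerQ_conjIsometry (k : Isometry Z v w) (l : Isometry Z v' w') :
    (f.conjIsometry k l).f.cornerQ = QGrp.pull (dualMap l.e.toLinearMap) f.f.cornerQ := by
  rw [SplitIso.cornerQ, SplitIso.cornerQ, conjIsometry, conj, SplitIso.transported_trans,
    SplitIso.transported_trans, SplitIso.transported_sum, SplitIso.transported_sum,
    SplitIso.transported_refl, SplitIso.transported_refl,
    SplitIso.transported_of_nu (f := SplitIso.ofIsometry k.symm) rfl,
    SplitIso.transported_of_nu (f := SplitIso.ofIsometry l) rfl]
  simp only [map_zero, zero_add, add_zero, QGrp.pull_pull]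
  refine congrArg (fun t => QGrp.pull t f.f.transported) ?_
  refine LinearMap.ext fun u => SDual.ext fun x => ?_
  rfl

theorem corner_stab (Q : BasedModule Λ) :
    (f.stab Q).f.corner = f.f.corner.prodMap LinearMap.id := rfl

theorem transported_sumRefl {y z : SplitFormation Λ ε} (f : StableIso Z y z)
    (x : SplitFormation Λ ε) : (f.sumRefl x).f.transported =
      QGrp.pull (dualMap ((LinearMap.inl Λ z.F x.F).prodMap LinearMap.id)) f.f.transported := by
  have h1 := SplitIso.transported_trans (Z := Z)
    ((SplitIso.rightComm y x (SplitFormation.trivial ε f.P)).trans (f.f.sum (SplitIso.refl x)))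
    (SplitIso.rightComm z (SplitFormation.trivial ε f.P') x)
  have h2 := SplitIso.transported_trans (Z := Z)
    (SplitIso.rightComm y x (SplitFormation.trivial ε f.P)) (f.f.sum (SplitIso.refl x))
  have h3 : (SplitIso.rightComm (Z := Z) y x (SplitFormation.trivial ε f.P)).transported = 0 :=
    SplitIso.transported_of_nu rfl
  have h4 : (SplitIso.rightComm (Z := Z) z (SplitFormation.trivial ε f.P') x).transported = 0 :=
    SplitIso.transported_of_nu rfl
  have h5 := SplitIso.transported_sum f.f (SplitIso.refl (Z := Z) x)
  refine h1.trans ?_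
  rw [h2, h3, h4, h5, SplitIso.transported_refl, map_zero, map_zero, zero_add, add_zero, add_zero,
    QGrp.pull_pull]
  refine congrArg (fun t => QGrp.pull t f.f.transported) ?_
  exact LinearMap.ext fun u => SDual.ext fun x => rfl

theorem transported_conj {y z y' z' : SplitFormation Λ ε} (f : StableIso Z y z)
    (a : SplitIso Z y' y) (b : SplitIso Z z z') (ha : a.transported = 0)
    (hb : b.transported = 0) : (f.conj a b).f.transported =
      QGrp.pull (dualMap (b.α.toLinearMap.prodMap LinearMap.id)) f.f.transported := by
  change (((a.sum (SplitIso.refl (SplitFormation.trivial ε f.P))).trans f.f).trans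
    (b.sum (SplitIso.refl (SplitFormation.trivial ε f.P')))).transported = _
  rw [SplitIso.transported_trans, SplitIso.transported_trans, SplitIso.transported_sum,
    SplitIso.transported_sum, SplitIso.transported_refl, SplitIso.transported_refl, ha, hb]
  simp only [map_zero, zero_add, add_zero]
  rfl

theorem cornerQ_stab (Q : BasedModule Λ) : (f.stab Q).f.cornerQ =
    QGrp.pull (dualMap (LinearMap.inl Λ v'.M Q)) f.f.cornerQ := by
  have h1 := transported_conj (f.sumRefl (SplitFormation.boundary (QForm.zeroForm ε Q)))
    (SplitIso.boundarySum v (QForm.zeroForm ε Q))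
    (SplitIso.boundarySum v' (QForm.zeroForm ε Q)).symm (SplitIso.transported_of_nu rfl)
    (SplitIso.transported_symm_of_nu rfl)
  have h2 := h1.trans (congrArg (QGrp.pull _)
    (transported_sumRefl f (SplitFormation.boundary (QForm.zeroForm ε Q))))
  refine (congrArg (QGrp.pull _) (h2.trans (QGrp.pull_pull _ _ _))).trans ?_
  refine (QGrp.pull_pull _ _ _).trans (Eq.trans ?_ (QGrp.pull_pull _ _ _).symm)
  refine congrArg (fun t => QGrp.pull t f.f.transported) ?_
  exact LinearMap.ext fun u => SDual.ext fun x => rfl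

theorem corner_refl (v : QForm Λ ε) :
    (StableIso.refl (Z := Z) (SplitFormation.boundary v)).f.corner = LinearMap.id := rfl

theorem cornerQ_refl (v : QForm Λ ε) :
    (StableIso.refl (Z := Z) (SplitFormation.boundary v)).f.cornerQ = 0 := by
  change QGrp.pull _ (SplitIso.transported (SplitIso.refl _)) = 0
  rw [SplitIso.transported_refl, map_zero]

end StableIso

/-- The form on `V ⊕ V'^*` with the matrix `(θ, 0; ε a, -s)`. -/
abbrev unionOf (v v' : QForm Λ ε) (a : v.M →ₗ[Λ] v'.M) (s : QGrp Λ ε (SDual Λ v'.M)) :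
    QForm Λ ε where
  M := v.M.prod v'.M.dual
  q := QGrp.pull (LinearMap.fst Λ v.M (SDual Λ v'.M)) v.q +
    QGrp.pairing ε (LinearMap.snd Λ v.M (SDual Λ v'.M))
      (a.comp (LinearMap.fst Λ v.M (SDual Λ v'.M))) -
    QGrp.pull (LinearMap.snd Λ v.M (SDual Λ v'.M)) s

/-- In $Q_\epsilon$ the off-diagonal entry $\epsilon a$ may be replaced by the evaluation
$(x,u)\mapsto u(a\,x)$, which removes the sign and the double dual. -/
theorem unionForm_eq {v v' : QForm Λ ε}
    (f : StableIso Z (SplitFormation.boundary v) (SplitFormation.boundary v')) :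
    unionForm f = unionOf v v' f.f.corner f.f.cornerQ := by
  have h : ∀ p : (v.M × SDual Λ v'.M) →ₗ[Λ] v'.M, QGrp.mk ε
      ((ε : ℤ) • (dualMap (LinearMap.snd Λ v.M (SDual Λ v'.M))).comp (ev.comp p)) =
      QGrp.pairing ε (LinearMap.snd Λ v.M (SDual Λ v'.M)) p := by
    intro p
    refine Eq.trans ?_ (QGrp.mk_adj _)
    refine congrArg (QGrp.mk ε) (LinearMap.ext fun x => SDual.ext fun y => rfl)
  have h2 : QGrp.pull ((dualMap f.f.α.toLinearMap).comp (dualMap (LinearMap.fst Λ v'.M f.P')))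
      f.f.ν = f.f.cornerQ := by
    rw [SplitIso.cornerQ, SplitIso.transported, QGrp.pull_pull]
  rw [unionForm, h, h2]
  rfl

theorem phi_unionOf (v v' : QForm Λ ε) (a : v.M →ₗ[Λ] v'.M) (s : QGrp Λ ε (SDual Λ v'.M))
    (x y : v.M × SDual Λ v'.M) : (unionOf v v' a s).phi x y =
      v.phi x.1 y.1 + (x.2 (a y.1) + (ε : ℤ) • star (y.2 (a x.1))) - QGrp.symm s x.2 y.2 := by
  change QGrp.symm (QGrp.pull (LinearMap.fst Λ v.M (SDual Λ v'.M)) v.q +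
    QGrp.pairing ε (LinearMap.snd Λ v.M (SDual Λ v'.M))
      (a.comp (LinearMap.fst Λ v.M (SDual Λ v'.M))) -
    QGrp.pull (LinearMap.snd Λ v.M (SDual Λ v'.M)) s) x y = _
  rw [map_sub, map_add]
  exact congrArg₂ (fun a b : Λ => a - b) (congrArg₂ (fun a b : Λ => a + b)
    (QGrp.symm_pull (LinearMap.fst Λ v.M (SDual Λ v'.M)) v.q x y) rfl)
    (QGrp.symm_pull (LinearMap.snd Λ v.M (SDual Λ v'.M)) s x y)

end Corners

/-! ### Stable homotopy in terms of the corner. -/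

section StableHomotopy

variable {Λ : Type u} [Ring Λ] [StarRing Λ] [InvariantBasisNumber Λ]
variable {Z : AddSubgroup (RedK1 Λ)} {ε : ℤˣ}

/-- A homotopy is restricted to $V'^*$ and tested on $V$; its component in $P^*$ then drops out.
This is the converse of `homotopic_of_corner`. -/
theorem SplitIso.corner_data_of_homotopic {v v' : QForm Λ ε} {P P' : BasedModule Λ}
    {f f' : SplitIso Z (bd v P) (bd v' P')} (h : f.Homotopic f') :
    ∃ t : SDual Λ v'.M →ₗ[Λ] v.M,
      (∀ u x, u (f'.corner x) = u (f.corner x) + v.phi (t u) x) ∧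
      f'.cornerQ - f.cornerQ =
        -QGrp.pairing ε LinearMap.id (f'.corner.comp t) + QGrp.pull t v.q := by
  obtain ⟨Δ, hα, hν⟩ := SplitIso.homotopic_data h
  let d := dualMap (LinearMap.fst Λ v'.M P')
  refine ⟨(LinearMap.fst Λ v.M (SDual Λ P)).comp (Δ.comp d), fun u x => ?_, ?_⟩
  · have h1 := hα (d u) (x, 0)
    change u (f'.corner x) = u (f.corner x) + (v.phi (Δ (d u)).1 x + (Δ (d u)).2 0) at h1
    rw [map_zero, add_zero] at h1
    exact h1
  · have h1 := congrArg (QGrp.pull d) hν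
    rw [map_sub, map_add, map_neg] at h1
    refine h1.trans ?_
    have h2 : QGrp.pull d (QGrp.pull Δ (bd v P).θ) =
        QGrp.pull ((LinearMap.fst Λ v.M (SDual Λ P)).comp (Δ.comp d)) v.q := by
      simp only [QGrp.pull_pull, map_zero, add_zero]
      rfl
    rw [h2]
    rfl

namespace StableIso

section

variable {v v' : QForm Λ ε}

theorem corner_data_of_homotopic
    {f f' : StableIso Z (SplitFormation.boundary v) (SplitFormation.boundary v')}
    (h : f.Homotopic f') :
    ∃ t : SDual Λ v'.M →ₗ[Λ] v.M,
      (∀ u x, u (f'.f.corner x) = u (f.f.corner x) + v.phi (t u) x) ∧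
      f'.f.cornerQ - f.f.cornerQ =
        -QGrp.pairing ε LinearMap.id (f'.f.corner.comp t) + QGrp.pull t v.q := by
  obtain ⟨A, B, R, R', g, k, g', k', h⟩ := h
  have h1 := SplitIso.corner_data_of_homotopic h
  rw [corner_extend, corner_extend, cornerQ_extend, cornerQ_extend] at h1
  exact h1

end

end StableIso

variable [hZ : Fact (StarInvariant Z)]

/-- The isomorphism of trivial formations induced by `A ≅ P ⊕ R`. -/
def SplitIso.ofTrivial (ε : ℤˣ) {A P R : BasedModule Λ} (e : SEquiv Z A (P.prod R)) :
    SplitIso Z (SplitFormation.trivial ε A)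
      ((SplitFormation.trivial ε P).sum (SplitFormation.trivial ε R)) :=
  SplitIso.ofApply (y := SplitFormation.trivial ε A)
    (z := (SplitFormation.trivial ε P).sum (SplitFormation.trivial ε R)) e.e e.simple
    (e.symm.dual.trans (SEquiv.dualProd Z P R)).e (e.symm.dual.trans (SEquiv.dualProd Z P R)).simple
    0 (fun g u => by
      rw [map_zero]
      change u (e.e 0) + 0 = u 0
      rw [map_zero, map_zero, add_zero])
    (fun g => SDual.ext fun x => by
      change g (e.e.symm x) = g (e.e.symm (x.1, 0)) + g (e.e.symm (0, x.2))
      rw [← map_add, ← map_add]; simp)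
    (by simp)

/-- The two stable isomorphisms may use different trivial summands. Once these are matched by
stabilisation, `SplitIso.homotopic_of_corner` applies, because stabilisation does not affect the
corners. -/
theorem StableIso.homotopic_of_corner {v v' : QForm Λ ε}
    (f f' : StableIso Z (SplitFormation.boundary v) (SplitFormation.boundary v'))
    (t : SDual Λ v'.M →ₗ[Λ] v.M)
    (ha : ∀ u x, u (f'.f.corner x) = u (f.f.corner x) + v.phi (t u) x)
    (hs : f'.f.cornerQ - f.f.cornerQ =
      -QGrp.pairing ε LinearMap.id (f'.f.corner.comp t) + QGrp.pull t v.q) :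
    f.Homotopic f' := by
  let W := v'.M.prod v.M
  let F : SEquiv Z (v.M.prod f.P) (v'.M.prod f.P') := ⟨f.f.α, f.f.α_simple⟩
  let F' : SEquiv Z (v.M.prod f'.P) (v'.M.prod f'.P') := ⟨f'.f.α, f'.f.α_simple⟩
  let c := @SEquiv.prodComm Λ _ _ _ Z
  let e1 : SEquiv Z (f.P.prod (f'.P.prod W)) (f'.P.prod (f.P.prod W)) :=
    (SEquiv.prodAssoc Z f.P f'.P W).symm.trans
      (((c f.P f'.P).prod (.refl W)).trans (SEquiv.prodAssoc Z f'.P f.P W))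
  -- On the target side the stabilised modules have to be identified. The extra summand $W=V'\oplus
  -- V$ makes this possible: $V'$ joins the target summand of `f`, where $\alpha^{-1}$ applies, and
  -- $V$ joins the source summand of `f'`, where $\alpha'$ applies.
  let e2 : SEquiv Z (f.P'.prod (f'.P.prod W)) (f'.P'.prod (f.P.prod W)) :=
    (SEquiv.prodAssoc Z f.P' f'.P W).symm.trans <|
    (SEquiv.prodProdProdComm Z f.P' f'.P v'.M v.M).trans <|
    ((c f.P' v'.M).prod (c f'.P v.M)).trans <| (F.symm.prod F').trans <|
    ((c v.M f.P).prod (c v'.M f'.P')).trans <| (c (f.P.prod v.M) (f'.P'.prod v'.M)).trans <|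
    (SEquiv.prodProdProdComm Z f'.P' v'.M f.P v.M).trans <|
    SEquiv.prodAssoc Z f'.P' f.P W
  refine ⟨f.P.prod (f'.P.prod W), f.P'.prod (f'.P.prod W), f'.P.prod W, f.P.prod W,
    .ofTrivial ε (.refl _), (SplitIso.ofTrivial ε (.refl _)).symm, .ofTrivial ε e1,
    (SplitIso.ofTrivial ε e2).symm, SplitIso.homotopic_of_corner _ _ t ?_ ?_⟩
  · rw [corner_extend, corner_extend]
    exact ha
  · rw [corner_extend, cornerQ_extend, cornerQ_extend]
    exact hs

end StableHomotopy

/-! ### Simplicity of unions, and annihilators in simple forms. -/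

section Unions

variable {Λ : Type u} [Ring Λ] [StarRing Λ] [InvariantBasisNumber Λ]
variable {Z : AddSubgroup (RedK1 Λ)} {ε : ℤˣ}

/-- The homomorphism `X^* → X` given by the symmetrisation of an element of `Q_ε(X^*)`. -/
noncomputable def flat {X : BasedModule Λ} (q : QGrp Λ ε (SDual Λ X)) : SDual Λ X →ₗ[Λ] X :=
  (unev X).comp (adj (QGrp.symm q))

theorem apply_flat {X : BasedModule Λ} (q : QGrp Λ ε (SDual Λ X)) (u w : SDual Λ X) :
    w (flat q u) = QGrp.symm q w u := by
  change w (unev X (adj (QGrp.symm q) u)) = _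
  rw [apply_unev, adj_apply, star_star]

theorem QForm.IsSimpleForm.exists_equiv {v : QForm Λ ε} (hv : v.IsSimpleForm Z) :
    ∃ e : SEquiv Z v.M v.M.dual, ∀ x, e.e x = v.phi x := by
  obtain ⟨e, he, h⟩ := hv
  exact ⟨⟨e, he⟩, h⟩

variable [hZ : Fact (StarInvariant Z)]

/-- Up to signs `G` is the symmetrisation of the union. After the addition of $P'^*$ it becomes a
composite of $\alpha^*$, a shear by $\varphi$, $\beta$ and one more shear, up to reordering. All of
these are simple, and $P'^*$ is cancelled by `exists_of_block`. -/
theorem exists_union_equiv {v v' : QForm Λ ε} {P P' : BasedModule Λ}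
    (f : SplitIso Z (SplitIso.bd v P) (SplitIso.bd v' P')) :
    ∃ G : SEquiv Z (v.M.prod v'.M.dual) (v.M.dual.prod v'.M), ∀ x u,
      G.e (x, u) = (dualMap f.corner u - v.phi x, f.corner x + flat f.cornerQ u) := by
  let F : SEquiv Z (v.M.prod P) (v'.M.prod P') := ⟨f.α, f.α_simple⟩
  let b : SEquiv Z (v.M.prod P.dual) (v'.M.prod P'.dual) := ⟨f.β, f.β_simple⟩
  let N : SDual Λ (v'.M × P') →ₗ[Λ] (v'.M × P') := flat (X := v'.M.prod P') f.transported
  have hN : ∀ u w, w (N u) = QGrp.symm f.transported w u :=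
    fun u w => apply_flat (X := v'.M.prod P') f.transported u w
  let m : SDual Λ v.M →ₗ[Λ] SDual Λ (v'.M × P') :=
    (dualMap f.α.symm.toLinearMap).comp (dualMap (LinearMap.fst Λ v.M P))
  let κ : SDual Λ v.M →ₗ[Λ] (v'.M × SDual Λ P') :=
    ((LinearMap.fst Λ v'.M P').comp (N.comp m)).prod ((dualMap (LinearMap.inr Λ v'.M P')).comp m)
  let X : SEquiv Z ((v.M.prod v'.M.dual).prod P'.dual) ((v.M.dual.prod v'.M).prod P'.dual) :=
    (SEquiv.prodAssoc Z _ _ _).trans <|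
    ((SEquiv.refl v.M).prod ((SEquiv.dualProd Z v'.M P').symm.trans
      (F.dual.trans (SEquiv.dualProd Z v.M P)))).trans <|
    (SEquiv.prodAssoc Z _ _ _).symm.trans <|
    (((SEquiv.prodComm Z v.M v.M.dual).trans (SEquiv.shearLeft Z (-v.phi))).prod
      (SEquiv.refl P.dual)).trans <|
    (SEquiv.prodAssoc Z _ _ _).trans <|
    ((SEquiv.refl v.M.dual).prod b).trans <|
    (SEquiv.shear Z (N := v'.M.prod P'.dual) κ).trans (SEquiv.prodAssoc Z _ _ _).symm
  let g : (v.M × SDual Λ v'.M) →ₗ[Λ] (SDual Λ v.M × v'.M) :=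
    ((dualMap f.corner).comp (LinearMap.snd Λ v.M (SDual Λ v'.M)) -
      v.phi.comp (LinearMap.fst Λ v.M (SDual Λ v'.M))).prod
    (f.corner.comp (LinearMap.fst Λ v.M (SDual Λ v'.M)) +
      (flat f.cornerQ).comp (LinearMap.snd Λ v.M (SDual Λ v'.M)))
  let k : SDual Λ P' →ₗ[Λ] (SDual Λ v.M × v'.M) :=
    ((dualMap (f.α.toLinearMap.comp (LinearMap.inl Λ v.M P))).comp
      (dualMap (LinearMap.snd Λ v'.M P'))).prod
    ((LinearMap.fst Λ v'.M P').comp (N.comp (dualMap (LinearMap.snd Λ v'.M P'))))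
  obtain ⟨G, hG⟩ := X.exists_of_block g k (by
    rintro ⟨x, u⟩ r
    let U : SDual Λ (v'.M × P') := dualMap (LinearMap.fst Λ v'.M P') u +
      dualMap (LinearMap.snd Λ v'.M P') r
    -- Here `y` and `q` are the values on $(x,u,r)$ just before $\beta$ is applied: $\alpha^*(u,r)$
    -- is split into its $V^*$-part, corrected by $-\varphi x$, and its $P^*$-part.
    let y : SDual Λ v.M := dualMap (f.α.toLinearMap.comp (LinearMap.inl Λ v.M P)) U - v.phi x
    let q : SDual Λ P := dualMap (f.α.toLinearMap.comp (LinearMap.inr Λ v.M P)) U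
    have hX : X.e ((x, u), r) =
        ((y, (f.β (x, q)).1 + (N (m y)).1), (f.β (x, q)).2 + dualMap (LinearMap.inr Λ v'.M P') (m y)) := by
      have hy : dualMap (f.α.toLinearMap.comp (LinearMap.inl Λ v.M P)) U + (-v.phi) x = y := by
        rw [LinearMap.neg_apply, ← sub_eq_add_neg]
      change ((dualMap (f.α.toLinearMap.comp (LinearMap.inl Λ v.M P)) U + (-v.phi) x,
        (f.β (x, q)).1 + (N (m (dualMap (f.α.toLinearMap.comp (LinearMap.inl Λ v.M P)) U
          + (-v.phi) x))).1), (f.β (x, q)).2 + dualMap (LinearMap.inr Λ v'.M P')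
          (m (dualMap (f.α.toLinearMap.comp (LinearMap.inl Λ v.M P)) U + (-v.phi) x))) = _
      rw [hy]
    -- By construction $\alpha^*(U-m\,y)=\mu(x,q)$. Hence $\beta(x,q)$ deviates from the desired
    -- value only by terms in `m y`, and the last shear `κ` is the one that adds them back.
    have hμ : (SplitIso.bd v' P').μ (f.β (x, q)) = U - m y := by
      rw [← f.eqμ_apply]
      refine SDual.ext fun z => ?_
      change v.phi x (f.α.symm z).1 + U (f.α (0, (f.α.symm z).2)) =
        U z - (U (f.α ((f.α.symm z).1, 0)) - v.phi x (f.α.symm z).1)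
      have h1 : U z = U (f.α ((f.α.symm z).1, 0)) + U (f.α (0, (f.α.symm z).2)) := by
        rw [← map_add, ← map_add]
        simp
      rw [h1]
      abel
    have hγ : ∀ w : SDual Λ v'.M, w (f.β (x, q)).1 = w (f.corner x) + w (N (U - m y)).1 := by
      intro w
      have h1 := f.symm_transported_mu (dualMap (LinearMap.fst Λ v'.M P') w) (f.β (x, q))
      rw [hμ, ← hN, LinearEquiv.symm_apply_apply] at h1
      change w (N (U - m y)).1 = w (f.β (x, q)).1 - w (f.corner x) at h1
      rw [h1]
      abel
    rw [hX]
    refine Prod.ext (Prod.ext ?_ ?_) ?_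
    · refine SDual.ext fun z => ?_
      change u (f.α (z, 0)).1 + r (f.α (z, 0)).2 - v.phi x z =
        (u (f.α (z, 0)).1 - v.phi x z) + r (f.α (z, 0)).2
      abel
    · refine v'.M.ext_dual fun w => ?_
      have h1 : w ((N (dualMap (LinearMap.fst Λ v'.M P') u)).1) = w (flat f.cornerQ u) := by
        rw [apply_flat, SplitIso.cornerQ, QGrp.symm_pull, ← hN]
        rfl
      change w ((f.β (x, q)).1 + (N (m y)).1) = w (f.corner x + flat f.cornerQ u +
        (N (dualMap (LinearMap.snd Λ v'.M P') r)).1)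
      rw [map_add, hγ, map_sub, map_add, map_add, map_add, ← h1, Prod.fst_sub, Prod.fst_add,
        map_sub, map_add]
      abel
    · refine SDual.ext fun z => ?_
      have h1 := congrArg (fun t : SDual Λ (v'.M × P') => t (0, z)) hμ
      change v'.phi (f.β (x, q)).1 0 + (f.β (x, q)).2 z = u 0 + r z - m y (0, z) at h1
      rw [map_zero, map_zero, zero_add, zero_add] at h1
      change (f.β (x, q)).2 z + m y (0, z) = r z
      rw [h1]
      abel)
  exact ⟨G, fun x u => hG (x, u)⟩

/-- The equivalence of `exists_union_equiv` becomes the symmetrisation after the sign $-1$ on $V$,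
the sign $-\epsilon$ on $V'$ and the identification of $V'$ with $V'^{**}$. None of these affects
torsion. -/
theorem unionForm_isSimpleForm {v v' : QForm Λ ε}
    (f : StableIso Z (SplitFormation.boundary v) (SplitFormation.boundary v')) :
    (unionForm f).IsSimpleForm Z := by
  rw [unionForm_eq]
  obtain ⟨G, hG⟩ := exists_union_equiv f.f
  let E : SEquiv Z (v.M.prod v'.M.dual) (v.M.prod v'.M.dual).dual :=
    ((SEquiv.neg Z v.M).prod (SEquiv.refl v'.M.dual)).trans <| G.trans <|
    ((SEquiv.refl v.M.dual).prod ((SEquiv.sign Z (-ε) v'.M).trans (SEquiv.ev Z v'.M))).trans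
      (SEquiv.dualProd Z v.M v'.M.dual).symm
  refine ⟨E.e, E.simple, fun x => SDual.ext fun y => ?_⟩
  rw [phi_unionOf]
  change (G.e (-x.1, x.2)).1 y.1 + star (y.2 (((-ε : ℤˣ) : ℤ) • (G.e (-x.1, x.2)).2)) = _
  rw [hG, map_neg, sub_neg_eq_add, map_neg, map_zsmul, map_add, map_neg, apply_flat, star_zsmul,
    Units.val_neg, star_add, star_neg, neg_smul, smul_add, QGrp.symm_symm _ x.2]
  change x.2 (f.f.corner y.1) + v.phi x.1 y.1 + _ = _
  rw [smul_neg]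
  abel

/-- If `(j, σ) : V ⊕ W^* → M` is a simple isomorphism, where `σ` is a section of `i^* φ` and
`i^* φ j = 0`, then `W` is the annihilator of `V`. -/
theorem basedExact_perp {v : QForm Λ ε} (hv : v.IsSimpleForm Z) {V W : BasedModule Λ}
    (j : V →ₗ[Λ] v.M) (i : W →ₗ[Λ] v.M) (σ : SDual Λ W →ₗ[Λ] v.M)
    (hij : ∀ w x, v.phi (i w) (j x) = 0) (hσ : ∀ u w, v.phi (σ u) (i w) = u w)
    (K : SEquiv Z (V.prod W.dual) v.M) (hK : ∀ x u, K.e (x, u) = j x + σ u) :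
    BasedExact Z i (v.perpMap j) := by
  obtain ⟨E, hE⟩ := hv.exists_equiv
  -- The composite of $\varphi$ with the dual of `K`, in the other order and with a sign on `W`. Its
  -- second component is $j^*\varphi$ and it sends $i\,w$ to $(w,0)$, so its inverse is a simple
  -- splitting of the sequence.
  let Y : SEquiv Z v.M (W.prod V.dual) :=
    E.trans <| K.dual.trans <| (SEquiv.dualProd Z V W.dual).trans <|
    ((SEquiv.refl V.dual).prod ((SEquiv.ev Z W).symm.trans (SEquiv.sign Z ε W))).trans
      (SEquiv.prodComm Z V.dual W)
  have hY2 : ∀ m, (Y.e m).2 = v.perpMap j m := by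
    intro m
    refine SDual.ext fun x => ?_
    change (E.e m) (K.e (x, 0)) = v.phi m (j x)
    rw [hE, hK, map_zero, add_zero]
  have hY1 : ∀ w, (Y.e (i w)).1 = w := by
    intro w
    change (ε : ℤ) • (evEquiv W).symm
      (dualProd (Λ := Λ) V (SDual Λ W) (dualCongr K.e (E.e (i w)))).2 = w
    have h1 : (dualProd (Λ := Λ) V (SDual Λ W) (dualCongr K.e (E.e (i w)))).2 =
        evEquiv W ((ε : ℤ) • w) := by
      refine SDual.ext fun u => ?_
      change (E.e (i w)) (K.e (0, u)) = star (u ((ε : ℤ) • w))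
      rw [hE, hK, map_zero, zero_add, QForm.phi_symm, hσ, map_zsmul, star_zsmul]
    rw [h1, LinearEquiv.symm_apply_apply, smul_smul, units_coe_mul_self, one_smul]
  have hYi : ∀ w, Y.e (i w) = (w, 0) := fun w => Prod.ext (hY1 w) ((hY2 _).trans
    (SDual.ext fun x => hij w x))
  have hi : ∀ w, Y.e.symm (w, 0) = i w := fun w => by rw [← hYi, LinearEquiv.symm_apply_apply]
  refine ⟨fun a b h => ?_, fun m => ⟨fun h => ⟨(Y.e m).1, ?_⟩, ?_⟩,
    Y.e.symm.toLinearMap.comp (LinearMap.inr Λ W (SDual Λ V)), Y.e.symm, fun c => ?_,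
    fun a c => ?_, Y.symm.simple⟩
  · rw [← hY1 a, h, hY1]
  · rw [← hi, LinearEquiv.symm_apply_eq]
    exact Prod.ext rfl ((hY2 m).trans h).symm
  · rintro ⟨w, rfl⟩
    exact (hY2 _).symm.trans (congrArg Prod.snd (hYi w))
  · rw [← hY2]
    exact congrArg Prod.snd (Y.e.apply_symm_apply (0, c))
  · rw [← hi]
    change _ = Y.e.symm (a, 0) + Y.e.symm (0, c)
    rw [← map_add]
    simp

/-- Converse of `basedExact_perp`. Let `D` be $\varphi$ followed by the dual of the splitting of the
sequence. The composite of $(j,\sigma)$ with `D` is triangular: a sign and identities on the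
diagonal, and the form between $\sigma$ and the section $\tau$ off it. This is `S`, so
$(j,\sigma)=D^{-1}S$ is simple. -/
theorem exists_perp_equiv {v : QForm Λ ε} (hv : v.IsSimpleForm Z) {V W : BasedModule Λ}
    {j : V →ₗ[Λ] v.M} {i : W →ₗ[Λ] v.M} (h : BasedExact Z i (v.perpMap j))
    (σ : SDual Λ W →ₗ[Λ] v.M) (hσ : ∀ u w, v.phi (σ u) (i w) = u w) :
    ∃ K : SEquiv Z (V.prod W.dual) v.M, ∀ x u, K.e (x, u) = j x + σ u := by
  obtain ⟨E, hE⟩ := hv.exists_equiv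
  obtain ⟨τ, -, hτ, -, -⟩ := h.based
  have hτ' : ∀ c x, v.phi (τ c) (j x) = c x := fun c x =>
    congrArg (fun t : SDual Λ V => t x) (hτ c)
  have hij : ∀ w x, v.phi (i w) (j x) = 0 := fun w x =>
    congrArg (fun t : SDual Λ V => t x) ((h.exact (i w)).2 ⟨w, rfl⟩)
  obtain ⟨e, he⟩ := h.exists_equiv τ hτ
  let D : SEquiv Z v.M (W.dual.prod V.dual.dual) :=
    E.trans (e.dual.trans (SEquiv.dualProd Z W V.dual))
  let S : SEquiv Z (V.prod W.dual) (W.dual.prod V.dual.dual) :=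
    (SEquiv.prodComm Z V W.dual).trans <|
    ((SEquiv.refl W.dual).prod ((SEquiv.sign Z ε V).trans (SEquiv.ev Z V))).trans
      (SEquiv.shear Z (N := V.dual.dual) ((dualMap τ).comp (v.phi.comp σ)))
  refine ⟨S.trans D.symm, fun x u => ?_⟩
  change D.e.symm (S.e (x, u)) = _
  rw [LinearEquiv.symm_apply_eq]
  refine Prod.ext (SDual.ext fun w => ?_) (SDual.ext fun c => ?_)
  · change u w = (E.e (j x + σ u)) (e.e (w, 0))
    rw [hE, he, map_zero, add_zero, map_add, SDual.add_apply, hσ, QForm.phi_symm, hij]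
    simp
  · change star (c ((ε : ℤ) • x)) + v.phi (σ u) (τ c) = (E.e (j x + σ u)) (e.e (0, c))
    rw [hE, he, map_zero, zero_add, map_add, SDual.add_apply, QForm.phi_symm v (j x), hτ',
      map_zsmul, star_zsmul]

theorem QForm.IsSimpleForm.exists_section {v : QForm Λ ε} (hv : v.IsSimpleForm Z)
    {V : BasedModule Λ} {j : V →ₗ[Λ] v.M} (r : v.M →ₗ[Λ] V) (hr : ∀ x, r (j x) = x) :
    ∃ s : SDual Λ V →ₗ[Λ] v.M, ∀ c, v.perpMap j (s c) = c := by
  obtain ⟨E, hE⟩ := hv.exists_equiv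
  refine ⟨E.e.symm.toLinearMap.comp (dualMap r), fun c => SDual.ext fun x => ?_⟩
  change v.phi (E.e.symm (dualMap r c)) (j x) = c x
  rw [← hE, LinearEquiv.apply_symm_apply]
  change c (r (j x)) = c x
  rw [hr]

theorem QForm.IsSimpleForm.exists_perp {v : QForm Λ ε} (hv : v.IsSimpleForm Z)
    {V : BasedModule Λ} {j : V →ₗ[Λ] v.M} (r : v.M →ₗ[Λ] V) (hr : ∀ x, r (j x) = x) :
    ∃ (W : BasedModule Λ) (i : W →ₗ[Λ] v.M), BasedExact Z i (v.perpMap j) := by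
  obtain ⟨s, hs⟩ := hv.exists_section r hr
  exact exists_basedExact _ s hs

theorem BasedExact.exists_retraction {A B C : BasedModule Λ} {i : A →ₗ[Λ] B} {p : B →ₗ[Λ] C}
    (h : BasedExact Z i p) : ∃ r : B →ₗ[Λ] A, ∀ a, r (i a) = a := by
  obtain ⟨s, e, -, he, -⟩ := h.based
  refine ⟨(LinearMap.fst Λ A C).comp e.symm.toLinearMap, fun a => ?_⟩
  have h1 : e.symm (i a) = (a, 0) := by rw [LinearEquiv.symm_apply_eq, he, map_zero, add_zero]
  exact congrArg Prod.fst h1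

end Unions

/-! ### Pairs of a form and a based module, up to hyperbolic pairs. -/

section Pairs

variable {Λ : Type u} [Ring Λ] [StarRing Λ] [InvariantBasisNumber Λ]
variable {Z : AddSubgroup (RedK1 Λ)} {ε : ℤˣ}

/-- By reflexivity, a form on $X^*$ is represented by a map $X^*\to X$. This is used to correct a
complement of a Lagrangian. -/
theorem QGrp.exists_pairing {X : BasedModule Λ} (q : QGrp Λ ε (SDual Λ X)) :
    ∃ t : SDual Λ X →ₗ[Λ] X, QGrp.pairing ε LinearMap.id t = q := by
  obtain ⟨χ, rfl⟩ := QGrp.mk_surjective q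
  refine ⟨(unev X).comp ((ε : ℤ) • χ), ?_⟩
  have h : QGrp.mk ε χ = QGrp.pairing ε χ LinearMap.id := rfl
  rw [h]
  refine QGrp.pairing_star fun u w => ?_
  change u (unev X ((ε : ℤ) • χ w)) = _
  rw [apply_unev, SDual.zsmul_apply, star_zsmul]
  rfl

/-- A form together with a homomorphism from a based module to the underlying module. -/
structure QPair (Λ : Type u) [Ring Λ] [StarRing Λ] (ε : ℤˣ) : Type (u + 1) where
  form : QForm Λ ε
  V : BasedModule Λ
  j : V →ₗ[Λ] form.M

namespace QPair

abbrev sum (x y : QPair Λ ε) : QPair Λ ε := ⟨x.form.sum y.form, x.V.prod y.V, x.j.prodMap y.j⟩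

abbrev hyp (ε : ℤˣ) (P : BasedModule Λ) : QPair Λ ε :=
  ⟨QForm.hyp ε P, P, LinearMap.inl Λ P (SDual Λ P)⟩

end QPair

variable (Z) in
/-- An isometry which restricts to a simple isomorphism of the based modules. -/
structure PairIso (x y : QPair Λ ε) where
  f : Isometry Z x.form y.form
  eV : SEquiv Z x.V y.V
  comm : ∀ a, f.e (x.j a) = y.j (eV.e a)

namespace PairIso

variable {x y z x' y' : QPair Λ ε}

def refl (x : QPair Λ ε) : PairIso Z x x := ⟨.refl _, .refl _, fun _ => rfl⟩

def symm (f : PairIso Z x y) : PairIso Z y x := ⟨f.f.symm, f.eV.symm, fun a => by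
  change f.f.e.symm (y.j a) = x.j (f.eV.e.symm a)
  rw [LinearEquiv.symm_apply_eq, f.comm, LinearEquiv.apply_symm_apply]⟩

def trans (f : PairIso Z x y) (g : PairIso Z y z) : PairIso Z x z :=
  ⟨f.f.trans g.f, f.eV.trans g.eV, fun a => by
    change g.f.e (f.f.e (x.j a)) = z.j (g.eV.e (f.eV.e a))
    rw [f.comm, g.comm]⟩

def sum (f : PairIso Z x y) (g : PairIso Z x' y') : PairIso Z (x.sum x') (y.sum y') :=
  ⟨f.f.sum g.f, f.eV.prod g.eV, fun a => Prod.ext (f.comm a.1) (g.comm a.2)⟩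

def symmSum (x y : QPair Λ ε) : PairIso Z (x.sum y) (y.sum x) :=
  ⟨.comm _ _, .prodComm Z _ _, fun _ => rfl⟩

def assoc (x y z : QPair Λ ε) : PairIso Z ((x.sum y).sum z) (x.sum (y.sum z)) :=
  ⟨.assoc _ _ _, .prodAssoc Z _ _ _, fun _ => rfl⟩

def rightComm (x y z : QPair Λ ε) : PairIso Z ((x.sum y).sum z) ((x.sum z).sum y) :=
  (assoc x y z).trans (((refl x).sum (symmSum y z)).trans (assoc x z y).symm)

def sumComm (x y z w : QPair Λ ε) :
    PairIso Z ((x.sum y).sum (z.sum w)) ((x.sum z).sum (y.sum w)) :=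
  (assoc (x.sum y) z w).symm.trans (((rightComm x y z).sum (refl w)).trans (assoc (x.sum z) y w))

def hypProd (P R : BasedModule Λ) :
    PairIso Z ((QPair.hyp ε P).sum (QPair.hyp ε R)) (QPair.hyp ε (P.prod R)) where
  f :=
    let e := (SEquiv.prodProdProdComm Z P P.dual R R.dual).trans
      ((SEquiv.refl (P.prod R)).prod (SEquiv.dualProd Z P R).symm)
    ⟨e.e, e.simple, by
      refine Eq.trans ?_ (map_add (QGrp.mk ε)
        (QGrp.pullHom (LinearMap.fst Λ (P × SDual Λ P) (R × SDual Λ R)) (QForm.hypHom P))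
        (QGrp.pullHom (LinearMap.snd Λ (P × SDual Λ P) (R × SDual Λ R)) (QForm.hypHom R)))
      exact congrArg (QGrp.mk ε) (LinearMap.ext fun a => SDual.ext fun b => rfl)⟩
  eV := .refl _
  comm a := Prod.ext rfl (SDual.ext fun b => add_zero (0 : Λ))

end PairIso

variable (Z) in
/-- Isomorphism up to the addition of pairs `(H_ε(P), P)`. -/
def Near (x y : QPair Λ ε) : Prop :=
  ∃ P Q : BasedModule Λ, Nonempty (PairIso Z (x.sum (.hyp ε P)) (y.sum (.hyp ε Q)))

namespace Near

variable {x y z x' y' : QPair Λ ε}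

theorem of_iso (f : PairIso Z x y) : Near Z x y :=
  ⟨BasedModule.std Λ 0, BasedModule.std Λ 0, ⟨f.sum (.refl _)⟩⟩

theorem symm (h : Near Z x y) : Near Z y x := by
  obtain ⟨P, Q, ⟨f⟩⟩ := h
  exact ⟨Q, P, ⟨f.symm⟩⟩

theorem trans (h : Near Z x y) (h' : Near Z y z) : Near Z x z := by
  obtain ⟨P, Q, ⟨f⟩⟩ := h
  obtain ⟨R, S, ⟨g⟩⟩ := h'
  exact ⟨P.prod R, S.prod Q, ⟨((PairIso.refl x).sum (.symm (.hypProd P R))).trans <|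
    (PairIso.assoc _ _ _).symm.trans <| (f.sum (.refl _)).trans <| (PairIso.rightComm _ _ _).trans <|
    (g.sum (.refl _)).trans <| (PairIso.assoc _ _ _).trans ((PairIso.refl z).sum (.hypProd S Q))⟩⟩

theorem sum (h : Near Z x y) (h' : Near Z x' y') : Near Z (x.sum x') (y.sum y') := by
  obtain ⟨P, Q, ⟨f⟩⟩ := h
  obtain ⟨R, S, ⟨g⟩⟩ := h'
  exact ⟨P.prod R, Q.prod S, ⟨((PairIso.refl _).sum (.symm (.hypProd P R))).trans <|
    (PairIso.sumComm _ _ _ _).trans <| (f.sum g).trans <| (PairIso.sumComm _ _ _ _).trans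
    ((PairIso.refl _).sum (.hypProd Q S))⟩⟩

theorem sum_hyp (x : QPair Λ ε) (P : BasedModule Λ) : Near Z (x.sum (.hyp ε P)) x :=
  ⟨BasedModule.std Λ 0, P.prod (BasedModule.std Λ 0),
    ⟨(PairIso.assoc _ _ _).trans ((PairIso.refl x).sum (.hypProd _ _))⟩⟩

theorem sum_of_iso {P : BasedModule Λ} (f : PairIso Z y (.hyp ε P)) : Near Z (x.sum y) x :=
  (of_iso ((PairIso.refl x).sum f)).trans (sum_hyp x P)

end Near

variable (Z ε) in
/-- Pairs up to the addition of pairs `(H_ε(P), P)`. -/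
def PairClass : Type (u + 1) := Quot (Near Z (ε := ε))

variable (Z) in
def PairClass.mk (x : QPair Λ ε) : PairClass Z ε := Quot.mk _ x

theorem PairClass.eq_iff {x y : QPair Λ ε} : PairClass.mk Z x = PairClass.mk Z y ↔ Near Z x y :=
  Equivalence.quot_mk_eq_iff ⟨fun x => .of_iso (.refl x), .symm, .trans⟩ x y

/-- A simple form with a simple Lagrangian is hyperbolic. -/
theorem IsSimpleLagrangian.exists_pairIso {v : QForm Λ ε} {L : BasedModule Λ} {j : L →ₗ[Λ] v.M}
    (h : IsSimpleLagrangian Z v L j) :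
    Nonempty (PairIso Z (QPair.hyp ε L) ⟨v, L, j⟩) := by
  obtain ⟨s, -, hs, -, -⟩ := h.based.based
  -- The quadratic form takes the value $q(s)+[t]$ on $s+jt$, since `j` is isotropic and `s` is a
  -- section of $j^*\varphi$. This `t` makes the complement isotropic.
  obtain ⟨t, ht⟩ := QGrp.exists_pairing (-QGrp.pull s v.q)
  have hφ : ∀ a b, v.phi (j a) (j b) = 0 := by
    intro a b
    have h1 := QGrp.symm_pull j v.q a b
    rw [h.isotropic, map_zero] at h1
    exact h1.symm
  let s' := s + j.comp t
  have hs' : ∀ c, v.perpMap j (s' c) = c := by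
    intro c
    refine SDual.ext fun x => ?_
    change v.phi (s c + j (t c)) (j x) = c x
    rw [map_add, SDual.add_apply, hφ, add_zero]
    exact congrArg (fun t : SDual Λ L => t x) (hs c)
  have hq : QGrp.pull s' v.q = 0 := by
    rw [QGrp.pull_add, ← QGrp.pull_pull, h.isotropic, map_zero, add_zero]
    have h1 : QGrp.pairing ε ((QGrp.symm v.q).comp s) (j.comp t) =
        QGrp.pairing ε LinearMap.id t := QGrp.pairing_ext fun c c' =>
      congrArg (fun r : SDual Λ L => r (t c')) (hs c)
    rw [h1, ht, add_neg_cancel]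
  obtain ⟨e, he⟩ := h.based.exists_equiv s' hs'
  refine ⟨⟨⟨e.e, e.simple, ?_⟩, .refl L, fun a => ?_⟩⟩
  · have h1 : e.e.toLinearMap = j.comp (LinearMap.fst Λ L (SDual Λ L)) +
        s'.comp (LinearMap.snd Λ L (SDual Λ L)) := LinearMap.ext fun x => he x.1 x.2
    rw [h1, QGrp.pull_add, ← QGrp.pull_pull, h.isotropic, ← QGrp.pull_pull _ s', hq, map_zero,
      map_zero, zero_add, zero_add, QForm.hyp_q]
    refine QGrp.pairing_star fun x y => ?_
    change v.phi (j x.1) (s' y.2) = (ε : ℤ) • star (y.2 x.1)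
    rw [QForm.phi_symm]
    exact congrArg (fun r : SDual Λ L => (ε : ℤ) • star (r x.1)) (hs' y.2)
  · change e.e (a, 0) = j a
    rw [he, map_zero, add_zero]

theorem IsSimpleLagrangian.map {v w : QForm Λ ε} {L : BasedModule Λ} {j : L →ₗ[Λ] v.M}
    (h : IsSimpleLagrangian Z v L j) (T : Isometry Z v w) :
    IsSimpleLagrangian Z w L (T.e.toLinearMap.comp j) := by
  have hφ : ∀ x y, w.phi (T.e x) (T.e y) = v.phi x y := by
    intro x y
    have h1 := QGrp.symm_pull T.e.toLinearMap w.q x y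
    rw [T.isom] at h1
    exact h1.symm
  have hp : ∀ x, w.perpMap (T.e.toLinearMap.comp j) (T.e x) = v.perpMap j x := fun x =>
    SDual.ext fun y => hφ x (j y)
  have hp' : ∀ x, w.perpMap (T.e.toLinearMap.comp j) x = v.perpMap j (T.e.symm x) := by
    intro x
    rw [← hp, LinearEquiv.apply_symm_apply]
  have hr : ∀ x, x ∈ LinearMap.range (T.e.toLinearMap.comp j) ↔
      w.perpMap (T.e.toLinearMap.comp j) x = 0 := by
    intro x
    rw [hp', ← h.perp]
    constructor
    · rintro ⟨a, rfl⟩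
      exact ⟨a, (T.e.symm_apply_apply _).symm⟩
    · rintro ⟨a, ha⟩
      refine ⟨a, ?_⟩
      change T.e (j a) = x
      rw [ha, LinearEquiv.apply_symm_apply]
  obtain ⟨r, hr'⟩ := h.summand
  obtain ⟨s, e, hs, he, hes⟩ := h.based.based
  refine ⟨⟨r.comp T.e.symm.toLinearMap, fun x => ?_⟩, hr, ?_, ⟨?_, fun x => (hr x).symm,
    T.e.toLinearMap.comp s, e.trans T.e, fun c => (hp _).trans (hs c), fun a c => ?_,
    hes.trans T.simple⟩⟩
  · change r (T.e.symm (T.e (j x))) = x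
    rw [LinearEquiv.symm_apply_apply, hr']
  · rw [← QGrp.pull_pull, T.isom, h.isotropic]
  · exact T.e.injective.comp h.based.inj
  · change T.e (e (a, c)) = T.e (j a) + T.e (s c)
    rw [he, map_add]

abbrev QuasiFormation.pair (x : QuasiFormation Z ε) : QPair Λ ε := ⟨x.form, x.V, x.jV⟩

/-- Two relations need an argument. In `stab`, exchanging the summands identifies
$(H_\epsilon(P);P^*)$ with the hyperbolic pair of $P^*$. In `shift`, the additional summand is
$(M,\psi;L)$, which is hyperbolic because $L$ is a simple Lagrangian. -/
theorem near_of_rel {x y : QuasiFormation Z ε} (h : QuasiFormation.Rel x y) :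
    Near Z x.pair y.pair := by
  induction h with
  | iso f => exact .of_iso ⟨f.f, ⟨f.eV, f.eV_simple⟩, f.eV_comm⟩
  | stab x P =>
    let e := (SEquiv.prodComm Z P P.dual).trans ((SEquiv.refl P.dual).prod
        ((SEquiv.sign Z ε P).trans (SEquiv.ev Z P)))
    let T : Isometry Z (QForm.hyp ε P) (QForm.hyp ε P.dual) := ⟨e.e, e.simple, by
      rw [QForm.hyp_q, QForm.hyp_q, QGrp.pull_pairing]
      refine QGrp.pairing_star fun x y => ?_
      change star (y.2 ((ε : ℤ) • x.1)) = (ε : ℤ) • star (y.2 x.1)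
      rw [map_zsmul, star_zsmul]⟩
    have f : PairIso Z (QuasiFormation.trivial Z ε P).pair (QPair.hyp ε P.dual) :=
      ⟨T, .refl P.dual, fun a => by
        refine Prod.ext rfl (SDual.ext fun y => ?_)
        change star (y ((ε : ℤ) • (0 : P))) = 0
        simp⟩
    have h : Near Z (x.pair.sum (QuasiFormation.trivial Z ε P).pair) x.pair := Near.sum_of_iso f
    exact h
  | shift x hK =>
    obtain ⟨f⟩ := x.lagrangian.exists_pairIso
    have h : Near Z (QPair.sum ⟨x.form, x.L, x.jL⟩ x.pair) x.pair :=
      (Near.of_iso (.symmSum _ _)).trans (Near.sum_of_iso f.symm)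
    exact h
  | refl x => exact .of_iso (.refl _)
  | symm _ ih => exact ih.symm
  | trans _ _ ih ih' => exact ih.trans ih'
  | sum _ _ ih ih' => exact ih.sum ih'

/-- The class of the pair `(M, ψ; V)` of a quasi-formation `(M, ψ; L, V)`. -/
def LMonoid.pairClass (ξ : LMonoid Z ε) : PairClass Z ε :=
  Quot.lift (fun x => PairClass.mk Z x.pair) (fun _ _ h => Quot.sound (near_of_rel h)) ξ

/-- The shift relation with $K=L=P$ absorbs $(H_\epsilon(P);P,P)$ into a trivial formation, and
trivial formations represent zero. -/
theorem LMonoid.mk_self_hyp (P : BasedModule Λ) :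
    LMonoid.mk (QuasiFormation.ofLagrangians (QForm.hyp ε P) (QForm.hyp_isSimpleForm P)
      (IsSimpleLagrangian.hyp (Z := Z) P) (IsSimpleLagrangian.hyp P)) = 0 := by
  have h0 : LMonoid.mk (QuasiFormation.trivial Z ε P) = 0 := by
    rw [← zero_add (LMonoid.mk (QuasiFormation.trivial Z ε P))]
    exact LMonoid.sound (.stab _ P)
  have h1 : LMonoid.mk (QuasiFormation.ofLagrangians (QForm.hyp ε P) (QForm.hyp_isSimpleForm P)
      (IsSimpleLagrangian.hyp (Z := Z) P) (IsSimpleLagrangian.hyp P)) +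
      LMonoid.mk (QuasiFormation.trivial Z ε P) = LMonoid.mk (QuasiFormation.trivial Z ε P) :=
    LMonoid.sound (.shift (QuasiFormation.trivial Z ε P) (IsSimpleLagrangian.hyp P))
  rwa [h0, add_zero] at h1

/-- The pair determines the quasi-formation up to the choice of its Lagrangian, and by the shift
relation changing the Lagrangian changes the class by that of a simple formation. -/
theorem LMonoid.pairClass_eq_iff {ξ ξ' : LMonoid Z ε} :
    ξ.pairClass = ξ'.pairClass ↔ ∃ z ∈ LMonoid.simpleL Z ε, ξ' = ξ + z := by
  constructor
  · intro h
    induction ξ using Quot.ind with | _ x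
    induction ξ' using Quot.ind with | _ x'
    obtain ⟨P, Q, ⟨T⟩⟩ := PairClass.eq_iff.1 h.symm
    let H := fun P : BasedModule Λ => QuasiFormation.ofLagrangians (QForm.hyp ε P)
      (QForm.hyp_isSimpleForm P) (IsSimpleLagrangian.hyp (Z := Z) P) (IsSimpleLagrangian.hyp P)
    let X := x'.sum (H P)
    let Y := x.sum (H Q)
    have hX : LMonoid.mk X = LMonoid.mk x' := by
      rw [← LMonoid.mk_add, LMonoid.mk_self_hyp, add_zero]
    have hY : LMonoid.mk Y = LMonoid.mk x := by
      rw [← LMonoid.mk_add, LMonoid.mk_self_hyp, add_zero]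
    -- The isometry `T` of pairs carries the Lagrangian of `X` to a Lagrangian `J` of `Y`. So `X` is
    -- `Y` with its Lagrangian replaced by `J`, and the shift relation exhibits the difference of
    -- the classes as the formation of `J` and the Lagrangian of `Y`.
    have hJ : IsSimpleLagrangian Z Y.form X.L (T.f.e.toLinearMap.comp X.jL) := X.lagrangian.map T.f
    have h1 : LMonoid.mk X = LMonoid.mk (Y.changeLagrangian hJ) :=
      LMonoid.sound (.iso ⟨T.f, LinearEquiv.refl Λ X.L, .refl _, fun _ => rfl, T.eV.e, T.eV.simple,
        T.comm⟩)
    have h2 := LMonoid.sound (.shift Y hJ)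
    refine ⟨LMonoid.mk (QuasiFormation.ofLagrangians Y.form Y.simple hJ Y.lagrangian),
      ⟨_, Y.lagrangian, rfl⟩, ?_⟩
    change LMonoid.mk x' = LMonoid.mk x + _
    rw [← hX, h1, ← h2, ← LMonoid.mk_add, hY, add_comm]
  · rintro ⟨z, ⟨y, hy, rfl⟩, rfl⟩
    induction ξ using Quot.ind with | _ x
    obtain ⟨f⟩ := hy.exists_pairIso
    exact PairClass.eq_iff.2 (Near.sum_of_iso f.symm).symm

end Pairs

/-! ### Unions as pairs, and their isometries. -/

section UnionPairs

variable {Λ : Type u} [Ring Λ] [StarRing Λ] [InvariantBasisNumber Λ]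
variable {Z : AddSubgroup (RedK1 Λ)} {ε : ℤˣ}

theorem Isometry.phi_apply {v w : QForm Λ ε} (T : Isometry Z v w) (x y : v.M) :
    w.phi (T.e x) (T.e y) = v.phi x y := by
  have h1 := QGrp.symm_pull T.e.toLinearMap w.q x y
  rw [T.isom] at h1
  exact h1.symm

/-- The union with its first summand. -/
abbrev unionPair (v v' : QForm Λ ε) (a : v.M →ₗ[Λ] v'.M) (s : QGrp Λ ε (SDual Λ v'.M)) :
    QPair Λ ε := ⟨unionOf v v' a s, v.M, LinearMap.inl Λ v.M (SDual Λ v'.M)⟩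

theorem pull_unionOf {v v' : QForm Λ ε} (a : v.M →ₗ[Λ] v'.M) (s : QGrp Λ ε (SDual Λ v'.M))
    {X : Type u} [AddCommGroup X] [Module Λ X] (T : X →ₗ[Λ] (v.M × SDual Λ v'.M))
    (p : X →ₗ[Λ] v.M) (r : X →ₗ[Λ] SDual Λ v'.M) (hp : ∀ x, (T x).1 = p x)
    (hr : ∀ x, (T x).2 = r x) : QGrp.pull T (unionOf v v' a s).q =
      QGrp.pull p v.q + QGrp.pairing ε r (a.comp p) - QGrp.pull r s := by
  have h1 : (LinearMap.fst Λ v.M (SDual Λ v'.M)).comp T = p := LinearMap.ext hp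
  have h2 : (LinearMap.snd Λ v.M (SDual Λ v'.M)).comp T = r := LinearMap.ext hr
  change QGrp.pull T (QGrp.pull (LinearMap.fst Λ v.M (SDual Λ v'.M)) v.q +
    QGrp.pairing ε (LinearMap.snd Λ v.M (SDual Λ v'.M))
      (a.comp (LinearMap.fst Λ v.M (SDual Λ v'.M))) -
    QGrp.pull (LinearMap.snd Λ v.M (SDual Λ v'.M)) s) = _
  rw [map_sub, map_add, QGrp.pull_pull, QGrp.pull_pull, QGrp.pull_pairing, LinearMap.comp_assoc,
    h1, h2]

section Stab

/-- The union along `f ⊕ ∂ id_Q`. -/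
theorem nonempty_unionPair_stab {v v' : QForm Λ ε} (a : v.M →ₗ[Λ] v'.M)
    (s : QGrp Λ ε (SDual Λ v'.M)) (Q : BasedModule Λ) :
    Nonempty (PairIso Z ((unionPair v v' a s).sum (QPair.hyp ε Q))
      (unionPair (v.sum (QForm.zeroForm ε Q)) (v'.sum (QForm.zeroForm ε Q))
        (a.prodMap LinearMap.id) (QGrp.pull (dualMap (LinearMap.inl Λ v'.M Q)) s))) := by
  let e : SEquiv Z ((v.M.prod v'.M.dual).prod (Q.prod Q.dual))
      ((v.M.prod Q).prod (v'.M.prod Q).dual) :=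
    (SEquiv.prodProdProdComm Z v.M v'.M.dual Q Q.dual).trans
      ((SEquiv.refl (v.M.prod Q)).prod (SEquiv.dualProd Z v'.M Q).symm)
  let X := (v.M × SDual Λ v'.M) × (Q × SDual Λ Q)
  let p1 : X →ₗ[Λ] (v.M × SDual Λ v'.M) := LinearMap.fst Λ _ _
  let p2 : X →ₗ[Λ] (Q × SDual Λ Q) := LinearMap.snd Λ _ _
  let x : X →ₗ[Λ] v.M := (LinearMap.fst Λ _ _).comp p1
  let u : X →ₗ[Λ] SDual Λ v'.M := (LinearMap.snd Λ _ _).comp p1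
  let y : X →ₗ[Λ] Q := (LinearMap.fst Λ _ _).comp p2
  let w : X →ₗ[Λ] SDual Λ Q := (LinearMap.snd Λ _ _).comp p2
  refine ⟨⟨⟨e.e, e.simple, ?_⟩, .refl _, fun b => Prod.ext rfl (SDual.ext fun c => add_zero (0 : Λ))⟩⟩
  let r : X →ₗ[Λ] SDual Λ (v'.M × Q) :=
    (QuadL.dualProd (Λ := Λ) v'.M Q).symm.toLinearMap.comp (u.prod w)
  have h1 := pull_unionOf (v := v.sum (QForm.zeroForm ε Q)) (v' := v'.sum (QForm.zeroForm ε Q))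
    (a.prodMap LinearMap.id) (QGrp.pull (dualMap (LinearMap.inl Λ v'.M Q)) s) e.e.toLinearMap
    (x.prod y) r (fun _ => rfl) (fun _ => rfl)
  refine h1.trans ?_
  have h2 : QGrp.pull (x.prod y) (v.sum (QForm.zeroForm ε Q)).q = QGrp.pull x v.q := by
    change QGrp.pull (x.prod y) (QGrp.pull (LinearMap.fst Λ v.M Q) v.q +
      QGrp.pull (LinearMap.snd Λ v.M Q) 0) = _
    rw [map_zero, add_zero, QGrp.pull_pull]
    rfl
  have h3 : QGrp.pairing ε r ((a.prodMap LinearMap.id).comp (x.prod y)) =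
      QGrp.pairing ε u (a.comp x) + QGrp.pairing ε w y := by
    rw [QGrp.pairing, QGrp.pairing, QGrp.pairing, ← map_add]
    exact congrArg (QGrp.mk ε) (LinearMap.ext fun b => SDual.ext fun c => rfl)
  have h4 : (dualMap (LinearMap.inl Λ v'.M Q)).comp r = u :=
    LinearMap.ext fun b => SDual.ext fun c => by
      change (u b) c + (w b) 0 = (u b) c
      rw [map_zero, add_zero]
  have h5 : QGrp.pull p1 (unionOf v v' a s).q = QGrp.pull x v.q + QGrp.pairing ε u (a.comp x) -
      QGrp.pull u s := pull_unionOf a s p1 x u (fun _ => rfl) (fun _ => rfl)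
  have h6 : QGrp.pull p2 (QForm.hyp ε Q).q = QGrp.pairing ε w y := rfl
  refine Eq.trans ?_ (congrArg₂ (· + ·) h5 h6).symm
  rw [h2, h3, QGrp.pull_pull, h4]
  abel

end Stab

variable [hZ : Fact (StarInvariant Z)]

/-- Isometries carry unions to unions. -/
theorem nonempty_unionPair_conj {v v' w w' : QForm Λ ε} (a : v.M →ₗ[Λ] v'.M)
    (s : QGrp Λ ε (SDual Λ v'.M)) (k : Isometry Z v w) (l : Isometry Z v' w') :
    Nonempty (PairIso Z (unionPair v v' a s)
      (unionPair w w' (l.e.toLinearMap.comp (a.comp k.e.symm.toLinearMap))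
        (QGrp.pull (dualMap l.e.toLinearMap) s))) := by
  let k' : SEquiv Z v.M w.M := ⟨k.e, k.simple⟩
  let l' : SEquiv Z v'.M w'.M := ⟨l.e, l.simple⟩
  let e : SEquiv Z (v.M.prod v'.M.dual) (w.M.prod w'.M.dual) := k'.prod l'.symm.dual
  let p := LinearMap.fst Λ v.M (SDual Λ v'.M)
  let r := LinearMap.snd Λ v.M (SDual Λ v'.M)
  refine ⟨⟨⟨e.e, e.simple, ?_⟩, k', fun b => Prod.ext rfl (SDual.ext fun c => rfl)⟩⟩
  refine (pull_unionOf _ _ e.e.toLinearMap (k.e.toLinearMap.comp p)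
    ((dualMap l.e.symm.toLinearMap).comp r) (fun _ => rfl) (fun _ => rfl)).trans ?_
  have h1 : QGrp.pull (k.e.toLinearMap.comp p) w.q = QGrp.pull p v.q := by
    rw [← QGrp.pull_pull, k.isom]
  have h2 : QGrp.pairing ε ((dualMap l.e.symm.toLinearMap).comp r)
      ((l.e.toLinearMap.comp (a.comp k.e.symm.toLinearMap)).comp (k.e.toLinearMap.comp p)) =
      QGrp.pairing ε r (a.comp p) := QGrp.pairing_ext fun b c => by
    change b.2 (l.e.symm (l.e (a (k.e.symm (k.e c.1))))) = b.2 (a c.1)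
    rw [LinearEquiv.symm_apply_apply, LinearEquiv.symm_apply_apply]
  have h3 : (dualMap l.e.toLinearMap).comp ((dualMap l.e.symm.toLinearMap).comp r) = r :=
    LinearMap.ext fun b => SDual.ext fun c => by
      change b.2 (l.e.symm (l.e c)) = b.2 c
      rw [LinearEquiv.symm_apply_apply]
  rw [h1, h2, QGrp.pull_pull, h3]

/-- Homotopies induce isometries of unions. -/
theorem nonempty_unionPair_homotopy {v v' : QForm Λ ε} {a a' : v.M →ₗ[Λ] v'.M}
    {s s' : QGrp Λ ε (SDual Λ v'.M)} (t : SDual Λ v'.M →ₗ[Λ] v.M)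
    (ha : ∀ u x, u (a' x) = u (a x) + v.phi (t u) x)
    (hs : s' - s = -QGrp.pairing ε LinearMap.id (a'.comp t) + QGrp.pull t v.q) :
    Nonempty (PairIso Z (unionPair v v' a s) (unionPair v v' a' s')) := by
  -- A homotopy becomes the shear $(x,u)\mapsto(x-t\,u,u)$, which fixes the first summand.
  let e : SEquiv Z (v.M.prod v'.M.dual) (v.M.prod v'.M.dual) := SEquiv.shearLeft Z (-t)
  let p := LinearMap.fst Λ v.M (SDual Λ v'.M)
  let r := LinearMap.snd Λ v.M (SDual Λ v'.M)
  refine ⟨⟨⟨e.e, e.simple, ?_⟩, .refl v.M, fun b => ?_⟩⟩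
  · have h0 := pull_unionOf a' s' e.e.toLinearMap (p - t.comp r) r
      (fun x => by
        change x.1 + (-t) x.2 = x.1 - t x.2
        rw [LinearMap.neg_apply, sub_eq_add_neg]) (fun _ => rfl)
    refine h0.trans ?_
    have h1 : QGrp.pairing ε r (a.comp p) = QGrp.pairing ε r (a'.comp p) -
        QGrp.pairing ε ((QGrp.symm v.q).comp (t.comp r)) p := by
      rw [QGrp.pairing, QGrp.pairing, QGrp.pairing, ← map_sub]
      refine congrArg (QGrp.mk ε) (LinearMap.ext fun b => SDual.ext fun c => ?_)
      change b.2 (a c.1) = b.2 (a' c.1) - v.phi (t b.2) c.1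
      rw [ha, add_sub_cancel_right]
    have h2 : QGrp.pull r s = QGrp.pull r s' + QGrp.pairing ε r (a'.comp (t.comp r)) -
        QGrp.pull (t.comp r) v.q := by
      have h3 : s = s' + QGrp.pairing ε LinearMap.id (a'.comp t) - QGrp.pull t v.q := by
        have h4 := congrArg (fun z => s' - z) hs
        rw [sub_sub_cancel] at h4
        rw [h4]; abel
      conv_lhs => rw [h3]
      rw [map_sub, map_add, QGrp.pull_pull]
      rfl
    change _ = QGrp.pull p v.q + QGrp.pairing ε r (a.comp p) - QGrp.pull r s
    rw [h1, h2, QGrp.pull_sub, LinearMap.comp_sub, QGrp.pairing_sub_right,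
      QGrp.pairing_symm_comm v.q p]
    abel
  · change (b + (-t) 0, (0 : SDual Λ v'.M)) = (b, 0)
    rw [map_zero, add_zero]

section Perp

variable {v v' : QForm Λ ε} {P P' : BasedModule Λ}
  (f : SplitIso Z (SplitIso.bd v P) (SplitIso.bd v' P'))

/-- The inclusion of the annihilator of `V` in the union. -/
def SplitIso.perp : v'.M →ₗ[Λ] (v.M × SDual Λ v'.M) := f.backForm.prod (-v'.phi)

/-- Evaluation against `perp` is the projection to $V'^*$, so the inclusion of $V'^*$ is a section
of the dual sequence and `perp` is the whole annihilator of $V$. The terms of the union cancel by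
the first two equations of the isomorphism, read on the corner. -/
theorem SplitIso.phi_perp (x : v.M × SDual Λ v'.M) (w : v'.M) :
    (unionOf v v' f.corner f.cornerQ).phi x (f.perp w) = x.2 w := by
  rw [phi_unionOf]
  change v.phi x.1 (f.backForm w) + (x.2 (f.corner (f.backForm w)) +
    (ε : ℤ) • star ((-v'.phi) w (f.corner x.1))) - QGrp.symm f.cornerQ x.2 ((-v'.phi) w) = _
  rw [LinearMap.neg_apply, map_neg, f.symm_cornerQ_phi, SDual.neg_apply, f.phi_corner, star_neg,
    smul_neg, ← QForm.phi_symm]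
  abel

theorem SplitIso.phi_perp_inl (w : v'.M) (x : v.M) :
    (unionOf v v' f.corner f.cornerQ).phi (f.perp w) (x, 0) = 0 := by
  have h := f.phi_perp (x, 0) w
  rw [QForm.phi_symm, h]
  change (ε : ℤ) • star (0 : Λ) = 0
  rw [star_zero, smul_zero]

/-- The third equation, read on the corner. It shows that the union contains $-v'$ as the
annihilator of $v$. -/
theorem SplitIso.pull_perp : QGrp.pull f.perp (unionOf v v' f.corner f.cornerQ).q = -v'.q := by
  refine (pull_unionOf _ _ f.perp f.backForm (-v'.phi) (fun _ => rfl) (fun _ => rfl)).trans ?_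
  have h : QGrp.pairing ε v'.phi (f.corner.comp f.backForm) =
      QGrp.pairing ε ((QGrp.symm v.q).comp f.backForm) f.backForm :=
    QGrp.pairing_ext fun x y => f.phi_corner x (f.backForm y)
  rw [QGrp.pairing_neg_left, h, QGrp.pairing_symm_self, QGrp.pull_neg, f.pull_phi_cornerQ]
  abel

theorem SplitIso.basedExact_perp (hU : (unionOf v v' f.corner f.cornerQ).IsSimpleForm Z) :
    BasedExact Z f.perp ((unionOf v v' f.corner f.cornerQ).perpMap (L := v.M)
      (LinearMap.inl Λ v.M (SDual Λ v'.M))) :=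
  QuadL.basedExact_perp hU _ f.perp (LinearMap.inr Λ v.M (SDual Λ v'.M))
    (fun w x => f.phi_perp_inl w x) (fun u w => f.phi_perp (0, u) w) (.refl _)
    (fun x u => by
      change (x, u) = (x, (0 : SDual Λ v'.M)) + ((0 : v.M), u)
      simp)

end Perp

theorem unionOf_isSimpleForm {v v' : QForm Λ ε}
    (f : StableIso Z (SplitFormation.boundary v) (SplitFormation.boundary v')) :
    (unionOf v v' f.f.corner f.f.cornerQ).IsSimpleForm Z := by
  rw [← unionForm_eq]
  exact unionForm_isSimpleForm f

/-- Isomorphic unions come from equivalent stable isomorphisms. -/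
theorem homotopic_conj_of_pairIso {v v' w w' : QForm Λ ε}
    (f : StableIso Z (SplitFormation.boundary v) (SplitFormation.boundary v'))
    (f' : StableIso Z (SplitFormation.boundary w) (SplitFormation.boundary w'))
    (T : PairIso Z (unionPair v v' f.f.corner f.f.cornerQ)
      (unionPair w w' f'.f.corner f'.f.cornerQ)) :
    ∃ (k : Isometry Z v w) (l : Isometry Z v' w'),
      f.Homotopic (f'.conjIsometry k.symm l.symm) := by
  have hUf := unionOf_isSimpleForm f
  have hUf' := unionOf_isSimpleForm f'
  let U : SEquiv Z (v.M.prod v'.M.dual) (w.M.prod w'.M.dual) := ⟨T.f.e, T.f.simple⟩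
  have hk1 : ∀ x, T.f.e (x, 0) = (T.eV.e x, 0) := T.comm
  let k : Isometry Z v w := ⟨T.eV.e, T.eV.simple, by
    have h1 := pull_unionOf f.f.corner f.f.cornerQ (LinearMap.inl Λ v.M (SDual Λ v'.M))
      LinearMap.id 0 (fun _ => rfl) (fun _ => rfl)
    rw [← T.f.isom, QGrp.pull_pull] at h1
    rw [pull_unionOf f'.f.corner f'.f.cornerQ
      (T.f.e.toLinearMap.comp (LinearMap.inl Λ v.M (SDual Λ v'.M))) T.eV.e.toLinearMap 0
      (fun x => congrArg Prod.fst (hk1 x)) (fun x => congrArg Prod.snd (hk1 x))] at h1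
    simpa [QGrp.pairing_zero_left, QGrp.pull_zero, QGrp.pull_id] using h1⟩
  -- An isometry that preserves the first summands also preserves their annihilators, and it is
  -- simple on them because the sequences are based. The forms induced there are $-v'$ and $-w'$, so
  -- this yields the isometry `l`.
  obtain ⟨G, hG⟩ := BasedExact.exists_map (f.f.basedExact_perp hUf) (f'.f.basedExact_perp hUf') U
    T.eV.symm.dual (fun x => SDual.ext fun y => by
      change (unionOf w w' f'.f.corner f'.f.cornerQ).phi (T.f.e x) (y, 0) =
        (unionOf v v' f.f.corner f.f.cornerQ).phi x (T.eV.e.symm y, 0)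
      rw [← T.f.phi_apply, hk1, LinearEquiv.apply_symm_apply])
  have hG' : ∀ a, T.f.e (f.f.perp a) = f'.f.perp (G.e a) := hG
  let l : Isometry Z v' w' := ⟨G.e, G.simple, by
    have h1 := f.f.pull_perp
    rw [← T.f.isom, QGrp.pull_pull] at h1
    have h2 : T.f.e.toLinearMap.comp f.f.perp = f'.f.perp.comp G.e.toLinearMap :=
      LinearMap.ext hG'
    rw [h2, ← QGrp.pull_pull, f'.f.pull_perp, map_neg] at h1
    exact neg_injective h1⟩
  -- Relative to `k` and `l` the isometry of unions has one further entry, this `t`. On $V'^*$ it is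
  -- $u\mapsto(k\,t\,u,\,l^{-*}u)$, where pairing with `perp` gives the second component. Comparing
  -- the forms then shows that $-t$ is a homotopy.
  let t : SDual Λ v'.M →ₗ[Λ] v.M := T.eV.e.symm.toLinearMap.comp
    ((LinearMap.fst Λ w.M (SDual Λ w'.M)).comp (T.f.e.toLinearMap.comp
      (LinearMap.inr Λ v.M (SDual Λ v'.M))))
  have ht : ∀ u, (T.f.e (0, u)).1 = T.eV.e (t u) := fun u =>
    (LinearEquiv.apply_symm_apply T.eV.e _).symm
  have hu : ∀ u, (T.f.e (0, u)).2 = dualMap G.e.symm.toLinearMap u := by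
    intro u
    refine SDual.ext fun z => ?_
    rw [← f'.f.phi_perp]
    obtain ⟨z, rfl⟩ := G.e.surjective z
    rw [← hG', T.f.phi_apply, f.f.phi_perp]
    change u z = u (G.e.symm (G.e z))
    rw [LinearEquiv.symm_apply_apply]
  refine ⟨k, l, StableIso.homotopic_of_corner _ _ (-t) (fun u x => ?_) ?_⟩
  · have h1 := T.f.phi_apply (0, u) (x, 0)
    rw [phi_unionOf, phi_unionOf, hk1, ht, hu] at h1
    change w.phi (k.e (t u)) (k.e x) + (u (G.e.symm (f'.f.corner (T.eV.e x))) +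
      (ε : ℤ) • star ((0 : SDual Λ w'.M) _)) - QGrp.symm f'.f.cornerQ _ 0 =
      v.phi 0 x + (u (f.f.corner x) + (ε : ℤ) • star ((0 : SDual Λ v'.M) _)) -
        QGrp.symm f.f.cornerQ u 0 at h1
    rw [k.phi_apply, map_zero (QGrp.symm f'.f.cornerQ _), map_zero (QGrp.symm f.f.cornerQ u),
      map_zero v.phi, sub_zero, sub_zero, SDual.zero_apply, SDual.zero_apply, SDual.zero_apply,
      star_zero, smul_zero, add_zero, add_zero, zero_add] at h1
    change u (G.e.symm (f'.f.corner (T.eV.e x))) = u (f.f.corner x) + v.phi (-t u) x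
    rw [← h1, map_neg, SDual.neg_apply]
    abel
  · have h1 := pull_unionOf f.f.corner f.f.cornerQ (LinearMap.inr Λ v.M (SDual Λ v'.M)) 0
      LinearMap.id (fun _ => rfl) (fun _ => rfl)
    rw [← T.f.isom, QGrp.pull_pull] at h1
    rw [pull_unionOf f'.f.corner f'.f.cornerQ
      (T.f.e.toLinearMap.comp (LinearMap.inr Λ v.M (SDual Λ v'.M)))
      (T.eV.e.toLinearMap.comp t) (dualMap G.e.symm.toLinearMap) ht hu, QGrp.pull_zero,
      LinearMap.comp_zero, QGrp.pairing_zero_right, QGrp.pull_id, ← QGrp.pull_pull] at h1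
    have h2 : QGrp.pull T.eV.e.toLinearMap w.q = v.q := k.isom
    have h3 : (f'.conjIsometry k.symm l.symm).f.cornerQ =
        QGrp.pull (dualMap G.e.symm.toLinearMap) f'.f.cornerQ :=
      StableIso.cornerQ_conjIsometry f' k.symm l.symm
    have h4 : QGrp.pairing ε LinearMap.id ((f'.conjIsometry k.symm l.symm).f.corner.comp (-t)) =
        -QGrp.pairing ε (dualMap G.e.symm.toLinearMap)
          (f'.f.corner.comp (T.eV.e.toLinearMap.comp t)) := by
      rw [LinearMap.comp_neg, QGrp.pairing_neg_right]
      exact congrArg Neg.neg (QGrp.pairing_ext fun _ _ => rfl)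
    rw [h2] at h1
    rw [h3, h4, QGrp.pull_neg, neg_neg]
    rw [zero_add, zero_sub] at h1
    refine (congrArg (fun z => QGrp.pull (dualMap G.e.symm.toLinearMap) f'.f.cornerQ - z)
      (neg_eq_iff_eq_neg.1 h1.symm)).trans ?_
    abel

end UnionPairs

/-! ### The union as a complete invariant of stable boundary isomorphisms. -/

section BoundaryClasses

variable {Λ : Type u} [Ring Λ] [StarRing Λ] [InvariantBasisNumber Λ]
variable {Z : AddSubgroup (RedK1 Λ)} {ε : ℤˣ}

/-- The `s`-basis of `Λ^k` carried over from a based module. -/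
def SBasis.ofEquiv {k : ℕ} (M : BasedModule Λ) (e : M ≃ₗ[Λ] (Fin k → Λ)) : SBasis Λ k where
  m := M.m
  n := M.n
  sb := (e.symm.prodCongr (LinearEquiv.refl Λ (Fin M.m → Λ))).trans M.sb

theorem SBasis.isSimple_ofEquiv {k : ℕ} (M : BasedModule Λ) (e : M ≃ₗ[Λ] (Fin k → Λ)) :
    IsSimple Z (M := M) (N := (SBasis.ofEquiv M e).mod) e :=
  .of_eq_zero (torsion_perm (M := M) (N := (SBasis.ofEquiv M e).mod) e (Equiv.refl _)
    (Equiv.refl _) fun x w => by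
      change M.sb (e.symm (e x), w) = M.sb (x, w)
      rw [LinearEquiv.symm_apply_apply])

theorem SEquiv.fin_eq {k l : ℕ} {B : SBasis Λ k} {D : SBasis Λ l} (e : SEquiv Z B.mod D.mod) :
    k = l :=
  eq_of_fin_equiv Λ e.e

variable (Z) in
/-- Simple isomorphisms of based modules preserve hyperbolic pairs. -/
theorem QPair.nonempty_hyp [hZ : Fact (StarInvariant Z)] {P Q : BasedModule Λ}
    (e : SEquiv Z P Q) : Nonempty (PairIso Z (QPair.hyp ε P) (QPair.hyp ε Q)) := by
  let E : SEquiv Z (P.prod P.dual) (Q.prod Q.dual) := e.prod e.symm.dual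
  refine ⟨⟨⟨E.e, E.simple, ?_⟩, e, fun a => Prod.ext rfl (SDual.ext fun b => rfl)⟩⟩
  rw [QForm.hyp_q, QForm.hyp_q, QGrp.pull_pairing]
  refine QGrp.pairing_ext fun x y => ?_
  change x.2 (e.e.symm (e.e y.1)) = x.2 y.1
  rw [LinearEquiv.symm_apply_apply]

/-- The union of a stable isomorphism, with its first summand. -/
abbrev StableIso.pair {v v' : QForm Λ ε}
    (f : StableIso Z (SplitFormation.boundary v) (SplitFormation.boundary v')) : QPair Λ ε :=
  unionPair v v' f.f.corner f.f.cornerQ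

theorem StableIso.nonempty_pair_stab {v v' : QForm Λ ε}
    (f : StableIso Z (SplitFormation.boundary v) (SplitFormation.boundary v'))
    (Q : BasedModule Λ) :
    Nonempty (PairIso Z (f.pair.sum (QPair.hyp ε Q)) (f.stab Q).pair) := by
  have h := nonempty_unionPair_stab (Z := Z) f.f.corner f.f.cornerQ Q
  rwa [← StableIso.corner_stab, ← StableIso.cornerQ_stab] at h

variable [hZ : Fact (StarInvariant Z)]

theorem StableIso.nonempty_pair_homotopic {v v' : QForm Λ ε}
    {f f' : StableIso Z (SplitFormation.boundary v) (SplitFormation.boundary v')}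
    (h : f.Homotopic f') : Nonempty (PairIso Z f.pair f'.pair) := by
  obtain ⟨t, ha, hs⟩ := StableIso.corner_data_of_homotopic h
  exact nonempty_unionPair_homotopy t ha hs

theorem StableIso.nonempty_pair_conj {v v' w w' : QForm Λ ε}
    (f : StableIso Z (SplitFormation.boundary v) (SplitFormation.boundary v'))
    (k : Isometry Z v w) (l : Isometry Z v' w') :
    Nonempty (PairIso Z f.pair (f.conjIsometry k l).pair) := by
  have h := nonempty_unionPair_conj f.f.corner f.f.cornerQ k l
  rwa [← StableIso.corner_conjIsometry, ← StableIso.cornerQ_conjIsometry] at h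

def BoundaryIso.pairClass {v v' : QForm Λ ε} (s : BoundaryIso Z v v') : PairClass Z ε :=
  Quot.lift (fun f => PairClass.mk Z f.pair) (fun _ _ h =>
    PairClass.eq_iff.2 (.of_iso (StableIso.nonempty_pair_homotopic h).some)) s

def BIso.pairClass {v v' : QForm Λ ε} (s : BIso Z v v') : PairClass Z ε :=
  Quot.lift BoundaryIso.pairClass (by
    rintro _ _ ⟨f, g, h, rfl, rfl⟩
    exact PairClass.eq_iff.2 (.of_iso (f.nonempty_pair_conj g h).some)) s

/-- The class of the pair `(w ∪_f -w'; W)`. -/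
def SBIso.pairClass {v v' : QForm Λ ε} (s : SBIso Z v v') : PairClass Z ε :=
  Quot.lift (fun p => BIso.pairClass p.elt) (by
    rintro _ _ ⟨B, D, C, h, f⟩
    refine PairClass.eq_iff.2 (Near.symm ?_)
    obtain ⟨T⟩ := f.nonempty_pair_stab D.mod
    obtain ⟨T'⟩ := (f.stab D.mod).nonempty_pair_conj (Isometry.join v B D C h)
      (Isometry.join v' B D C h)
    exact (Near.of_iso (T.trans T').symm).trans (Near.sum_hyp _ _)) s

namespace SBIso

variable {v v' : QForm Λ ε}

theorem exists_mk (s : SBIso Z v v') : ∃ (k : ℕ) (B : SBasis Λ k)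
    (f : StableIso Z (SplitFormation.boundary (v.stab B)) (SplitFormation.boundary (v'.stab B))),
    SBIso.mk B f = s := by
  induction s using Quot.ind with | _ p
  obtain ⟨k, B, c⟩ := p
  induction c using Quot.ind with | _ c
  induction c using Quot.ind with | _ f
  exact ⟨k, B, f, rfl⟩

/-- At a fixed index of the direct system, the isometries produced by `homotopic_conj_of_pairIso`
are automorphisms of the two stabilised forms, which are divided out in $\mathrm{bIso}$. -/
theorem mk_eq_of_pairIso {k : ℕ} {B : SBasis Λ k}
    {f f' : StableIso Z (SplitFormation.boundary (v.stab B)) (SplitFormation.boundary (v'.stab B))}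
    (T : PairIso Z f.pair f'.pair) : SBIso.mk B f = SBIso.mk B f' := by
  obtain ⟨k, l, h⟩ := homotopic_conj_of_pairIso f f' T
  have h1 : BIso.mk f = BIso.mk (f'.conjIsometry k.symm l.symm) :=
    congrArg (Quot.mk _) (Quot.sound h)
  have h2 : BIso.mk f' = BIso.mk (f'.conjIsometry k.symm l.symm) :=
    Quot.sound ⟨f', k.symm, l.symm, rfl, rfl⟩
  rw [SBIso.mk, SBIso.mk, h1, h2]

theorem exists_stab {k l : ℕ} {B : SBasis Λ k} (D : SBasis Λ l) (C : SBasis Λ (k + l))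
    (h : IsSimple Z (M := B.mod.prod D.mod) (N := C.mod) (QuadL.joinFin Λ k l))
    (f : StableIso Z (SplitFormation.boundary (v.stab B)) (SplitFormation.boundary (v'.stab B))) :
    ∃ f' : StableIso Z (SplitFormation.boundary (v.stab C)) (SplitFormation.boundary (v'.stab C)),
      SBIso.mk B f = SBIso.mk C f' ∧
      Nonempty (PairIso Z (f.pair.sum (QPair.hyp ε D.mod)) f'.pair) := by
  obtain ⟨T⟩ := f.nonempty_pair_stab D.mod
  obtain ⟨T'⟩ := (f.stab D.mod).nonempty_pair_conj (Isometry.join v B D C h)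
    (Isometry.join v' B D C h)
  exact ⟨_, Quot.sound (SBIso.Rel.mk B D C h f), ⟨T.trans T'⟩⟩

/-- Indices with the same module $\Lambda^k$ but different bases are distinct in the direct system.
They meet over $\Lambda^{2k}$: one is stabilised by `B'`, the other by `B`, and `r` identifies the
hyperbolic pairs so added. -/
theorem mk_eq_of_pairIso_of_join {k : ℕ} {B B' : SBasis Λ k} (E : SBasis Λ (k + k))
    (h1 : IsSimple Z (M := B.mod.prod B'.mod) (N := E.mod) (QuadL.joinFin Λ k k))
    (h3 : IsSimple Z (M := B'.mod.prod B.mod) (N := E.mod) (QuadL.joinFin Λ k k))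
    (r : SEquiv Z B.mod B'.mod)
    {f : StableIso Z (SplitFormation.boundary (v.stab B)) (SplitFormation.boundary (v'.stab B))}
    {f' : StableIso Z (SplitFormation.boundary (v.stab B'))
      (SplitFormation.boundary (v'.stab B'))}
    (T : PairIso Z f.pair f'.pair) : SBIso.mk B f = SBIso.mk B' f' := by
  obtain ⟨g, hg, ⟨S⟩⟩ := exists_stab B' E h1 f
  obtain ⟨g', hg', ⟨S'⟩⟩ := exists_stab B E h3 f'
  obtain ⟨R⟩ := QPair.nonempty_hyp Z (ε := ε) r.symm
  rw [hg, hg']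
  exact mk_eq_of_pairIso (S.symm.trans ((T.sum R).trans S'))

/-- The identity on each factor need not be simple, but the two torsions are opposite to each other.
-/
theorem _root_.QuadL.SBasis.isSimple_refl_prod {k : ℕ} (B B' : SBasis Λ k) :
    IsSimple Z (M := B'.mod.prod B.mod) (N := B.mod.prod B'.mod)
      (LinearEquiv.refl Λ ((Fin k → Λ) × (Fin k → Λ))) := by
  have h3 := torsion_prod (M := B'.mod) (N := B.mod) (M' := B.mod) (N' := B'.mod)
    (LinearEquiv.refl Λ (Fin k → Λ)) (LinearEquiv.refl Λ (Fin k → Λ))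
  have h4 := torsion_symm (M := B'.mod) (N := B.mod) (LinearEquiv.refl Λ (Fin k → Λ))
  have h5 : torsion (M := B.mod) (N := B'.mod) (LinearEquiv.refl Λ (Fin k → Λ)) =
    -torsion (M := B'.mod) (N := B.mod) (LinearEquiv.refl Λ (Fin k → Λ)) := h4
  rw [h5, add_neg_cancel] at h3
  exact .of_eq_zero h3

theorem mk_eq_of_pairIso_of_equiv {k k' : ℕ} {B : SBasis Λ k} {B' : SBasis Λ k'}
    (r : SEquiv Z B.mod B'.mod)
    {f : StableIso Z (SplitFormation.boundary (v.stab B)) (SplitFormation.boundary (v'.stab B))}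
    {f' : StableIso Z (SplitFormation.boundary (v.stab B'))
      (SplitFormation.boundary (v'.stab B'))}
    (T : PairIso Z f.pair f'.pair) : SBIso.mk B f = SBIso.mk B' f' := by
  obtain rfl := r.fin_eq
  have h1 := SBasis.isSimple_ofEquiv (Z := Z) (B.mod.prod B'.mod) (QuadL.joinFin Λ k k)
  have h2 := SBasis.isSimple_refl_prod (Z := Z) B B'
  have h3 := IsSimple.trans (M := B'.mod.prod B.mod) (N := B.mod.prod B'.mod) h2 h1
  exact mk_eq_of_pairIso_of_join _ h1 h3 r T

/-- A class in `sbIso(v, v')` is determined by its union, with its first summand. -/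
theorem pairClass_injective : Function.Injective (SBIso.pairClass (Z := Z) (v := v) (v' := v')) := by
  intro s s' h
  obtain ⟨k, B, f, rfl⟩ := s.exists_mk
  obtain ⟨k', B', f', rfl⟩ := s'.exists_mk
  obtain ⟨P, Q, ⟨T⟩⟩ := PairClass.eq_iff.1 h
  let X := B.mod.prod P
  let X' := B'.mod.prod Q
  -- Large enough that one complement $\Lambda^m$ makes all four modules standard.
  let m := P.m + Q.m + X.m + X'.m
  obtain ⟨l, ⟨p⟩⟩ := SEquiv.exists_std (Z := Z) P m (by omega)
  obtain ⟨l', ⟨p'⟩⟩ := SEquiv.exists_std (Z := Z) Q m (by omega)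
  obtain ⟨n, ⟨x⟩⟩ := SEquiv.exists_std (Z := Z) X m (by omega)
  obtain ⟨n', ⟨x'⟩⟩ := SEquiv.exists_std (Z := Z) X' m (by omega)
  -- The isomorphism on the first summands has $v$ on both sides, so $B\oplus P$ and $B'\oplus Q$
  -- have equal ranks and the two stabilised indices become simply isomorphic to the same
  -- $\Lambda^n$.
  have hn : n = n' := by
    have e1 := BasedModule.rank_eq (M := X.prod (BasedModule.std Λ m)) (N := BasedModule.std Λ n)
      x.e
    have e2 := BasedModule.rank_eq (M := X'.prod (BasedModule.std Λ m)) (N := BasedModule.std Λ n')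
      x'.e
    have e3 := BasedModule.rank_eq (M := (v.M.prod B.mod).prod P) (N := (v.M.prod B'.mod).prod Q)
      T.eV.e
    have e4 : ∀ j, (BasedModule.std Λ j).rank = j := fun j => by simp [BasedModule.rank]
    rw [BasedModule.rank_prod, BasedModule.rank_prod] at e1 e2
    simp only [BasedModule.rank_prod, e4] at e1 e2 e3
    omega
  subst hn
  let D := SBasis.std Λ l
  let D' := SBasis.std Λ l'
  let E := SBasis.ofEquiv (B.mod.prod D.mod) (QuadL.joinFin Λ k l)
  let E' := SBasis.ofEquiv (B'.mod.prod D'.mod) (QuadL.joinFin Λ k' l')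
  let jE : SEquiv Z (B.mod.prod D.mod) E.mod := ⟨_, SBasis.isSimple_ofEquiv _ _⟩
  let jE' : SEquiv Z (B'.mod.prod D'.mod) E'.mod := ⟨_, SBasis.isSimple_ofEquiv _ _⟩
  obtain ⟨g, hg, ⟨S⟩⟩ := exists_stab D E jE.simple f
  obtain ⟨g', hg', ⟨S'⟩⟩ := exists_stab D' E' jE'.simple f'
  let r : SEquiv Z E.mod (BasedModule.std Λ n) := jE.symm.trans
    (((SEquiv.refl B.mod).prod p.symm).trans ((SEquiv.prodAssoc Z _ _ _).symm.trans x))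
  let r' : SEquiv Z E'.mod (BasedModule.std Λ n) := jE'.symm.trans
    (((SEquiv.refl B'.mod).prod p'.symm).trans ((SEquiv.prodAssoc Z _ _ _).symm.trans x'))
  -- Stabilising by $D=\Lambda^l\cong P\oplus\Lambda^m$ adds the hyperbolic pair of `P`, over which
  -- `T` is defined, and a further one that is carried along by the identity.
  have hyp_split : ∀ {l : ℕ} {P : BasedModule Λ}
      (_ : SEquiv Z (P.prod (BasedModule.std Λ m)) (BasedModule.std Λ l)), Nonempty (PairIso Z
      (QPair.hyp ε (SBasis.std Λ l).mod) ((QPair.hyp ε P).sum (QPair.hyp ε (BasedModule.std Λ m)))) := by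
    intro l P p
    obtain ⟨R⟩ := QPair.nonempty_hyp Z (ε := ε) p.symm
    exact ⟨R.trans (PairIso.hypProd _ _).symm⟩
  obtain ⟨R⟩ := hyp_split p
  obtain ⟨R'⟩ := hyp_split p'
  rw [hg, hg']
  refine mk_eq_of_pairIso_of_equiv (r.trans r'.symm) ?_
  exact S.symm.trans <| ((PairIso.refl _).sum R).trans <| (PairIso.assoc _ _ _).symm.trans <|
    (T.sum (PairIso.refl _)).trans <| (PairIso.assoc _ _ _).trans <|
    ((PairIso.refl _).sum R'.symm).trans S'

end SBIso

end BoundaryClasses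

/-! ### The induced forms on $V$ and $V^\perp$, and the map $b$. -/

section InducedForms

variable {Λ : Type u} [Ring Λ] [StarRing Λ] [InvariantBasisNumber Λ]
variable {Z : AddSubgroup (RedK1 Λ)} {ε : ℤˣ}

theorem Isometry.nonempty_zeroProd (ε : ℤˣ) (P Q : BasedModule Λ) : Nonempty (Isometry Z
    ((QForm.zeroForm ε P).sum (QForm.zeroForm ε Q)) (QForm.zeroForm ε (P.prod Q))) :=
  ⟨⟨LinearEquiv.refl Λ (P × Q), .refl (P.prod Q), by
    change QGrp.pull _ 0 = QGrp.pull (LinearMap.fst Λ P Q) 0 + QGrp.pull (LinearMap.snd Λ P Q) 0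
    simp⟩⟩

variable (Z) in
/-- The relation which defines the `0`-stabilised forms. -/
def ZSRel (v w : QForm Λ ε) : Prop := ∃ P Q : BasedModule Λ,
  Nonempty (Isometry Z (v.sum (QForm.zeroForm ε P)) (w.sum (QForm.zeroForm ε Q)))

theorem ZSRel.trans {v w x : QForm Λ ε} (h : ZSRel Z v w) (h' : ZSRel Z w x) : ZSRel Z v x := by
  obtain ⟨P, Q, ⟨f⟩⟩ := h
  obtain ⟨R, S, ⟨g⟩⟩ := h'
  obtain ⟨a⟩ := Isometry.nonempty_zeroProd (Z := Z) ε P R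
  obtain ⟨b⟩ := Isometry.nonempty_zeroProd (Z := Z) ε Q R
  obtain ⟨c⟩ := Isometry.nonempty_zeroProd (Z := Z) ε R Q
  obtain ⟨d⟩ := Isometry.nonempty_zeroProd (Z := Z) ε S Q
  exact ⟨P.prod R, S.prod Q, ⟨((Isometry.refl v).sum a.symm).trans <|
    (Isometry.assoc _ _ _).symm.trans <| (f.sum (.refl _)).trans <| (Isometry.assoc _ _ _).trans <|
    ((Isometry.refl w).sum (.comm _ _)).trans <| (Isometry.assoc _ _ _).symm.trans <|
    (g.sum (.refl _)).trans <| (Isometry.assoc _ _ _).trans ((Isometry.refl x).sum d)⟩⟩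

theorem ZSForm.eq_iff {v w : QForm Λ ε} : ZSForm.mk Z v = ZSForm.mk Z w ↔ ZSRel Z v w :=
  Equivalence.quot_mk_eq_iff
    (r := fun v w : QForm Λ ε => ∃ P Q : BasedModule Λ,
      Nonempty (Isometry Z (v.sum (QForm.zeroForm ε P)) (w.sum (QForm.zeroForm ε Q))))
    ⟨fun _ => ⟨BasedModule.std Λ 0, BasedModule.std Λ 0, ⟨.refl _⟩⟩,
      fun ⟨P, Q, ⟨f⟩⟩ => ⟨Q, P, ⟨f.symm⟩⟩, fun h h' => ZSRel.trans h h'⟩ v w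

theorem ZSForm.mk_sum_zero (v : QForm Λ ε) (P : BasedModule Λ) :
    ZSForm.mk Z (v.sum (QForm.zeroForm ε P)) = ZSForm.mk Z v := by
  obtain ⟨a⟩ := Isometry.nonempty_zeroProd (Z := Z) ε P (BasedModule.std Λ 0)
  exact ZSForm.eq_iff.2 ⟨BasedModule.std Λ 0, P.prod (BasedModule.std Λ 0),
    ⟨(Isometry.assoc _ _ _).trans ((Isometry.refl v).sum a)⟩⟩

theorem ZSForm.mk_eq_of_isometry {v w : QForm Λ ε} (f : Isometry Z v w) :
    ZSForm.mk Z v = ZSForm.mk Z w :=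
  ZSForm.eq_iff.2 ⟨BasedModule.std Λ 0, BasedModule.std Λ 0, ⟨f.sum (.refl _)⟩⟩

theorem QGrp.pull_sum_hyp (v : QForm Λ ε) {V : BasedModule Λ} (j : V →ₗ[Λ] v.M)
    (P : BasedModule Λ) :
    QGrp.pull (j.prodMap (LinearMap.inl Λ P (SDual Λ P))) (v.sum (QForm.hyp ε P)).q =
      QGrp.pull (LinearMap.fst Λ V P) (QGrp.pull j v.q) := by
  change QGrp.pull (j.prodMap (LinearMap.inl Λ P (SDual Λ P)))
    (QGrp.pull (LinearMap.fst Λ v.M (P × SDual Λ P)) v.q +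
    QGrp.pull (LinearMap.snd Λ v.M (P × SDual Λ P)) (QForm.hyp ε P).q) = _
  have h : QGrp.pull (j.prodMap (LinearMap.inl Λ P (SDual Λ P)))
      (QGrp.pull (LinearMap.snd Λ v.M (P × SDual Λ P)) (QForm.hyp ε P).q) =
      QGrp.pairing ε (0 : (V × P) →ₗ[Λ] SDual Λ P) (LinearMap.snd Λ V P) := rfl
  rw [map_add, h, QGrp.pairing_zero_left, add_zero, QGrp.pull_pull, QGrp.pull_pull]
  rfl

/-- The hyperbolic form vanishes on $P$. So the addition of a hyperbolic pair adds a zero form to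
the induced form, which the relation on $0$-stabilised forms ignores. -/
theorem ZSForm.mk_restrict_sum_hyp (v : QForm Λ ε) {V : BasedModule Λ} (j : V →ₗ[Λ] v.M)
    (P : BasedModule Λ) : ZSForm.mk Z ((v.sum (QForm.hyp ε P)).restrict (V.prod P)
      (j.prodMap (LinearMap.inl Λ P (SDual Λ P)))) = ZSForm.mk Z (v.restrict V j) := by
  refine Eq.trans ?_ (ZSForm.mk_sum_zero _ P)
  refine congrArg (fun q => ZSForm.mk Z (⟨V.prod P, q⟩ : QForm Λ ε)) ?_
  refine (QGrp.pull_sum_hyp v j P).trans ?_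
  change _ = QGrp.pull (LinearMap.fst Λ V P) (QGrp.pull j v.q) + QGrp.pull (LinearMap.snd Λ V P) 0
  rw [map_zero, add_zero]

theorem ZSForm.mk_neg_restrict_sum_hyp (v : QForm Λ ε) {V : BasedModule Λ} (j : V →ₗ[Λ] v.M)
    (P : BasedModule Λ) : ZSForm.mk Z ((v.sum (QForm.hyp ε P)).restrict (V.prod P)
      (j.prodMap (LinearMap.inl Λ P (SDual Λ P)))).neg = ZSForm.mk Z (v.restrict V j).neg := by
  refine Eq.trans ?_ (ZSForm.mk_sum_zero _ P)
  refine congrArg (fun q => ZSForm.mk Z (⟨V.prod P, q⟩ : QForm Λ ε)) ?_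
  refine (congrArg Neg.neg (QGrp.pull_sum_hyp v j P)).trans ?_
  change _ = QGrp.pull (LinearMap.fst Λ V P) (-QGrp.pull j v.q) + QGrp.pull (LinearMap.snd Λ V P) 0
  rw [map_zero, add_zero, map_neg]

theorem PairIso.nonempty_restrict {x y : QPair Λ ε} (T : PairIso Z x y) :
    Nonempty (Isometry Z (x.form.restrict x.V x.j) (y.form.restrict y.V y.j)) := by
  refine ⟨⟨T.eV.e, T.eV.simple, ?_⟩⟩
  change QGrp.pull T.eV.e.toLinearMap (QGrp.pull y.j y.form.q) = QGrp.pull x.j x.form.q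
  have h : y.j.comp T.eV.e.toLinearMap = T.f.e.toLinearMap.comp x.j :=
    LinearMap.ext fun a => (T.comm a).symm
  rw [QGrp.pull_pull, h, ← QGrp.pull_pull, T.f.isom]

theorem Near.mk_restrict {x y : QPair Λ ε} (h : Near Z x y) :
    ZSForm.mk Z (x.form.restrict x.V x.j) = ZSForm.mk Z (y.form.restrict y.V y.j) := by
  obtain ⟨P, Q, ⟨T⟩⟩ := h
  obtain ⟨f⟩ := T.nonempty_restrict
  rw [← ZSForm.mk_restrict_sum_hyp x.form x.j P, ← ZSForm.mk_restrict_sum_hyp y.form y.j Q]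
  exact ZSForm.mk_eq_of_isometry f

variable [hZ : Fact (StarInvariant Z)]

theorem BasedExact.exists_perp_section {v : QForm Λ ε} (hv : v.IsSimpleForm Z)
    {V W : BasedModule Λ} {j : V →ₗ[Λ] v.M} {i : W →ₗ[Λ] v.M}
    (h : BasedExact Z i (v.perpMap j)) :
    ∃ σ : SDual Λ W →ₗ[Λ] v.M, ∀ u, v.perpMap i (σ u) = u := by
  obtain ⟨r, hr⟩ := h.exists_retraction
  exact hv.exists_section r hr

/-- The annihilator of `V ⊕ P` in `M ⊕ H_ε(P)`. -/
theorem BasedExact.sum_hyp {v : QForm Λ ε} (hv : v.IsSimpleForm Z) {V W : BasedModule Λ}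
    {j : V →ₗ[Λ] v.M} {i : W →ₗ[Λ] v.M} (h : BasedExact Z i (v.perpMap j)) (P : BasedModule Λ) :
    BasedExact Z (A := W.prod P) (i.prodMap (LinearMap.inl Λ P (SDual Λ P)))
      ((v.sum (QForm.hyp ε P)).perpMap (L := V.prod P)
        (j.prodMap (LinearMap.inl Λ P (SDual Λ P)))) := by
  obtain ⟨σ, hσ⟩ := h.exists_perp_section hv
  have hσ' : ∀ u w, v.phi (σ u) (i w) = u w := fun u w =>
    congrArg (fun t : SDual Λ W => t w) (hσ u)
  obtain ⟨K, hK⟩ := exists_perp_equiv hv h σ hσ'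
  have hφ : ∀ x y : v.M × (P × SDual Λ P), (v.sum (QForm.hyp ε P)).phi x y =
      v.phi x.1 y.1 + (x.2.2 y.2.1 + (ε : ℤ) • star (y.2.2 x.2.1)) := fun x y =>
    QForm.phi_sum v (QForm.hyp ε P) x y
  let K' : SEquiv Z ((V.prod P).prod (W.prod P).dual) (v.M.prod (P.prod P.dual)) :=
    ((SEquiv.refl (V.prod P)).prod (SEquiv.dualProd Z W P)).trans <|
    (SEquiv.prodProdProdComm Z V P W.dual P.dual).trans (K.prod (.refl _))
  refine QuadL.basedExact_perp (V := V.prod P) (W := W.prod P) (hv.sum (QForm.hyp_isSimpleForm P))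
    _ _ ((σ.prodMap (LinearMap.inr Λ P (SDual Λ P))).comp
      (QuadL.dualProd (Λ := Λ) W P).toLinearMap) (fun w x => ?_) (fun u w => ?_) K' (fun x u => ?_)
  · rw [hφ]
    have h1 : v.phi (i w.1) (j x.1) = 0 :=
      congrArg (fun t : SDual Λ V => t x.1) ((h.exact (i w.1)).2 ⟨w.1, rfl⟩)
    change v.phi (i w.1) (j x.1) + ((0 : Λ) + (ε : ℤ) • star (0 : Λ)) = 0
    rw [h1, star_zero, smul_zero, add_zero, add_zero]
  · rw [hφ]
    change v.phi (σ _) (i w.1) + (u (0, w.2) + (ε : ℤ) • star (0 : Λ)) = _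
    rw [hσ', star_zero, smul_zero, add_zero]
    change u (w.1, 0) + u (0, w.2) = u w
    rw [← map_add]
    simp
  · change (K.e (x.1, dualMap (LinearMap.inl Λ W P) u), (x.2, dualMap (LinearMap.inr Λ W P) u)) =
      (j x.1, (x.2, 0)) + (σ (dualMap (LinearMap.inl Λ W P) u),
        ((0 : P), dualMap (LinearMap.inr Λ W P) u))
    rw [hK]
    simp

/-- The annihilator is determined by the pair, and its basis up to simple isomorphism by the based
sequence, so naturality of based sequences applies. -/
theorem PairIso.nonempty_perp {x y : QPair Λ ε} (T : PairIso Z x y) {W W' : BasedModule Λ}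
    {i : W →ₗ[Λ] x.form.M} {i' : W' →ₗ[Λ] y.form.M} (h : BasedExact Z i (x.form.perpMap x.j))
    (h' : BasedExact Z i' (y.form.perpMap y.j)) :
    Nonempty (Isometry Z (x.form.restrict W i).neg (y.form.restrict W' i').neg) := by
  let U : SEquiv Z x.form.M y.form.M := ⟨T.f.e, T.f.simple⟩
  obtain ⟨G, hG⟩ := h.exists_map h' U T.eV.symm.dual (fun a => SDual.ext fun b => by
    change y.form.phi (T.f.e a) (y.j b) = x.form.phi a (x.j (T.eV.e.symm b))
    rw [← T.f.phi_apply, T.comm, LinearEquiv.apply_symm_apply])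
  refine ⟨⟨G.e, G.simple, ?_⟩⟩
  change QGrp.pull G.e.toLinearMap (-QGrp.pull i' y.form.q) = -QGrp.pull i x.form.q
  have h1 : i'.comp G.e.toLinearMap = T.f.e.toLinearMap.comp i :=
    LinearMap.ext fun a => (hG a).symm
  rw [map_neg, QGrp.pull_pull, h1, ← QGrp.pull_pull, T.f.isom]

theorem Near.mk_perp {x y : QPair Λ ε} (h : Near Z x y) (hx : x.form.IsSimpleForm Z)
    (hy : y.form.IsSimpleForm Z) {W W' : BasedModule Λ}
    {i : W →ₗ[Λ] x.form.M} {i' : W' →ₗ[Λ] y.form.M} (hi : BasedExact Z i (x.form.perpMap x.j))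
    (hi' : BasedExact Z i' (y.form.perpMap y.j)) :
    ZSForm.mk Z (x.form.restrict W i).neg = ZSForm.mk Z (y.form.restrict W' i').neg := by
  obtain ⟨P, Q, ⟨T⟩⟩ := h
  obtain ⟨f⟩ := T.nonempty_perp (hi.sum_hyp hx P) (hi'.sum_hyp hy Q)
  rw [← ZSForm.mk_neg_restrict_sum_hyp x.form i P, ← ZSForm.mk_neg_restrict_sum_hyp y.form i' Q]
  exact ZSForm.mk_eq_of_isometry f

theorem QuasiFormation.nonempty_perp (x : QuasiFormation Z ε) : Nonempty x.Perp := by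
  obtain ⟨r, hr⟩ := x.split
  obtain ⟨W, i, h⟩ := x.simple.exists_perp r hr
  exact ⟨⟨W, i, h⟩⟩

/-- Only the pair classes are assumed to agree. This gives at once that $b$ is well defined and that
it is invariant under the action of $L^s_{2q+1}(\Lambda)$. -/
theorem isB_unique {ξ ξ' : LMonoid Z ε} (h : ξ.pairClass = ξ'.pairClass)
    {s s' : ZSForm Z ε × ZSForm Z ε} (hs : IsB ξ s) (hs' : IsB ξ' s') : s = s' := by
  obtain ⟨x, p, rfl, rfl⟩ := hs
  obtain ⟨x', p', rfl, rfl⟩ := hs'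
  have hN : Near Z x.pair x'.pair := PairClass.eq_iff.1 h
  exact Prod.ext hN.mk_restrict (hN.mk_perp x.simple x'.simple p.based p'.based)

theorem exists_isB (ξ : LMonoid Z ε) : ∃ s, IsB ξ s := by
  induction ξ using Quot.ind with | _ x
  obtain ⟨p⟩ := x.nonempty_perp
  exact ⟨_, x, p, rfl, rfl⟩

end InducedForms

/-! ### The boundary isomorphism of a quasi-formation and its union. -/

section Gluing

variable {Λ : Type u} [Ring Λ] [StarRing Λ] [InvariantBasisNumber Λ]
variable {Z : AddSubgroup (RedK1 Λ)} {ε : ℤˣ}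

theorem QuasiFormation.Perp.phi_eq_zero {x : QuasiFormation Z ε} (p : x.Perp) (w : p.W) (a : x.V) :
    x.form.phi (p.i w) (x.jV a) = 0 :=
  congrArg (fun t : SDual Λ x.V => t a) ((p.based.exact (p.i w)).2 ⟨w, rfl⟩)

section Corner

variable {x : QuasiFormation Z ε} {p : x.Perp} {ψ : x.form.M →ₗ[Λ] SDual Λ x.form.M}
  {σ : SDual Λ p.W →ₗ[Λ] x.form.M}
  {h : Isometry Z (x.vform.sum (QForm.hyp ε p.W)) ((QuasiFormation.pform p).sum x.form)}

theorem IsGluing.apply_fst (hh : IsGluing x p ψ σ h) (a : x.V) (w : p.W) (u u' : SDual Λ p.W) :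
    u' (h.e (a, (w, u))).1 = u' w - x.form.phi (σ u') (x.jV a) - ψ (σ u') (σ u) := by
  have h1 := congrArg (fun t : SDual Λ (SDual Λ p.W) => star (t u')) (hh a w u).1
  change star (star (u' (h.e (a, (w, u))).1)) = star (star (u' w) -
    star (x.form.phi (σ u') (x.jV a)) - star (ψ (σ u') (σ u))) at h1
  rw [← star_sub, ← star_sub, star_star, star_star] at h1
  exact h1

theorem apply_corner_gluingIso (hh : IsGluing x p ψ σ h) (a : x.V) (u : SDual Λ p.W) :
    u ((gluingIso x p h).f.corner a) = -x.form.phi (σ u) (x.jV a) := by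
  change u (h.e (a, 0)).1 = _
  have h1 := hh.apply_fst a 0 0 u
  rw [map_zero, map_zero, map_zero, sub_zero, zero_sub] at h1
  exact h1

theorem SplitIso.transported_symm {y z : SplitFormation Λ ε} (f : SplitIso Z y z) :
    f.symm.transported = -f.ν := by
  change QGrp.pull (dualMap f.α.symm.toLinearMap) (-QGrp.pull (dualMap f.α.toLinearMap) f.ν) = _
  rw [map_neg, QGrp.pull_pull]
  have h : (dualMap f.α.toLinearMap).comp (dualMap f.α.symm.toLinearMap) = LinearMap.id :=
    LinearMap.ext fun u => SDual.ext fun a => by simp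
  rw [h, QGrp.pull_id]

/-- Of the five factors of $f_j$, only the two that come from symmetrisations of simple forms have
$\nu\ne0$. The one for $(M,\psi)$ lives on $M^*$ and does not meet the corner. The one for
$H_\epsilon(V^\perp)$ contributes the hyperbolic form, pulled back along a map determined by `h`. -/
theorem cornerQ_gluingIso (hh : IsGluing x p ψ σ h) (hψ : QGrp.mk ε ψ = x.form.q) :
    (gluingIso x p h).f.cornerQ = -QGrp.pull σ x.form.q := by
  let H := QForm.hyp ε p.W
  let hH : H.IsSimpleForm Z := QForm.hyp_isSimpleForm p.W
  let f1 := (SplitIso.refl (Z := Z) (SplitFormation.boundary x.vform)).sum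
      (SplitIso.ofSimpleForm H hH).symm
  let f2 := (SplitIso.boundarySum (Z := Z) x.vform H).symm
  let f3 := SplitIso.ofIsometry h
  let f4 := SplitIso.boundarySum (Z := Z) (QuasiFormation.pform p) x.form
  let f5 := (SplitIso.refl (Z := Z) (SplitFormation.boundary (QuasiFormation.pform p))).sum
      (SplitIso.ofSimpleForm x.form x.simple)
  have e2 : f2.transported = 0 := SplitIso.transported_symm_of_nu rfl
  have e3 : f3.transported = 0 := SplitIso.transported_of_nu rfl
  have e4 : f4.transported = 0 := SplitIso.transported_of_nu rfl
  let N := (SplitIso.ofSimpleForm x.form x.simple).transported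
  have e5 : f5.transported = QGrp.pull (dualMap (LinearMap.inr Λ p.W x.form.M)) N := by
    refine (SplitIso.transported_sum _ _).trans ?_
    rw [SplitIso.transported_refl, map_zero, zero_add]
  have e1 : f1.transported = QGrp.pull (dualMap (LinearMap.inr Λ x.V (p.W × SDual Λ p.W)))
      (QGrp.pull hH.choose.symm.toLinearMap H.q) := by
    refine (SplitIso.transported_sum _ _).trans ?_
    rw [SplitIso.transported_refl, map_zero, zero_add, SplitIso.transported_symm]
    exact congrArg _ (neg_neg _)
  have e : (gluingIso x p h).f.transported =
      QGrp.pull (dualMap f5.α.toLinearMap) (QGrp.pull (dualMap f4.α.toLinearMap)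
        (QGrp.pull (dualMap f3.α.toLinearMap) (QGrp.pull (dualMap f2.α.toLinearMap)
          f1.transported))) + f5.transported := by
    have c1 := SplitIso.transported_trans f1 (f2.trans (f3.trans (f4.trans f5)))
    have c2 := SplitIso.transported_trans f2 (f3.trans (f4.trans f5))
    have c3 := SplitIso.transported_trans f3 (f4.trans f5)
    have c4 := SplitIso.transported_trans f4 f5
    refine c1.trans ?_
    rw [c2, c3, c4, e2, e3, e4, map_zero, map_zero, map_zero, zero_add, zero_add, zero_add]
    simp only [QGrp.pull_pull]
    rfl
  -- The functional `u` is pulled back along the first component of `h`, restricted to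
  -- $V^\perp\oplus(V^\perp)^*$, and turned into a vector by the inverse of the hyperbolic
  -- symmetrisation. The formula for `h` gives $u$ as the second component of `T u`, while pairing
  -- the first with $u'$ gives $-\psi(\sigma u,\sigma u')$ up to sign and involution.
  let T : SDual Λ p.W →ₗ[Λ] (p.W × SDual Λ p.W) := hH.choose.symm.toLinearMap.comp
    ((dualMap (LinearMap.inr Λ x.V (p.W × SDual Λ p.W))).comp ((dualMap h.e.toLinearMap).comp
      (dualMap (LinearMap.fst Λ p.W x.form.M))))
  have h1 : (gluingIso x p h).f.cornerQ = QGrp.pull T H.q := by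
    have h2 := congrArg (QGrp.pull (dualMap (LinearMap.fst Λ p.W x.form.M))) e
    rw [e5, e1, map_add] at h2
    have h3 : QGrp.pull (dualMap (LinearMap.fst Λ p.W x.form.M))
        (QGrp.pull (dualMap (LinearMap.inr Λ p.W x.form.M)) N) = 0 := by
      rw [QGrp.pull_pull]
      have h4 : (dualMap (LinearMap.inr Λ p.W x.form.M)).comp
        (dualMap (LinearMap.fst Λ p.W x.form.M)) = 0 :=
        LinearMap.ext fun u => SDual.ext fun a => map_zero u
      rw [h4, QGrp.pull_zero]
    rw [h3, add_zero] at h2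
    refine h2.trans ?_
    simp only [QGrp.pull_pull]
    rfl
  have hT : ∀ u, H.phi (T u) = (dualMap (LinearMap.inr Λ x.V (p.W × SDual Λ p.W)))
      (dualMap h.e.toLinearMap (dualMap (LinearMap.fst Λ p.W x.form.M) u)) := by
    intro u
    rw [← hH.choose_spec.2]
    exact LinearEquiv.apply_symm_apply _ _
  have hT' : ∀ u w u', (T u).2 w + (ε : ℤ) • star (u' (T u).1) = u w - ψ (σ u) (σ u') := by
    intro u w u'
    have h2 := congrArg (fun t : SDual Λ (p.W × SDual Λ p.W) => t (w, u')) (hT u)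
    refine h2.trans ((hh.apply_fst 0 w u' u).trans ?_)
    rw [map_zero, map_zero, sub_zero]
  have hT2 : ∀ u, (T u).2 = u := by
    intro u
    refine SDual.ext fun w => ?_
    have h2 := hT' u w 0
    rw [map_zero, map_zero, SDual.zero_apply, star_zero, smul_zero, add_zero, sub_zero] at h2
    exact h2
  have hT1 : ∀ u u', (ε : ℤ) • star (u' (T u).1) = -ψ (σ u) (σ u') := by
    intro u u'
    have h2 := hT' u 0 u'
    rw [map_zero, map_zero, zero_add, zero_sub] at h2
    exact h2
  rw [h1, ← hψ, QGrp.pull_mk]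
  change QGrp.pairing ε ((LinearMap.snd Λ p.W (SDual Λ p.W)).comp T)
    ((LinearMap.fst Λ p.W (SDual Λ p.W)).comp T) = _
  have h5 : QGrp.pull σ (QGrp.mk ε ψ) = QGrp.pairing ε (ψ.comp σ) σ := rfl
  rw [h5, ← QGrp.pairing_neg_right]
  refine QGrp.pairing_star fun u u' => ?_
  change (T u).2 (T u').1 = (ε : ℤ) • star (ψ (σ u') (-σ u))
  rw [hT2, map_neg, ← hT1, star_zsmul, star_star, smul_smul, units_coe_mul_self, one_smul]

end Corner

variable [hZ : Fact (StarInvariant Z)]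

/-- The isometry is $(a,u)\mapsto j\,a-\sigma u$. Since the corner entries of $f_j$ are
$-\sigma^*\varphi^*j$ and $-\sigma^*\psi\sigma$, the matrix of the union is $\psi$ in these
coordinates, and $V$ is carried to $V$ by the identity. -/
theorem nonempty_pair_of_isBoundaryIso {x : QuasiFormation Z ε} {p : x.Perp}
    {f : StableIso Z (SplitFormation.boundary x.vform)
      (SplitFormation.boundary (QuasiFormation.pform p))} (hf : IsBoundaryIso x p f) :
    Nonempty (PairIso Z f.pair x.pair) := by
  obtain ⟨ψ, σ, h, hψ, hσ, hh, rfl⟩ := hf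
  have hσ' : ∀ u w, x.form.phi (σ u) (p.i w) = u w := fun u w =>
    congrArg (fun t : SDual Λ p.W => t w) (hσ u)
  obtain ⟨K, hK⟩ := exists_perp_equiv x.simple p.based σ hσ'
  let E : SEquiv Z (x.V.prod p.W.dual) x.form.M :=
    ((SEquiv.refl x.V).prod (SEquiv.neg Z p.W.dual)).trans K
  have hE : ∀ a u, E.e (a, u) = x.jV a - σ u := fun a u => by
    change K.e (a, -u) = _
    rw [hK, map_neg, sub_eq_add_neg]
  let p1 := LinearMap.fst Λ x.V (SDual Λ p.W)
  let p2 := LinearMap.snd Λ x.V (SDual Λ p.W)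
  refine ⟨⟨⟨E.e, E.simple, ?_⟩, .refl x.V, fun a => ?_⟩⟩
  · have h1 : E.e.toLinearMap = x.jV.comp p1 - σ.comp p2 := LinearMap.ext fun b => hE b.1 b.2
    have h2 : (gluingIso x p h).pair.form.q = QGrp.pull p1 x.vform.q +
        QGrp.pairing ε p2 ((gluingIso x p h).f.corner.comp p1) -
        QGrp.pull p2 (gluingIso x p h).f.cornerQ := rfl
    have h3 : QGrp.pairing ε p2 ((gluingIso x p h).f.corner.comp p1) =
        -QGrp.pairing ε ((QGrp.symm x.form.q).comp (σ.comp p2)) (x.jV.comp p1) := by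
      rw [← QGrp.pairing_neg_right]
      refine QGrp.pairing_ext fun b c => ?_
      refine (apply_corner_gluingIso hh c.1 b.2).trans ?_
      exact (map_neg (x.form.phi (σ b.2)) (x.jV c.1)).symm
    rw [h1, h2, h3, cornerQ_gluingIso hh hψ, QGrp.pull_sub, QGrp.pairing_symm_comm, map_neg,
      ← QGrp.pull_pull, ← QGrp.pull_pull]
    change QGrp.pull p1 (QGrp.pull x.jV x.form.q) + QGrp.pull p2 (QGrp.pull σ x.form.q) -
      QGrp.pairing ε ((QGrp.symm x.form.q).comp (σ.comp p2)) (x.jV.comp p1) =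
      QGrp.pull p1 (QGrp.pull x.jV x.form.q) +
      -QGrp.pairing ε ((QGrp.symm x.form.q).comp (σ.comp p2)) (x.jV.comp p1) -
      -QGrp.pull p2 (QGrp.pull σ x.form.q)
    abel
  · change E.e (a, 0) = x.jV a
    rw [hE, map_zero, sub_zero]

theorem exists_isBoundaryIso (x : QuasiFormation Z ε) (p : x.Perp) :
    ∃ f, IsBoundaryIso x p f := by
  obtain ⟨σ, hσ⟩ := p.based.exists_perp_section x.simple
  obtain ⟨ψ, hψ⟩ := QGrp.mk_surjective x.form.q
  have hσ' : ∀ u w, x.form.phi (σ u) (p.i w) = u w := fun u w =>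
    congrArg (fun t : SDual Λ p.W => t w) (hσ u)
  obtain ⟨K, hK⟩ := exists_perp_equiv x.simple p.based σ hσ'
  let A : x.V →ₗ[Λ] p.W := (unev p.W).comp ((dualMap σ).comp ((adj x.form.phi).comp x.jV))
  let B : SDual Λ p.W →ₗ[Λ] p.W := (unev p.W).comp ((dualMap σ).comp ((adj ψ).comp σ))
  have hA : ∀ a, ev (A a) = dualMap σ (adj x.form.phi (x.jV a)) := fun a => ev_unev _ _
  have hB : ∀ u, ev (B u) = dualMap σ (adj ψ (σ u)) := fun u => ev_unev _ _
  have hA' : ∀ u a, u (A a) = x.form.phi (σ u) (x.jV a) := fun u a =>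
    star_injective (congrArg (fun t : SDual Λ (SDual Λ p.W) => t u) (hA a))
  have hB' : ∀ u u', u (B u') = ψ (σ u) (σ u') := fun u u' =>
    star_injective (congrArg (fun t : SDual Λ (SDual Λ p.W) => t u) (hB u'))
  let D : (x.V × SDual Λ p.W) →ₗ[Λ] p.W := -(A.coprod B)
  -- The gluing map is a composite of reorderings, the shear $w\mapsto c=w-A\,a-B\,u$, the simple
  -- isomorphism $(j,\sigma)$ and the shear by $j^\perp$. Hence it is simple.
  let E : SEquiv Z (x.V.prod (p.W.prod p.W.dual)) (p.W.prod x.form.M) :=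
    ((SEquiv.refl x.V).prod (SEquiv.prodComm Z p.W p.W.dual)).trans <|
    (SEquiv.prodAssoc Z x.V p.W.dual p.W).symm.trans <|
    (SEquiv.prodComm Z (x.V.prod p.W.dual) p.W).trans <|
    (SEquiv.shearLeft Z (M := p.W) (N := x.V.prod p.W.dual) D).trans <|
    ((SEquiv.refl p.W).prod K).trans (SEquiv.shear Z p.i)
  have hE : ∀ a w u, E.e (a, (w, u)) =
      (w - A a - B u, p.i (w - A a - B u) + σ u + x.jV a) := by
    intro a w u
    have h1 : w + D (a, u) = w - A a - B u := by
      change w + -(A a + B u) = _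
      rw [← sub_eq_add_neg, sub_add_eq_sub_sub]
    have h2 : E.e (a, (w, u)) = (w + D (a, u), K.e (a, u) + p.i (w + D (a, u))) := rfl
    rw [h2, h1, hK]
    refine Prod.ext rfl ?_
    exact (add_comm _ _).trans (by rw [add_comm (x.jV a), add_assoc])
  let X := x.V × (p.W × SDual Λ p.W)
  let a : X →ₗ[Λ] x.V := LinearMap.fst Λ _ _
  let w : X →ₗ[Λ] p.W := (LinearMap.fst Λ _ _).comp (LinearMap.snd Λ x.V (p.W × SDual Λ p.W))
  let u : X →ₗ[Λ] SDual Λ p.W :=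
    (LinearMap.snd Λ _ _).comp (LinearMap.snd Λ x.V (p.W × SDual Λ p.W))
  let c : X →ₗ[Λ] p.W := w - A.comp a - B.comp u
  -- The values $-q(j^\perp c)$ and $q(j^\perp c)$ cancel. What remains is $q(\sigma u+j\,a)$ and
  -- the mixed term $u(c)$; the summands `A` and `B` of `c` are chosen to remove $q(\sigma u)$ and
  -- the mixed term of $\sigma u$ and $j\,a$.
  let h : Isometry Z (x.vform.sum (QForm.hyp ε p.W)) ((QuasiFormation.pform p).sum x.form) :=
    ⟨E.e, E.simple, by
      have e1 : QGrp.pull E.e.toLinearMap ((QuasiFormation.pform p).sum x.form).q =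
          -QGrp.pull (p.i.comp c) x.form.q +
            QGrp.pull (p.i.comp c + (σ.comp u + x.jV.comp a)) x.form.q := by
        have d1 : (LinearMap.fst Λ p.W x.form.M).comp E.e.toLinearMap = c :=
          LinearMap.ext fun b => congrArg Prod.fst (hE b.1 b.2.1 b.2.2)
        have d2 : (LinearMap.snd Λ p.W x.form.M).comp E.e.toLinearMap =
            p.i.comp c + (σ.comp u + x.jV.comp a) := LinearMap.ext fun b => by
          refine (congrArg Prod.snd (hE b.1 b.2.1 b.2.2)).trans ?_
          exact add_assoc _ _ _
        change QGrp.pull E.e.toLinearMap (QGrp.pull (LinearMap.fst Λ p.W x.form.M)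
          (-QGrp.pull p.i x.form.q) + QGrp.pull (LinearMap.snd Λ p.W x.form.M) x.form.q) = _
        rw [map_add, QGrp.pull_pull, QGrp.pull_pull, d1, d2, map_neg, QGrp.pull_pull]
      have e2 : (x.vform.sum (QForm.hyp ε p.W)).q =
          QGrp.pull (x.jV.comp a) x.form.q + QGrp.pairing ε u w := by
        change QGrp.pull a (QGrp.pull x.jV x.form.q) + _ = _
        rw [QGrp.pull_pull]
        rfl
      have e3 : QGrp.pairing ε ((QGrp.symm x.form.q).comp (p.i.comp c))
          (σ.comp u + x.jV.comp a) = QGrp.pairing ε u c := by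
        refine QGrp.pairing_star fun b b' => ?_
        change x.form.phi (p.i (c b)) (σ (u b') + x.jV (a b')) = _
        rw [map_add, p.phi_eq_zero, add_zero, QForm.phi_symm, hσ']
      have e4 : QGrp.pairing ε u (A.comp a) =
          QGrp.pairing ε ((QGrp.symm x.form.q).comp (σ.comp u)) (x.jV.comp a) :=
        QGrp.pairing_ext fun b b' => hA' _ _
      have e5 : QGrp.pairing ε u (B.comp u) = QGrp.pull (σ.comp u) x.form.q := by
        have e6 : QGrp.pull (σ.comp u) x.form.q =
            QGrp.pairing ε (ψ.comp (σ.comp u)) (σ.comp u) := by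
          rw [← hψ]; rfl
        rw [e6]
        exact QGrp.pairing_ext fun b b' => hB' _ _
      rw [e1, e2, QGrp.pull_add, e3, QGrp.pull_add, QGrp.pairing_sub_right,
        QGrp.pairing_sub_right, e4, e5]
      abel⟩
  refine ⟨gluingIso x p h, ψ, σ, h, hψ, hσ, fun a w u => ?_, rfl⟩
  have h1 : h.e (a, (w, u)) = _ := hE a w u
  rw [h1]
  exact ⟨by rw [map_sub, map_sub, hA, hB], rfl⟩

end Gluing

/-! ### Exactness. -/

section ExactSequence

variable {Λ : Type u} [Ring Λ] [StarRing Λ] [InvariantBasisNumber Λ]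
variable {Z : AddSubgroup (RedK1 Λ)} {ε : ℤˣ}

variable (Z) in
/-- The relation which defines the even `L`-group. -/
def HypRel (v w : QForm Λ ε) : Prop := ∃ P Q : BasedModule Λ,
  Nonempty (Isometry Z (v.sum (QForm.hyp ε P)) (w.sum (QForm.hyp ε Q)))

theorem HypRel.trans {v w x : QForm Λ ε} (h : HypRel Z v w) (h' : HypRel Z w x) :
    HypRel Z v x := by
  obtain ⟨P, Q, ⟨f⟩⟩ := h
  obtain ⟨R, S, ⟨g⟩⟩ := h'
  exact ⟨P.prod R, S.prod Q, ⟨((Isometry.refl v).sum (PairIso.hypProd P R).f.symm).trans <|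
    (Isometry.assoc _ _ _).symm.trans <| (f.sum (.refl _)).trans <| (Isometry.assoc _ _ _).trans <|
    ((Isometry.refl w).sum (.comm _ _)).trans <| (Isometry.assoc _ _ _).symm.trans <|
    (g.sum (.refl _)).trans <| (Isometry.assoc _ _ _).trans
    ((Isometry.refl x).sum (PairIso.hypProd S Q).f)⟩⟩

theorem SimpleLEven.eq_iff {v w : QForm Λ ε} (hv : v.IsSimpleForm Z) (hw : w.IsSimpleForm Z) :
    SimpleLEven.mk v hv = SimpleLEven.mk w hw ↔ HypRel Z v w :=
  Equivalence.quot_mk_eq_iff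
    (r := fun v w : {v : QForm Λ ε // v.IsSimpleForm Z} => ∃ P Q : BasedModule Λ,
      Nonempty (Isometry Z (v.1.sum (QForm.hyp ε P)) (w.1.sum (QForm.hyp ε Q))))
    ⟨fun _ => ⟨BasedModule.std Λ 0, BasedModule.std Λ 0, ⟨.refl _⟩⟩,
      fun ⟨P, Q, ⟨f⟩⟩ => ⟨Q, P, ⟨f.symm⟩⟩, fun h h' => HypRel.trans h h'⟩ ⟨v, hv⟩ ⟨w, hw⟩

variable [hZ : Fact (StarInvariant Z)]

/-- Every operation in the definition of $\delta$ changes the union only by an isomorphism of pairs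
or a hyperbolic pair, and the union along $f_j$ is $(M,\psi;V)$. With the injectivity of
`SBIso.pairClass` this makes $\delta$ independent of all choices. -/
theorem pairClass_of_isDelta {v v' : QForm Λ ε} {ξ : LMonoid Z ε} {s : SBIso Z v v'}
    (h : IsDelta v v' ξ s) : s.pairClass = ξ.pairClass := by
  obtain ⟨x, p, f, Q, n, B, k, l, rfl, hf, rfl⟩ := h
  obtain ⟨T⟩ := nonempty_pair_of_isBoundaryIso hf
  obtain ⟨S⟩ := f.nonempty_pair_stab Q
  obtain ⟨R⟩ := (f.stab Q).nonempty_pair_conj k l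
  exact PairClass.eq_iff.2 ((Near.of_iso ((S.trans R).symm.trans (T.sum (.refl _)))).trans
    (Near.sum_hyp _ _))

/-- The half rank condition is what allows the same `Q` and the same standard module to serve for
$V$ and $V^\perp$ in the definition of $\delta$. -/
theorem QuasiFormation.Perp.rank_eq {x : QuasiFormation Z ε} (p : x.Perp) :
    p.W.rank = x.V.rank := by
  obtain ⟨s, e, -, -, -⟩ := p.based.based
  have h1 := BasedModule.rank_eq (M := p.W.prod x.V.dual) (N := x.form.M) e
  rw [BasedModule.rank_prod] at h1
  have h2 : x.V.dual.rank = x.V.rank := rfl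
  have h3 := x.half
  omega

/-- Zero forms can be added to two stable isometries so that they take place over one standard
module. -/
theorem exists_common_stab {a b v : QForm Λ ε} (hr : a.M.rank = b.M.rank) (ha : ZSRel Z a v)
    (hb : ZSRel Z b v) : ∃ (Q : BasedModule Λ) (n : ℕ),
      Nonempty (Isometry Z (a.sum (QForm.zeroForm ε Q)) (v.stab (SBasis.std Λ n))) ∧
      Nonempty (Isometry Z (b.sum (QForm.zeroForm ε Q)) (v.stab (SBasis.std Λ n))) := by
  obtain ⟨P, R, ⟨f⟩⟩ := ha
  obtain ⟨P', R', ⟨f'⟩⟩ := hb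
  -- One complement for both modules. Each given isometry is stabilised by the zero form that the
  -- other one uses on its source, so that both have source module $P\oplus P'\oplus\Lambda^m$ up to
  -- order; the equality of ranks then makes the targets agree.
  let m := (R.prod P').m + (R'.prod P).m
  let S := BasedModule.std Λ m
  obtain ⟨n, ⟨r⟩⟩ := SEquiv.exists_std (Z := Z) (R.prod P') m (by omega)
  obtain ⟨n', ⟨r'⟩⟩ := SEquiv.exists_std (Z := Z) (R'.prod P) m (by omega)
  have hn : n = n' := by
    have e1 := BasedModule.rank_eq (M := (R.prod P').prod S) (N := BasedModule.std Λ n) r.e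
    have e2 := BasedModule.rank_eq (M := (R'.prod P).prod S) (N := BasedModule.std Λ n') r'.e
    have e3 := BasedModule.rank_eq (M := a.M.prod P) (N := v.M.prod R) f.e
    have e4 := BasedModule.rank_eq (M := b.M.prod P') (N := v.M.prod R') f'.e
    have e5 : ∀ j, (BasedModule.std Λ j).rank = j := fun j => by simp [BasedModule.rank]
    simp only [BasedModule.rank_prod, e5] at e1 e2 e3 e4
    omega
  subst hn
  have zero : ∀ {A B : BasedModule Λ} (e : SEquiv Z A B), Isometry Z (QForm.zeroForm ε A)
    (QForm.zeroForm ε B) := fun e => Isometry.zero e.e e.simple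
  have stable : ∀ {c : QForm Λ ε} {A B C : BasedModule Λ} {n : ℕ}
      (g : Isometry Z (c.sum (QForm.zeroForm ε A)) (v.sum (QForm.zeroForm ε B)))
      (e : SEquiv Z ((B.prod C).prod S) (BasedModule.std Λ n)),
      Nonempty (Isometry Z (c.sum (QForm.zeroForm ε (A.prod (C.prod S))))
        (v.stab (SBasis.std Λ n))) := by
    intro c A B C n g e
    obtain ⟨z⟩ := Isometry.nonempty_zeroProd (Z := Z) ε A (C.prod S)
    obtain ⟨z'⟩ := Isometry.nonempty_zeroProd (Z := Z) ε B (C.prod S)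
    exact ⟨((Isometry.refl c).sum z.symm).trans <| (Isometry.assoc _ _ _).symm.trans <|
      (g.sum (.refl _)).trans <| (Isometry.assoc _ _ _).trans <|
      (Isometry.refl v).sum (z'.trans (zero ((SEquiv.prodAssoc Z B C S).symm.trans e)))⟩
  obtain ⟨g⟩ := stable f r
  obtain ⟨g'⟩ := stable f' r'
  let e : SEquiv Z (P.prod (P'.prod S)) (P'.prod (P.prod S)) :=
    (SEquiv.prodAssoc Z _ _ _).symm.trans (((SEquiv.prodComm Z P P').prod (.refl S)).trans
      (SEquiv.prodAssoc Z _ _ _))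
  exact ⟨P.prod (P'.prod S), n, ⟨g⟩, ⟨((Isometry.refl b).sum (zero e)).trans g'⟩⟩

theorem exists_isDelta {v : QForm Λ ε} {ξ : LMonoid Z ε}
    (h : IsB ξ (ZSForm.mk Z v, ZSForm.mk Z v)) : ∃ s, IsDelta v v ξ s := by
  obtain ⟨x, p, hx, hb⟩ := h
  obtain ⟨f, hf⟩ := exists_isBoundaryIso x p
  obtain ⟨Q, n, ⟨k⟩, ⟨l⟩⟩ := exists_common_stab (a := x.vform) (b := QuasiFormation.pform p)
    p.rank_eq.symm (ZSForm.eq_iff.1 (congrArg Prod.fst hb)) (ZSForm.eq_iff.1 (congrArg Prod.snd hb))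
  exact ⟨_, x, p, f, Q, n, _, k, l, hx, hf, rfl⟩

theorem unionForm_hypRel {v v' w w' : QForm Λ ε}
    {f : StableIso Z (SplitFormation.boundary v) (SplitFormation.boundary v')}
    {f' : StableIso Z (SplitFormation.boundary w) (SplitFormation.boundary w')}
    (h : Near Z f.pair f'.pair) : HypRel Z (unionForm f) (unionForm f') := by
  obtain ⟨P, Q, ⟨T⟩⟩ := h
  rw [unionForm_eq, unionForm_eq]
  exact ⟨P, Q, ⟨T.f⟩⟩

/-- The value is taken on a chosen representative. The form of the pair is determined up to
hyperbolic forms by the pair class, so any other representative gives the same element. -/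
theorem exists_isKappa (v v' : QForm Λ ε) : ∃ κ : SBIso Z v v' → SimpleLEven Z ε,
    IsKappa v v' κ := by
  refine ⟨fun s => SimpleLEven.mk (unionForm s.exists_mk.choose_spec.choose_spec.choose)
    (unionForm_isSimpleForm _), fun k B f => ⟨unionForm_isSimpleForm f, ?_⟩⟩
  refine (SimpleLEven.eq_iff _ _).2 (unionForm_hypRel (PairClass.eq_iff.1 ?_))
  exact congrArg SBIso.pairClass (SBIso.mk B f).exists_mk.choose_spec.choose_spec.choose_spec

theorem IsSimpleLagrangian.hypRel_zero {v : QForm Λ ε} {L : BasedModule Λ} {j : L →ₗ[Λ] v.M}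
    (h : IsSimpleLagrangian Z v L j) : HypRel Z v (QForm.hyp ε (BasedModule.std Λ 0)) := by
  obtain ⟨T⟩ := h.exists_pairIso
  exact ⟨BasedModule.std Λ 0, L, ⟨(T.f.symm.sum (.refl _)).trans (.comm _ _)⟩⟩

theorem HypRel.of_isometry_sum {v w : QForm Λ ε} {P Q : BasedModule Λ}
    (T : Isometry Z (v.sum (QForm.hyp ε P)) (w.sum (QForm.hyp ε Q))) : HypRel Z v w :=
  ⟨P, Q, ⟨T⟩⟩

/-- A quasi-formation whose pair is the union along `f`, if that union is stably hyperbolic. -/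
theorem exists_quasiFormation_of_union {v v' : QForm Λ ε} (hr : v.M.rank = v'.M.rank)
    (f : StableIso Z (SplitFormation.boundary v) (SplitFormation.boundary v'))
    (hf : HypRel Z (unionForm f) (QForm.hyp ε (BasedModule.std Λ 0))) :
    ∃ ξ : LMonoid Z ε, ξ.pairClass = PairClass.mk Z f.pair ∧
      IsB ξ (ZSForm.mk Z v, ZSForm.mk Z v') := by
  obtain ⟨P, Q, ⟨T⟩⟩ := hf
  rw [unionForm_eq] at T
  have hU := unionOf_isSimpleForm f
  -- The hyperbolic form on the other side of `T` has an evident Lagrangian. Pulled back along `T`,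
  -- it becomes the Lagrangian of the quasi-formation.
  have hL := ((IsSimpleLagrangian.hyp (Z := Z) (ε := ε) (BasedModule.std Λ 0)).sum
    (IsSimpleLagrangian.hyp Q)).map T.symm
  let x : QuasiFormation Z ε :=
    { form := (unionOf v v' f.f.corner f.f.cornerQ).sum (QForm.hyp ε P)
      simple := hU.sum (QForm.hyp_isSimpleForm P)
      L := _
      jL := _
      lagrangian := hL
      V := v.M.prod P
      jV := (LinearMap.inl Λ v.M (SDual Λ v'.M)).prodMap (LinearMap.inl Λ P (SDual Λ P))
      split := ⟨(LinearMap.fst Λ v.M (SDual Λ v'.M)).prodMap (LinearMap.fst Λ P (SDual Λ P)),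
        fun _ => rfl⟩
      half := by
        have h1 : v'.M.dual.rank = v'.M.rank := rfl
        have h2 : P.dual.rank = P.rank := rfl
        change 2 * (v.M.prod P).rank = ((v.M.prod v'.M.dual).prod (P.prod P.dual)).rank
        simp only [BasedModule.rank_prod]
        omega }
  let p : x.Perp := ⟨v'.M.prod P, _, (f.f.basedExact_perp hU).sum_hyp hU P⟩
  refine ⟨LMonoid.mk x, PairClass.eq_iff.2 (Near.sum_hyp f.pair P), x, p, rfl, Prod.ext ?_ ?_⟩
  · refine (ZSForm.mk_restrict_sum_hyp _ _ P).trans ?_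
    refine congrArg (fun q => ZSForm.mk Z (⟨v.M, q⟩ : QForm Λ ε)) ?_
    refine (pull_unionOf _ _ _ LinearMap.id 0 (fun _ => rfl) (fun _ => rfl)).trans ?_
    rw [QGrp.pairing_zero_left, QGrp.pull_zero, QGrp.pull_id, add_zero, sub_zero]
  · refine (ZSForm.mk_neg_restrict_sum_hyp _ _ P).trans ?_
    refine congrArg (fun q => ZSForm.mk Z (⟨v'.M, q⟩ : QForm Λ ε)) ?_
    refine (congrArg Neg.neg f.f.pull_perp).trans (neg_neg _)

/-! ### Doubles and elementary classes. -/

section Elementary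

/-- The union of `w` and `-w` along the identity. -/
abbrev doublePair (w : QForm Λ ε) : QPair Λ ε := unionPair w w LinearMap.id 0

theorem doublePair_isometry {w w' : QForm Λ ε} (k : Isometry Z w w') :
    Nonempty (PairIso Z (doublePair w) (doublePair w')) := by
  have h := nonempty_unionPair_conj (Z := Z) LinearMap.id (0 : QGrp Λ ε (SDual Λ w.M)) k k
  have h1 : k.e.toLinearMap.comp ((LinearMap.id : w.M →ₗ[Λ] w.M).comp k.e.symm.toLinearMap) =
      LinearMap.id := LinearMap.ext fun x => k.e.apply_symm_apply x
  rwa [h1, map_zero] at h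

theorem doublePair_sum_zero (w : QForm Λ ε) (P : BasedModule Λ) :
    Near Z (doublePair (w.sum (QForm.zeroForm ε P))) (doublePair w) := by
  have h := nonempty_unionPair_stab (Z := Z) LinearMap.id (0 : QGrp Λ ε (SDual Λ w.M)) P
  have h1 : (LinearMap.id : w.M →ₗ[Λ] w.M).prodMap (LinearMap.id : P →ₗ[Λ] P) =
      LinearMap.id := LinearMap.prodMap_id
  rw [map_zero, h1] at h
  obtain ⟨T⟩ := h
  exact (Near.of_iso T.symm).trans (Near.sum_hyp _ _)

/-- Isometries extend to doubles, and a zero form contributes only a hyperbolic pair to the double.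
-/
theorem doublePair_of_ZSRel {w w' : QForm Λ ε} (h : ZSRel Z w w') :
    Near Z (doublePair w) (doublePair w') := by
  obtain ⟨P, Q, ⟨k⟩⟩ := h
  obtain ⟨T⟩ := doublePair_isometry k
  exact (doublePair_sum_zero w P).symm.trans ((Near.of_iso T).trans (doublePair_sum_zero w' Q))

/-- The shear $(x,u)\mapsto(x,u+\rho x)$ carries $K$ to the graph of $\rho$, and it pulls the
hyperbolic form back to $\rho$ on $K$ plus the evaluation of $K^*$ on $K$, which is the double. -/
theorem nonempty_doublePair_boundary (K : BasedModule Λ) (ρ : K →ₗ[Λ] SDual Λ K) :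
    Nonempty (PairIso Z (doublePair ⟨K, QGrp.mk ε ρ⟩) (QuasiFormation.boundary Z ε K ρ).pair) := by
  let E : SEquiv Z (K.prod K.dual) (K.prod K.dual) := SEquiv.shear Z ρ
  refine ⟨⟨⟨E.e, E.simple, ?_⟩, .refl K, fun a => Prod.ext rfl ?_⟩⟩
  · let p1 := LinearMap.fst Λ K (SDual Λ K)
    let p2 := LinearMap.snd Λ K (SDual Λ K)
    have h1 : QGrp.pull E.e.toLinearMap (QForm.hyp ε K).q =
        QGrp.pairing ε (p2 + ρ.comp p1) p1 := rfl
    have h2 : (doublePair ⟨K, QGrp.mk ε ρ⟩ : QPair Λ ε).form.q =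
        QGrp.pairing ε (ρ.comp p1) p1 + QGrp.pairing ε p2 p1 - QGrp.pull p2 0 := rfl
    refine h1.trans (Eq.trans ?_ h2.symm)
    rw [QGrp.pairing_add_left, map_zero, sub_zero, add_comm]
  · exact zero_add _

theorem pairClass_one (v : QForm Λ ε) :
    (1 : SBIso Z v v).pairClass = PairClass.mk Z (doublePair v) := by
  have h1 : (1 : SBIso Z v v).pairClass = PairClass.mk Z (StableIso.pair (Z := Z)
    (StableIso.refl (SplitFormation.boundary (v.stab (SBasis.std Λ 0))))) := rfl
  rw [h1, StableIso.pair, StableIso.corner_refl, StableIso.cornerQ_refl]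
  exact PairClass.eq_iff.2 (doublePair_sum_zero v _)

theorem pairClass_boundary (K : BasedModule Λ) (ρ : K →ₗ[Λ] SDual Λ K) :
    (LMonoid.mk (QuasiFormation.boundary Z ε K ρ)).pairClass =
      PairClass.mk Z (doublePair ⟨K, QGrp.mk ε ρ⟩) :=
  PairClass.eq_iff.2 (Near.of_iso (nonempty_doublePair_boundary K ρ).some.symm)

theorem isB_boundary_fst {K : BasedModule Λ} {ρ : K →ₗ[Λ] SDual Λ K}
    {s : ZSForm Z ε × ZSForm Z ε} (h : IsB (LMonoid.mk (QuasiFormation.boundary Z ε K ρ)) s) :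
    s.1 = ZSForm.mk Z ⟨K, QGrp.mk ε ρ⟩ := by
  obtain ⟨p⟩ := (QuasiFormation.boundary Z ε K ρ).nonempty_perp
  have h1 := isB_unique rfl h ⟨QuasiFormation.boundary Z ε K ρ, p, rfl, rfl⟩
  rw [h1]
  rfl

end Elementary

theorem exact_sequence (v : QForm Λ ε) :
    ∃ (b : LMonoid Z ε → ZSForm Z ε × ZSForm Z ε)
      (δ : {ξ : LMonoid Z ε // b ξ = (ZSForm.mk Z v, ZSForm.mk Z v)} → SBIso Z v v)
      (κ : SBIso Z v v → SimpleLEven Z ε),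
      (∀ ξ s, b ξ = s ↔ IsB ξ s) ∧
      (∀ ξ s, δ ξ = s ↔ IsDelta v v ξ.1 s) ∧
      IsKappa v v κ ∧
      (∀ ξ z, b ξ = (ZSForm.mk Z v, ZSForm.mk Z v) → z ∈ LMonoid.simpleL Z ε →
        b (ξ + z) = (ZSForm.mk Z v, ZSForm.mk Z v)) ∧
      (∀ ξ ξ', δ ξ = δ ξ' ↔ ∃ z ∈ LMonoid.simpleL Z ε, ξ'.1 = ξ.1 + z) ∧
      Set.range δ = κ ⁻¹' {0} ∧
      (∀ ξ, δ ξ = 1 ↔ ∃ z ∈ LMonoid.simpleL Z ε, ξ.1 + z ∈ LMonoid.elementary Z ε) := by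
  choose b hb using exists_isB (Z := Z) (ε := ε)
  have hb' : ∀ ξ s, b ξ = s ↔ IsB ξ s := fun ξ s =>
    ⟨fun h => h ▸ hb ξ, fun h => isB_unique rfl (hb ξ) h⟩
  have hδ : ∀ ξ : {ξ : LMonoid Z ε // b ξ = (ZSForm.mk Z v, ZSForm.mk Z v)},
      ∃ s, IsDelta v v ξ.1 s := fun ξ => exists_isDelta ((hb' _ _).1 ξ.2)
  choose δ hδ using hδ
  obtain ⟨κ, hκ⟩ := exists_isKappa (Z := Z) v v
  have hδp : ∀ ξ, (δ ξ).pairClass = ξ.1.pairClass := fun ξ => pairClass_of_isDelta (hδ ξ)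
  have hadd : ∀ (ξ z : LMonoid Z ε), z ∈ LMonoid.simpleL Z ε →
      ξ.pairClass = (ξ + z).pairClass := fun ξ z hz => LMonoid.pairClass_eq_iff.2 ⟨z, hz, rfl⟩
  have hbadd : ∀ (ξ z : LMonoid Z ε), z ∈ LMonoid.simpleL Z ε → b ξ = b (ξ + z) := fun ξ z hz =>
    isB_unique (hadd ξ z hz) (hb _) (hb _)
  refine ⟨b, δ, κ, hb', fun ξ s => ⟨fun h => h ▸ hδ ξ, fun h => ?_⟩, hκ,
    fun ξ z h hz => (hbadd ξ z hz).symm.trans h, fun ξ ξ' => ?_, ?_, fun ξ => ?_⟩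
  -- Any two values of the relation `IsDelta` have the pair class of `ξ`, so they coincide.
  · exact SBIso.pairClass_injective ((hδp ξ).trans (pairClass_of_isDelta h).symm)
  · rw [← LMonoid.pairClass_eq_iff, ← hδp, ← hδp]
    exact ⟨fun h => congrArg _ h, fun h => SBIso.pairClass_injective h⟩
  · ext s
    obtain ⟨k, B, f, rfl⟩ := s.exists_mk
    obtain ⟨hf, hκf⟩ := hκ k B f
    have h0 : SBIso.mk B f ∈ κ ⁻¹' {0} ↔
        HypRel Z (unionForm f) (QForm.hyp ε (BasedModule.std Λ 0)) := by
      rw [Set.mem_preimage, hκf]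
      exact SimpleLEven.eq_iff hf (QForm.hyp_isSimpleForm _)
    rw [h0]
    constructor
    · rintro ⟨ξ, hξ⟩
      have h1 := hδp ξ
      rw [hξ] at h1
      obtain ⟨x, hx⟩ : ∃ x, LMonoid.mk x = ξ.1 := Quot.exists_rep ξ.1
      rw [← hx] at h1
      -- The union agrees with the form of `x` up to hyperbolic forms, and that form is hyperbolic
      -- because of its Lagrangian.
      obtain ⟨P, Q, ⟨T⟩⟩ : Near Z f.pair x.pair := PairClass.eq_iff.1 h1
      rw [unionForm_eq]
      exact HypRel.trans (HypRel.of_isometry_sum T.f) x.lagrangian.hypRel_zero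
    · intro h
      obtain ⟨ξ, h1, h2⟩ := exists_quasiFormation_of_union rfl f h
      rw [ZSForm.mk_sum_zero] at h2
      exact ⟨⟨ξ, (hb' _ _).2 h2⟩, SBIso.pairClass_injective ((hδp _).trans h1)⟩
  · constructor
    · intro h
      have h1 := hδp ξ
      rw [h, pairClass_one] at h1
      -- Any representative of the form of $v$ will do: the double of $v$ is the pair of the
      -- elementary quasi-formation of `ρ`, so the two classes differ by a simple formation.
      obtain ⟨ρ, hρ⟩ := QGrp.mk_surjective v.q
      have h2 : ξ.1.pairClass = (LMonoid.mk (QuasiFormation.boundary Z ε v.M ρ)).pairClass := by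
        rw [pairClass_boundary, hρ, ← h1]
      obtain ⟨z, hz, h3⟩ := LMonoid.pairClass_eq_iff.1 h2
      exact ⟨z, hz, v.M, ρ, h3⟩
    · rintro ⟨z, hz, K, ρ, h⟩
      refine SBIso.pairClass_injective ?_
      rw [hδp, hadd ξ.1 z hz, ← h, pairClass_boundary, pairClass_one]
      -- The form $(K,[\rho])$ need not be $v$. Since $b$ is invariant under the action, its first
      -- component gives $[K,\rho]=[v]$ as $0$-stabilised forms, and this suffices for the doubles.
      have h1 := hb (ξ.1 + z)
      rw [← hbadd ξ.1 z hz, ξ.2, ← h] at h1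
      have h2 : ZSForm.mk Z v = ZSForm.mk Z ⟨K, QGrp.mk ε ρ⟩ := isB_boundary_fst h1
      exact PairClass.eq_iff.2 (doublePair_of_ZSRel (ZSForm.eq_iff.1 h2.symm))

end ExactSequence

end QuadL

theorem mainTheorem2 (Λ : Type u) [Ring Λ] [StarRing Λ] [InvariantBasisNumber Λ]
    (Z : AddSubgroup (RedK1 Λ)) (hZ : StarInvariant Z) (q : ℕ) (hq : 0 < q)
    (v : QForm Λ ((-1) ^ q)) :
    ∃ (b : LMonoid Z ((-1) ^ q) → ZSForm Z ((-1) ^ q) × ZSForm Z ((-1) ^ q))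
      (δ : {ξ : LMonoid Z ((-1) ^ q) // b ξ = (ZSForm.mk Z v, ZSForm.mk Z v)} → SBIso Z v v)
      (κ : SBIso Z v v → SimpleLEven Z ((-1) ^ q)),
      -- the maps `b`, `δ` and `κ` are well defined, and are the ones of the theory
      (∀ ξ s, b ξ = s ↔ IsB ξ s) ∧
      (∀ ξ s, δ ξ = s ↔ IsDelta v v ξ.1 s) ∧
      IsKappa v v κ ∧
      -- `L^s_{2q+1}(Λ)` acts on `l_{2q+1}(v, v)`
      (∀ ξ z, b ξ = (ZSForm.mk Z v, ZSForm.mk Z v) → z ∈ LMonoid.simpleL Z ((-1) ^ q) →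
        b (ξ + z) = (ZSForm.mk Z v, ZSForm.mk Z v)) ∧
      -- the orbits of the action are the fibres of `δ`
      (∀ ξ ξ', δ ξ = δ ξ' ↔ ∃ z ∈ LMonoid.simpleL Z ((-1) ^ q), ξ'.1 = ξ.1 + z) ∧
      -- `im δ = κ⁻¹(0)`
      Set.range δ = κ ⁻¹' {0} ∧
      -- `δ [x] = 1` if and only if `[x]` is elementary modulo the action
      (∀ ξ, δ ξ = 1 ↔ ∃ z ∈ LMonoid.simpleL Z ((-1) ^ q),
        ξ.1 + z ∈ LMonoid.elementary Z ((-1) ^ q)) := by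
  have : Fact (StarInvariant Z) := ⟨hZ⟩
  exact exact_sequence v
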